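/- Let $M$ be a smooth (Hausdorff) manifold of dimension $m>2$ with a smooth symmetric $(0,2)$-tensor field $g=\langle\cdot,\cdot\rangle$ which is degenerate exactly on a non-empty set $\Sigma$. Assume that $(M,g)$ is a *transverse Riemann–Lorentz space with tangent radical*: in all local coordinates $\det(g_{ab})$ has non-zero differential at its zeros (so $\Sigma$ is a smooth hypersurface and the radical $Rad_p=T_pM^{\perp}$ is a line for $p\in\Sigma$); $Rad_p\subset T_p\Sigma$ for $p\in\Sigma$; and $g$ changes from positive definite to Lorentzian across $\Sigma$. Let $\square_{\mathcal A}\mathcal B(\mathcal C)$ be defined by the Koszul formula $$2\,\square_{\mathcal A}\mathcal B(\mathcal C)=\mathcal A\langle\mathcal B,\mathcal C\rangle+\mathcal B\langle\mathcal C,\mathcal A\rangle-\mathcal C\langle\mathcal A,\mathcal B\rangle+\langle[\mathcal A,\mathcal B],\mathcal C\rangle-\langle[\mathcal B,\mathcal C],\mathcal A\rangle+\langle[\mathcal C,\mathcal A],\mathcal B\rangle .$$ Let $\nabla$ be the Levi-Civita connection of $g$ on $M\setminus\Sigma$, with $R(\mathcal A,\mathcal B)\mathcal C=\nabla_{\mathcal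 A}\nabla_{\mathcal B}\mathcal C-\nabla_{\mathcal B}\nabla_{\mathcal A}\mathcal C-\nabla_{[\mathcal A,\mathcal B]}\mathcal C$, and let $Ric(\mathcal A,\mathcal B)=\operatorname{tr}\bigl(z\mapsto R(\mathcal A,z)\mathcal B\bigr)$ on $M\setminus\Sigma$. Work on an open set $U\subset M$ that meets $\Sigma$; fields, functions and conditions below are over $U$ and $\Sigma\cap U$, respectively. Let $N$ (the main normal) and $R$ (the main radical field) be smooth vector fields along $\Sigma$ with $N\perp T\Sigma$, $\langle N,N\rangle=1$, $R\in Rad$, $II(N,N)=0$ and $\mathcal H(R,R)=-1$, where $$II(A,B)=\square_{\mathcal A}\mathcal B(R)\quad\text{and}\quad \mathcal H(X,Y)=\square_{\mathcal X}\mathcal Y(N)\quad (X,Y\text{ tangent to }\Sigma)$$ (these depend only on the fields along $\Sigma$). The screen distribution is $S=\{v\in T\Sigma:\mathcal H(v,R)=0\}$, with smooth sections $\Gamma(S)$. For $A$ along $\Sigma$ put $\nu(A)=\langle A,N\rangle$ and $\rho(A)=-\mathcal H(A-\nu(A)N,R)$. Let $\mathcal N$ be the canonical extension of $N$, i.e.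 the smooth extension with $\nabla_{\mathcal N}\mathcal N=0$ off $\Sigma$; the canonical extension of a field $A$ along $\Sigma$ is the smooth extension $\mathcal A$ with $[\mathcal N,\mathcal A]=0$. Let $\mathcal R$ be the canonical extension of $R$ and $\tau=\langle\mathcal R,\mathcal R\rangle$. The set $\Sigma$ is *$II$-flat* if $II(V,W)=0$ for all $V,W\in\Gamma(S)$. If $\Sigma$ is $II$-flat, then for $\mathcal X,\mathcal Y$ tangent to $\Sigma$ the field $\nabla_{\mathcal X}\mathcal Y$ extends smoothly across $\Sigma$ and $III(X,Y,Z)=II(\nabla_{\mathcal X}\mathcal Y|_\Sigma,Z)$; $\Sigma$ is *$III$-flat* if it is $II$-flat and $III(V,W,R)=0$ for all $V,W\in\Gamma(S)$. For a function $f$ on $U\setminus\Sigma$ write $f\cong 0$ if $f$ extends to a smooth function on $U$. Then: (a) $Ric(\mathcal N',\mathcal N')\not\cong0$ for every smooth extension $\mathcal N'$ of $N$. (b) If $V\in\Gamma(S)$ has canonical extension $\mathcal V$, and $\mathcal V'=\mathcal V+\tau\bar{\mathcal V}$ with $\bar{\mathcal V}$ smooth, then for every smooth extension $\mathcal N'$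 of $N$: $Ric(\mathcal N',\mathcal V')\cong0$ if and only if $\rho([V,R])+\nu(\bar V)=0$ on $\Sigma$, where $\bar V=\bar{\mathcal V}|_\Sigma$. (c) If $\Sigma$ is $II$-flat and $\mathcal R'=\mathcal R+\tau\bar{\mathcal R}$ with $\bar{\mathcal R}$ smooth, then for every smooth extension $\mathcal N'$ of $N$: $Ric(\mathcal N',\mathcal R')\cong0$ if and only if $\nu(\bar R)=0$ on $\Sigma$, where $\bar R=\bar{\mathcal R}|_\Sigma$. (d) $Ric(\mathcal R',\mathcal V')\cong0$ for all $V\in\Gamma(S)$ and all smooth extensions $\mathcal R',\mathcal V'$ of $R,V$. (e) $Ric(\mathcal R',\mathcal R')\not\cong0$ for every smooth extension $\mathcal R'$ of $R$. (f) If $\Sigma$ is $II$-flat, then, whatever smooth extensions $\mathcal V'$, $\mathcal W'$ are chosen for the sections $V,W$: $Ric(\mathcal V',\mathcal W')\cong0$ for all $V,W\in\Gamma(S)$ if and only if $\Sigma$ is $III$-flat. -/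

import Mathlib

open scoped Manifold ContDiff Topology

noncomputable section

namespace RiemannLorentz

/-- Vector fields on `M`; smoothness is always imposed separately (`SmoothOn`). A vector field
along a subset is represented by a vector field on a neighbourhood of it. -/
abbrev VField (m : ℕ) (M : Type*) [TopologicalSpace M]
    [ChartedSpace (EuclideanSpace ℝ (Fin m)) M] : Type _ :=
  (p : M) → TangentSpace (𝓡 m) p

/-- A smooth symmetric `(0,2)`-tensor field, possibly degenerate. -/
structure SymTensor (m : ℕ) (M : Type*) [TopologicalSpace M]
    [ChartedSpace (EuclideanSpace ℝ (Fin m)) M] [IsManifold (𝓡 m) ∞ M] where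
  form : (p : M) → TangentSpace (𝓡 m) p →L[ℝ] TangentSpace (𝓡 m) p →L[ℝ] ℝ
  symm : ∀ (p : M) (v w : TangentSpace (𝓡 m) p), form p v w = form p w v
  contMDiff : ContMDiff (𝓡 m)
    ((𝓡 m).prod 𝓘(ℝ, EuclideanSpace ℝ (Fin m) →L[ℝ] EuclideanSpace ℝ (Fin m) →L[ℝ] ℝ)) ∞
    (fun p ↦ Bundle.TotalSpace.mk'
      (EuclideanSpace ℝ (Fin m) →L[ℝ] EuclideanSpace ℝ (Fin m) →L[ℝ] ℝ) p (form p))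

variable {m : ℕ} {M : Type*} [TopologicalSpace M] [ChartedSpace (EuclideanSpace ℝ (Fin m)) M]
  [IsManifold (𝓡 m) ∞ M]

/-- The vector field `A` is smooth on `U`. -/
def SmoothOn (A : VField m M) (U : Set M) : Prop :=
  ContMDiffOn (𝓡 m) (𝓡 m).tangent ∞ (fun p ↦ (⟨p, A p⟩ : TangentBundle (𝓡 m) M)) U

/-- The vector field `A` is smooth at `p`. -/
def SmoothAt (A : VField m M) (p : M) : Prop :=
  ContMDiffAt (𝓡 m) (𝓡 m).tangent ∞ (fun q ↦ (⟨q, A q⟩ : TangentBundle (𝓡 m) M)) p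

/-- The derivative `A(f)` of the function `f` along the vector field `A`. -/
def dirDeriv (A : VField m M) (f : M → ℝ) (p : M) : ℝ :=
  mfderiv (𝓡 m) 𝓘(ℝ, ℝ) f p (A p)

/-- The Lie bracket `[A, B]`. -/
def bracket (A B : VField m M) : VField m M :=
  VectorField.mlieBracket (𝓡 m) A B

namespace SymTensor

variable (g : SymTensor m M)

/-- The function `⟨A, B⟩`. -/
def pair (A B : VField m M) (p : M) : ℝ := g.form p (A p) (B p)

/-! ### The singular hypersurface -/

/-- The radical of `g` at `p`. -/
def rad (p : M) : Set (TangentSpace (𝓡 m) p) := {v | ∀ w, g.form p v w = 0}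

/-- The set `Σ` of points where `g` is degenerate. -/
def sing : Set M := {p | ∃ v ∈ g.rad p, v ≠ 0}

/-- The function `det (g_ab)` in the local coordinates `φ`. -/
def gramDet (φ : OpenPartialHomeomorph M (EuclideanSpace ℝ (Fin m)))
    (y : EuclideanSpace ℝ (Fin m)) : ℝ :=
  Matrix.det (Matrix.of fun a b : Fin m ↦
    g.form (φ.symm y)
      (mfderiv (𝓡 m) (𝓡 m) φ.symm y (EuclideanSpace.single a (1 : ℝ)))
      (mfderiv (𝓡 m) (𝓡 m) φ.symm y (EuclideanSpace.single b (1 : ℝ))))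

/-- The tangent space `T_pΣ`: the vectors annihilated by the differentials of all smooth functions
vanishing on `Σ` near `p`. -/
def tangentSing (p : M) : Set (TangentSpace (𝓡 m) p) :=
  {v | ∀ f : M → ℝ, ContMDiffAt (𝓡 m) 𝓘(ℝ, ℝ) ∞ f p → (∀ᶠ q in 𝓝[g.sing] p, f q = 0) →
    mfderiv (𝓡 m) 𝓘(ℝ, ℝ) f p v = 0}

/-- `g` is positive definite at `p`. -/
def RiemannAt (p : M) : Prop := ∀ v : TangentSpace (𝓡 m) p, v ≠ 0 → 0 < g.form p v v

/-- `g` is a Lorentz form (nondegenerate of index one) at `p`. -/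
def LorentzAt (p : M) : Prop :=
  ∃ u : TangentSpace (𝓡 m) p, g.form p u u < 0 ∧
    ∀ v : TangentSpace (𝓡 m) p, v ≠ 0 → g.form p u v = 0 → 0 < g.form p v v

/-- `(M, g)` is a transverse Riemann-Lorentz space with tangent radical. -/
structure IsTransverseRiemannLorentz : Prop where
  nonempty : g.sing.Nonempty
  transverse : ∀ φ ∈ IsManifold.maximalAtlas (𝓡 m) ∞ M, ∀ y ∈ φ.target,
    g.gramDet φ y = 0 → fderiv ℝ (g.gramDet φ) y ≠ 0
  tangent_radical : ∀ p ∈ g.sing, g.rad p ⊆ g.tangentSing p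
  riemann_to_lorentz : ∀ p ∈ g.sing,
    p ∈ closure {q | g.RiemannAt q} ∧ p ∈ closure {q | g.LorentzAt q}

/-! ### The dual connection, the Levi-Civita connection and the Ricci curvature -/

/-- The dual connection `□_A B (C)`, given by the Koszul formula. -/
def dual (A B C : VField m M) (p : M) : ℝ :=
  (1 / 2 : ℝ) *
    (dirDeriv A (g.pair B C) p + dirDeriv B (g.pair C A) p - dirDeriv C (g.pair A B) p
      + g.pair (bracket A B) C p - g.pair (bracket B C) A p + g.pair (bracket C A) B p)

open Classical in
/-- The Levi-Civita covariant derivative `∇_A B` at a point outside `Σ`: the vector `v` with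
`⟨v, C⟩ = □_A B (C)` for all `C`. (Unique where `g` is nondegenerate; not used on `Σ`.) -/
def nabla (A B : VField m M) : VField m M := fun p ↦
  if h : ∃ v : TangentSpace (𝓡 m) p, ∀ C : VField m M, SmoothAt C p →
      g.form p v (C p) = g.dual A B C p
  then h.choose else 0

/-- The Levi-Civita curvature `R(A, B) C` outside `Σ`. -/
def curv (A B C : VField m M) : VField m M := fun p ↦
  g.nabla A (g.nabla B C) p - g.nabla B (g.nabla A C) p - g.nabla (bracket A B) C p

open Classical in
/-- The Ricci curvature `Ric(A, B)` at a point outside `Σ`: the trace of the endomorphism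
`z ↦ R(A, z) B` of the tangent space, i.e. `∑ i, ⟨R(A, E i) B, E i⟩ / ⟨E i, E i⟩` in any
orthogonal frame. -/
def ric (A B : VField m M) (p : M) : ℝ :=
  if h : ∃ T : TangentSpace (𝓡 m) p →ₗ[ℝ] TangentSpace (𝓡 m) p, ∀ Z : VField m M, SmoothAt Z p →
      T (Z p) = g.curv A Z B p
  then LinearMap.trace ℝ (TangentSpace (𝓡 m) p) h.choose else 0

/-- The function `f` on `U ∖ Σ` has a good limit on `Σ ∩ U`: it extends to a smooth
function on `U`. -/
def GoodLimit (U : Set M) (f : M → ℝ) : Prop :=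
  ∃ F : M → ℝ, ContMDiffOn (𝓡 m) 𝓘(ℝ, ℝ) ∞ F U ∧ ∀ p ∈ U \ g.sing, F p = f p

/-- `A'` is a smooth extension to `U` of the restriction of `A` to `Σ ∩ U`. -/
def IsExtension (U : Set M) (A' A : VField m M) : Prop :=
  SmoothOn A' U ∧ ∀ p ∈ g.sing ∩ U, A' p = A p

/-! ### Fundamental forms of `Σ`, the main normal `N` and the main radical field `R` -/

/-- The second fundamental form `H(X, Y) = □_X Y (N)`. -/
def H (N X Y : VField m M) (p : M) : ℝ := g.dual X Y N p

/-- The form `II(A, B) = □_A B (R)`. -/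
def II (R A B : VField m M) (p : M) : ℝ := g.dual A B R p

/-- Over `Σ ∩ U`, the smooth fields `N` and `R` restrict to the main normal and to the main
radical vector field. -/
structure IsMainPair (U : Set M) (N R : VField m M) : Prop where
  smooth_N : SmoothOn N U
  smooth_R : SmoothOn R U
  normal : ∀ p ∈ g.sing ∩ U, ∀ w ∈ g.tangentSing p, g.form p (N p) w = 0
  unit : ∀ p ∈ g.sing ∩ U, g.pair N N p = 1
  isotropic : ∀ p ∈ g.sing ∩ U, g.II R N N p = 0
  radical : ∀ p ∈ g.sing ∩ U, R p ∈ g.rad p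
  H_unitary : ∀ p ∈ g.sing ∩ U, g.H N R R p = -1

/-- `N` is geodesic for the Levi-Civita connection outside `Σ`. -/
def IsGeodesicOff (U : Set M) (N : VField m M) : Prop :=
  ∀ p ∈ U \ g.sing, g.nabla N N p = 0

/-- `V` restricts to a section over `Σ ∩ U` of the canonical screen distribution
`{v ∈ TΣ : H(v, R) = 0}`. -/
def IsScreen (U : Set M) (N R V : VField m M) : Prop :=
  SmoothOn V U ∧ ∀ p ∈ g.sing ∩ U, V p ∈ g.tangentSing p ∧ g.H N V R p = 0

/-- The normal component `ν(A) = ⟨A, N⟩`. -/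
def nu (N A : VField m M) (p : M) : ℝ := g.pair A N p

/-- The radical component `ρ(A) = -H(A - ν(A) N, R)`. -/
def rho (N R A : VField m M) (p : M) : ℝ :=
  -g.H N (fun q ↦ A q - g.nu N A q • N q) R p

/-- `Σ ∩ U` is `II`-flat. -/
def IIFlat (U : Set M) (N R : VField m M) : Prop :=
  ∀ V W : VField m M, g.IsScreen U N R V → g.IsScreen U N R W →
    ∀ p ∈ g.sing ∩ U, g.II R V W p = 0

open Classical in
/-- The smooth extension to `U` of `∇_X Y`, when it exists. (It then is unique, and it exists
for fields tangent to `Σ` if `Σ` is `II`-flat.) -/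
def nablaExt (U : Set M) (X Y : VField m M) : VField m M :=
  if h : ∃ Z : VField m M, SmoothOn Z U ∧ ∀ p ∈ U \ g.sing, Z p = g.nabla X Y p
  then h.choose else 0

/-- The form `III(X, Y, Z) = II(∇_X Y, Z)`. -/
def III (U : Set M) (R X Y Z : VField m M) (p : M) : ℝ :=
  g.II R (g.nablaExt U X Y) Z p

/-- `Σ ∩ U` is `III`-flat. -/
def IIIFlat (U : Set M) (N R : VField m M) : Prop :=
  g.IIFlat U N R ∧
    ∀ V W : VField m M, g.IsScreen U N R V → g.IsScreen U N R W →
      ∀ p ∈ g.sing ∩ U, g.III U R V W R p = 0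

/-- The field `A + τ B`, where `τ = ⟨R, R⟩`. -/
def addTau (R A B : VField m M) : VField m M := fun p ↦ A p + g.pair R R p • B p

end SymTensor

end RiemannLorentz

end

set_option linter.unusedSectionVars false

noncomputable section

namespace RiemannLorentz

variable {m : ℕ} {M : Type*} [TopologicalSpace M] [ChartedSpace (EuclideanSpace ℝ (Fin m)) M]
  [IsManifold (𝓡 m) ∞ M]

/-! ### Calculus of smooth functions and vector fields -/

/-! Along Σ the function t = ⟨R, R⟩ satisfies N(t) = 2, because H(R, R) = -1, so it is a defining
function of Σ. Replace R by R₀ = R + cN orthogonal to N; both c and N(c) vanish on Σ, so nothing of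
first order along Σ changes, and t may be taken as ⟨R₀, R₀⟩. Locally R₀ and N extend to a frame R₀,
N, E_i with the E_i orthogonal to both, and the dual frame is R₀/t, N/⟨N, N⟩, F_i. The Koszul form □
is smooth across Σ, so every singularity of the Levi-Civita connection and of its curvature comes
from the single vector R₀/t.

Expressing the curvature through □ and taking the trace gives t² Ric(A, B) = w + t·(pole) +
t²·(rest) with smooth coefficients (`t_sq_ric`), and w = -ν(A)ν(B) on Σ. Since ν(N) = 1, Ric(N', N')
has a genuine double pole, which is (a). In all other cases ν(A)ν(B) = 0 on Σ, so w is divisible by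
t (Hadamard's lemma), t Ric(A, B) is smooth (`hasRicPole`), and Ric(A, B) extends exactly when the
residue, the boundary value N(w)/2 + pole of t Ric(A, B), vanishes on Σ (`goodLimit_ric_iff`).

Two extensions of a field differ by tX, and passing from A to A + tX changes the residue by
-ν(X)ν(B) (`hasRicPole_perturb`). Hence (d), (e), (f) do not depend on the extensions, while in (b)
and (c) the factor ν(N) = 1 lets the normal component of the added field enter. It remains to
compute the residues of the canonical fields: -ρ([V, R]) for (N, V), 0 for (N, R) when Σ is II-flat,
0 for (R, V), -1 for (R, R), and -H(V, W) for (V, W) when Σ is II-flat. In the last case H(V, W) =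
III(V, W, R) (`III_eq`), because II(Z, R) = ν(Z). -/

instance : IsManifold (𝓡 m) (minSmoothness ℝ 3) M :=
  IsManifold.of_le (n := ∞) (by simp only [minSmoothness_of_isRCLikeNormedField]; exact WithTop.coe_le_coe.2 le_top)

instance : IsManifold (𝓡 m) ((∞ : WithTop ℕ∞) + 1) M :=
  IsManifold.of_le (n := ∞) (by simp)

/-- The real function `f` is smooth at `p`. -/
abbrev FunSmoothAt (f : M → ℝ) (p : M) : Prop := ContMDiffAt (𝓡 m) 𝓘(ℝ, ℝ) ∞ f p

/-- The real function `f` is differentiable at `p`. -/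
abbrev FunDiffAt (f : M → ℝ) (p : M) : Prop := MDifferentiableAt (𝓡 m) 𝓘(ℝ, ℝ) f p

/-- The vector field `A` is differentiable at `p`. -/
def DiffAt (A : VField m M) (p : M) : Prop :=
  MDifferentiableAt (𝓡 m) (𝓡 m).tangent (fun q ↦ (⟨q, A q⟩ : TangentBundle (𝓡 m) M)) p

variable {A B C A' B' C' : VField m M} {f h : M → ℝ} {p : M} {ι : Type*}

theorem FunSmoothAt.diff (hf : FunSmoothAt (m := m) f p) : FunDiffAt (m := m) f p :=
  hf.mdifferentiableAt (by simp)

theorem FunDiffAt.sum {s : Finset ι} {F : ι → M → ℝ}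
    (hF : ∀ i ∈ s, FunDiffAt (m := m) (F i) p) : FunDiffAt (m := m) (∑ i ∈ s, F i) p := by
  classical
  induction s using Finset.induction_on with
  | empty => exact mdifferentiableAt_const
  | insert a s ha ih =>
    simp only [Finset.mem_insert, forall_eq_or_imp] at hF
    rw [Finset.sum_insert ha]
    exact MDifferentiableAt.add hF.1 (ih hF.2)

theorem FunSmoothAt.const (c : ℝ) : FunSmoothAt (m := m) (fun _ : M ↦ c) p :=
  contMDiffAt_const

theorem FunSmoothAt.add (hf : FunSmoothAt (m := m) f p) (hh : FunSmoothAt (m := m) h p) :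
    FunSmoothAt (m := m) (f + h) p := ContMDiffAt.add hf hh

theorem FunSmoothAt.sub (hf : FunSmoothAt (m := m) f p) (hh : FunSmoothAt (m := m) h p) :
    FunSmoothAt (m := m) (f - h) p := ContMDiffAt.sub hf hh

theorem FunSmoothAt.mul (hf : FunSmoothAt (m := m) f p) (hh : FunSmoothAt (m := m) h p) :
    FunSmoothAt (m := m) (f * h) p := ContMDiffAt.mul hf hh

theorem FunSmoothAt.inv (hf : FunSmoothAt (m := m) f p) (h0 : f p ≠ 0) :
    FunSmoothAt (m := m) f⁻¹ p := ContMDiffAt.inv₀ hf h0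

theorem FunSmoothAt.sum {s : Finset ι} {F : ι → M → ℝ}
    (hF : ∀ i ∈ s, FunSmoothAt (m := m) (F i) p) : FunSmoothAt (m := m) (∑ i ∈ s, F i) p := by
  classical
  induction s using Finset.induction_on with
  | empty => exact contMDiffAt_const
  | insert a s ha ih =>
    simp only [Finset.mem_insert, forall_eq_or_imp] at hF
    rw [Finset.sum_insert ha]
    exact .add hF.1 (ih hF.2)

theorem FunSmoothAt.congr (hf : FunSmoothAt (m := m) f p) (hh : h =ᶠ[𝓝 p] f) :
    FunSmoothAt (m := m) h p := ContMDiffAt.congr_of_eventuallyEq hf hh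

theorem SmoothAt.diff (hA : SmoothAt A p) : DiffAt A p :=
  ContMDiffAt.mdifferentiableAt hA (by simp)

theorem SmoothAt.eventually_diff (hA : SmoothAt A p) : ∀ᶠ q in 𝓝 p, DiffAt A q := by
  have h1 : ContMDiffAt (𝓡 m) (𝓡 m).tangent 1
      (fun q ↦ (⟨q, A q⟩ : TangentBundle (𝓡 m) M)) p := ContMDiffAt.of_le hA (by simp)
  filter_upwards [(contMDiffAt_iff_contMDiffAt_nhds (by simp)).1 h1] with q hq
  exact hq.mdifferentiableAt (by simp)

theorem FunSmoothAt.eventually_diff (hf : FunSmoothAt (m := m) f p) :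
    ∀ᶠ q in 𝓝 p, FunDiffAt (m := m) f q := by
  have h1 : ContMDiffAt (𝓡 m) 𝓘(ℝ, ℝ) 1 f p := ContMDiffAt.of_le hf (by simp)
  filter_upwards [(contMDiffAt_iff_contMDiffAt_nhds (by simp)).1 h1] with q hq
  exact hq.mdifferentiableAt (by simp)

theorem SmoothOn.at {U : Set M} (hA : SmoothOn A U) (hU : IsOpen U) (hp : p ∈ U) :
    SmoothAt A p := ContMDiffOn.contMDiffAt hA (hU.mem_nhds hp)

theorem smoothOn_of_forall {U : Set M} (hA : ∀ p ∈ U, SmoothAt A p) : SmoothOn A U :=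
  fun p hp ↦ (hA p hp).contMDiffWithinAt

theorem SmoothAt.congr (hA : SmoothAt A p) (h : A' =ᶠ[𝓝 p] A) : SmoothAt A' p :=
  ContMDiffAt.congr_of_eventuallyEq hA (h.mono fun q hq ↦ by simp [hq])

theorem SmoothAt.add (hA : SmoothAt A p) (hB : SmoothAt B p) : SmoothAt (A + B) p :=
  ContMDiffAt.add_section hA hB

theorem SmoothAt.sub (hA : SmoothAt A p) (hB : SmoothAt B p) : SmoothAt (A - B) p :=
  ContMDiffAt.sub_section hA hB

theorem SmoothAt.smul (hf : FunSmoothAt (m := m) f p) (hA : SmoothAt A p) : SmoothAt (f • A) p :=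
  ContMDiffAt.smul_section hf hA

theorem SmoothAt.sum {s : Finset ι} {X : ι → VField m M} (hX : ∀ i ∈ s, SmoothAt (X i) p) :
    SmoothAt (∑ i ∈ s, X i) p := by
  have := ContMDiffAt.sum_section (I := 𝓡 m) (n := ∞) (t := X) (x₀ := p) (s := s) hX
  exact this.congr_of_eventuallyEq (.of_forall fun q ↦ by simp)

theorem DiffAt.add (hA : DiffAt A p) (hB : DiffAt B p) : DiffAt (A + B) p :=
  mdifferentiableAt_add_section hA hB

theorem DiffAt.smul (hf : FunDiffAt (m := m) f p) (hA : DiffAt A p) : DiffAt (f • A) p :=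
  MDifferentiableAt.smul_section hf hA

theorem smoothAt_extend (v : TangentSpace (𝓡 m) p) :
    SmoothAt (FiberBundle.extend (EuclideanSpace ℝ (Fin m)) v) p :=
  FiberBundle.contMDiffAt_extend ..

/-! ### Derivatives of functions along vector fields -/

theorem dirDeriv_eq : dirDeriv A f p = mvfderiv (𝓡 m) f p (A p) := rfl

theorem dirDeriv_congr_fun (hf : f =ᶠ[𝓝 p] h) : dirDeriv A f p = dirDeriv A h p := by
  unfold dirDeriv
  rw [hf.mfderiv_eq]
  rfl

theorem dirDeriv_congr (hA : A p = B p) : dirDeriv A f p = dirDeriv B f p := by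
  unfold dirDeriv
  rw [hA]

theorem dirDeriv_const (c : ℝ) : dirDeriv A (fun _ ↦ c) p = 0 := by
  rw [dirDeriv_eq, mvfderiv_const]; rfl

theorem dirDeriv_add_fun (hf : FunDiffAt (m := m) f p) (hh : FunDiffAt (m := m) h p) :
    dirDeriv A (f + h) p = dirDeriv A f p + dirDeriv A h p := by
  simp only [dirDeriv_eq]
  rw [mvfderiv_add hf hh]; rfl

theorem dirDeriv_sub_fun (hf : FunDiffAt (m := m) f p) (hh : FunDiffAt (m := m) h p) :
    dirDeriv A (f - h) p = dirDeriv A f p - dirDeriv A h p := by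
  simp only [dirDeriv_eq]
  rw [mvfderiv_sub hf hh]; rfl

theorem dirDeriv_mul_fun (hf : FunDiffAt (m := m) f p) (hh : FunDiffAt (m := m) h p) :
    dirDeriv A (f * h) p = dirDeriv A f p * h p + f p * dirDeriv A h p := by
  simp only [dirDeriv_eq]
  rw [mvfderiv_mul hf hh]
  simp; ring

theorem dirDeriv_sum_fun {s : Finset ι} {F : ι → M → ℝ}
    (hF : ∀ i ∈ s, FunDiffAt (m := m) (F i) p) :
    dirDeriv A (∑ i ∈ s, F i) p = ∑ i ∈ s, dirDeriv A (F i) p := by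
  classical
  induction s using Finset.induction_on with
  | empty => exact dirDeriv_const (A := A) (p := p) 0
  | insert a s ha ih =>
    simp only [Finset.mem_insert, forall_eq_or_imp] at hF
    rw [Finset.sum_insert ha, Finset.sum_insert ha, dirDeriv_add_fun hF.1, ih hF.2]
    exact .sum hF.2

theorem dirDeriv_add : dirDeriv (A + B) f p = dirDeriv A f p + dirDeriv B f p := by
  simp [dirDeriv_eq]

theorem dirDeriv_smul : dirDeriv (h • A) f p = h p * dirDeriv A f p := by
  simp [dirDeriv_eq]

theorem FunSmoothAt.dirDeriv (hA : SmoothAt A p) (hf : FunSmoothAt (m := m) f p) :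
    FunSmoothAt (m := m) (RiemannLorentz.dirDeriv A f) p := by
  have h1 := ContMDiffAt.mfderiv_const (m := ∞) hf (by simp)
  have h2 := ContMDiffAt.clm_apply_of_inCoordinates (n := ∞) (IB₂ := 𝓘(ℝ, ℝ))
    (E₂ := fun y : ℝ ↦ TangentSpace 𝓘(ℝ, ℝ) y) (b₁ := id) (b₂ := f) (m₀ := p)
    (ϕ := mfderiv (𝓡 m) 𝓘(ℝ, ℝ) f) (v := A) h1 hA hf
  exact ContMDiffAt.comp p
    (contMDiff_snd_tangentBundle_modelSpace ℝ 𝓘(ℝ, ℝ)).contMDiffAt h2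

/-! ### The Lie bracket -/

theorem SmoothAt.bracket (hA : SmoothAt A p) (hB : SmoothAt B p) :
    SmoothAt (RiemannLorentz.bracket A B) p :=
  ContMDiffAt.mlieBracket_vectorField (m := ⊤) (n := ⊤) hA hB (by simp)

theorem bracket_swap : bracket A B p = - bracket B A p :=
  VectorField.mlieBracket_swap_apply

theorem bracket_congr (hA : A =ᶠ[𝓝 p] A') (hB : B =ᶠ[𝓝 p] B') :
    bracket A B p = bracket A' B' p :=
  hA.mlieBracket_vectorField_eq hB

theorem bracket_add_right (hB : DiffAt B p) (hC : DiffAt C p) :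
    bracket A (B + C) p = bracket A B p + bracket A C p :=
  VectorField.mlieBracket_add_right hB hC

theorem bracket_add_left (hA : DiffAt A p) (hB : DiffAt B p) :
    bracket (A + B) C p = bracket A C p + bracket B C p :=
  VectorField.mlieBracket_add_left hA hB

theorem bracket_smul_right (hf : FunDiffAt (m := m) f p) (hB : DiffAt B p) :
    bracket A (f • B) p = dirDeriv A f p • B p + f p • bracket A B p :=
  VectorField.mlieBracket_smul_right hf hB

theorem bracket_smul_left (hf : FunDiffAt (m := m) f p) (hA : DiffAt A p) :
    bracket (f • A) B p = -(dirDeriv B f p • A p) + f p • bracket A B p := by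
  rw [← neg_smul]
  exact VectorField.mlieBracket_smul_left hf hA

theorem eventually_bracket_smul_right (hf : FunSmoothAt (m := m) f p) (hB : SmoothAt B p) :
    bracket A (f • B) =ᶠ[𝓝 p] dirDeriv A f • B + f • bracket A B := by
  filter_upwards [hf.eventually_diff, hB.eventually_diff] with q h1 h2
  exact bracket_smul_right h1 h2

/-- Apply the Jacobi identity to `A`, `B` and `f • C` with `C p ≠ 0`: after subtracting the identity
for `C`, only multiples of `C p` remain, and their coefficients are the claim. If the tangent space
is zero, both sides vanish. -/
theorem dirDeriv_bracket (hA : SmoothAt A p) (hB : SmoothAt B p) (hf : FunSmoothAt (m := m) f p) :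
    dirDeriv (bracket A B) f p = dirDeriv A (dirDeriv B f) p - dirDeriv B (dirDeriv A f) p := by
  by_cases hv : ∃ v : TangentSpace (𝓡 m) p, v ≠ 0
  · obtain ⟨v, hv⟩ := hv
    set C : VField m M := FiberBundle.extend (EuclideanSpace ℝ (Fin m)) v
    have hC : SmoothAt C p := smoothAt_extend v
    have hCp : C p = v := FiberBundle.extend_apply_self ..
    have two : minSmoothness ℝ 2 ≤ (∞ : WithTop ℕ∞) := by
      simp only [minSmoothness_of_isRCLikeNormedField]; exact WithTop.coe_le_coe.2 le_top
    have J : ∀ {D : VField m M}, SmoothAt D p →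
        bracket A (bracket B D) p = bracket (bracket A B) D p + bracket B (bracket A D) p :=
      fun hD ↦ VectorField.leibniz_identity_mlieBracket_apply
        (ContMDiffAt.of_le hA two) (ContMDiffAt.of_le hB two) (ContMDiffAt.of_le hD two)
    have h1 := J (SmoothAt.smul hf hC)
    rw [bracket_congr (.refl _ A) (eventually_bracket_smul_right hf hC),
      bracket_congr (.refl _ B) (eventually_bracket_smul_right hf hC),
      bracket_smul_right hf.diff hC.diff,
      bracket_add_right (SmoothAt.smul (.dirDeriv hB hf) hC).diff
        (SmoothAt.smul hf (hB.bracket hC)).diff,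
      bracket_add_right (SmoothAt.smul (.dirDeriv hA hf) hC).diff
        (SmoothAt.smul hf (hA.bracket hC)).diff,
      bracket_smul_right (FunSmoothAt.dirDeriv hB hf).diff hC.diff,
      bracket_smul_right (FunSmoothAt.dirDeriv hA hf).diff hC.diff,
      bracket_smul_right hf.diff (hB.bracket hC).diff,
      bracket_smul_right hf.diff (hA.bracket hC).diff, J hC, hCp] at h1
    have h2 : (dirDeriv (bracket A B) f p - (dirDeriv A (dirDeriv B f) p
        - dirDeriv B (dirDeriv A f) p)) • v = 0 := by
      rw [sub_smul, sub_smul]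
      exact neg_eq_zero.1 (Eq.trans (by module) (sub_eq_zero.2 h1))
    simpa [sub_eq_zero, hv] using h2
  · push Not at hv
    simp [dirDeriv_eq, hv]

namespace SymTensor

variable {A B C D A' B' C' : VField m M} {f h : M → ℝ} {p : M} {ι : Type*} (g : SymTensor m M)

/-! ### The function `⟨A, B⟩` -/

theorem pair_comm (A B : VField m M) : g.pair A B = g.pair B A := by
  ext q; exact g.symm ..

theorem pair_add_left : g.pair (A + B) C = g.pair A C + g.pair B C := by
  ext q; simp [pair]

theorem pair_add_right : g.pair A (B + C) = g.pair A B + g.pair A C := by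
  ext q; simp [pair]

theorem pair_sub_left : g.pair (A - B) C = g.pair A C - g.pair B C := by
  ext q; simp [pair]

theorem pair_smul_left : g.pair (f • A) B = f * g.pair A B := by
  ext q; simp [pair]

theorem pair_smul_right : g.pair A (f • B) = f * g.pair A B := by
  ext q; simp [pair]

theorem smooth_pair (hA : SmoothAt A p) (hB : SmoothAt B p) :
    FunSmoothAt (m := m) (g.pair A B) p := by
  have := ContMDiffAt.clm_bundle_apply₂ (F₃ := ℝ) (E₃ := fun _ : M ↦ ℝ) (n := ∞)
    (g.contMDiff p) hA hB
  simpa [FunSmoothAt] using! (Bundle.contMDiffAt_totalSpace.1 this).2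

theorem diff_pair (hA : DiffAt A p) (hB : DiffAt B p) :
    FunDiffAt (m := m) (g.pair A B) p := by
  have := MDifferentiableAt.clm_bundle_apply₂ (F₃ := ℝ) (E₃ := fun _ : M ↦ ℝ)
    ((g.contMDiff p).mdifferentiableAt (by simp)) hA hB
  simpa [FunDiffAt] using! ((mdifferentiableAt_totalSpace (𝓡 m) _).1 this).2

/-! ### Algebraic properties of the dual connection -/

theorem smooth_dual (hA : SmoothAt A p) (hB : SmoothAt B p) (hC : SmoothAt C p) :
    FunSmoothAt (m := m) (g.dual A B C) p := by
  refine .mul (.const _) ?_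
  refine .add (.sub (.add (.sub (.add ?_ ?_) ?_) ?_) ?_) ?_
  · exact .dirDeriv hA (g.smooth_pair hB hC)
  · exact .dirDeriv hB (g.smooth_pair hC hA)
  · exact .dirDeriv hC (g.smooth_pair hA hB)
  · exact g.smooth_pair (hA.bracket hB) hC
  · exact g.smooth_pair (hB.bracket hC) hA
  · exact g.smooth_pair (hC.bracket hA) hB

theorem pair_congr (hA : A =ᶠ[𝓝 p] A') (hB : B =ᶠ[𝓝 p] B') :
    g.pair A B =ᶠ[𝓝 p] g.pair A' B' := by
  filter_upwards [hA, hB] with q h1 h2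
  simp [pair, h1, h2]

theorem dual_congr (hA : A =ᶠ[𝓝 p] A') (hB : B =ᶠ[𝓝 p] B') (hC : C =ᶠ[𝓝 p] C') :
    g.dual A B C p = g.dual A' B' C' p := by
  simp only [dual, dirDeriv_congr_fun (g.pair_congr hB hC), dirDeriv_congr_fun (g.pair_congr hC hA),
    dirDeriv_congr_fun (g.pair_congr hA hB), dirDeriv_congr hA.self_of_nhds,
    dirDeriv_congr hB.self_of_nhds, dirDeriv_congr hC.self_of_nhds, pair, bracket_congr hA hB,
    bracket_congr hB hC, bracket_congr hC hA, hA.self_of_nhds, hB.self_of_nhds, hC.self_of_nhds]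

/-- Metric compatibility and, below, vanishing torsion hold for □ as scalar identities on all of
`M`, including Σ where no connection exists. Almost every computation along Σ is a linear
combination of these two. -/
theorem dual_metric (A B C : VField m M) (p : M) :
    g.dual A B C p + g.dual A C B p = dirDeriv A (g.pair B C) p := by
  simp only [dual, g.pair_comm C B, g.pair_comm A B, g.pair_comm C A]
  simp only [pair, bracket_swap (A := C) (B := B), bracket_swap (A := A) (B := B),
    bracket_swap (A := C) (B := A), map_neg, neg_apply]
  ring

theorem dual_torsion (A B C : VField m M) (p : M) :
    g.dual A B C p - g.dual B A C p = g.pair (bracket A B) C p := by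
  simp only [dual, g.pair_comm C B, g.pair_comm A B, g.pair_comm C A]
  simp only [pair, bracket_swap (A := C) (B := B), bracket_swap (A := A) (B := B),
    bracket_swap (A := C) (B := A), map_neg, neg_apply]
  ring

theorem dual_self (A B : VField m M) (p : M) :
    g.dual A B B p = 1 / 2 * dirDeriv A (g.pair B B) p := by
  linarith [g.dual_metric A B B p]

theorem dual_add_left (hA : DiffAt A p) (hA' : DiffAt A' p) (hB : DiffAt B p) (hC : DiffAt C p) :
    g.dual (A + A') B C p = g.dual A B C p + g.dual A' B C p := by
  simp only [dual, pair_add_left, pair_add_right, dirDeriv_add]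
  rw [dirDeriv_add_fun (g.diff_pair hC hA) (g.diff_pair hC hA'),
    dirDeriv_add_fun (g.diff_pair hA hB) (g.diff_pair hA' hB)]
  simp only [pair, bracket_add_left hA hA', bracket_add_right hA hA', map_add, Pi.add_apply,
    add_apply]
  ring

theorem dual_smul_left (hf : FunDiffAt (m := m) f p) (hA : DiffAt A p) (hB : DiffAt B p)
    (hC : DiffAt C p) : g.dual (f • A) B C p = f p * g.dual A B C p := by
  simp only [dual, pair_smul_left, pair_smul_right, dirDeriv_smul]
  rw [dirDeriv_mul_fun hf (g.diff_pair hC hA), dirDeriv_mul_fun hf (g.diff_pair hA hB)]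
  simp only [pair, bracket_smul_left hf hA, bracket_smul_right hf hA, map_add, Pi.mul_apply,
    add_apply, map_smul, smul_apply, smul_eq_mul, map_neg, neg_apply, g.symm p (C p) (A p)]
  ring

theorem dual_add_right (hA : DiffAt A p) (hB : DiffAt B p) (hC : DiffAt C p) (hC' : DiffAt C' p) :
    g.dual A B (C + C') p = g.dual A B C p + g.dual A B C' p := by
  simp only [dual, pair_add_left, pair_add_right, dirDeriv_add]
  rw [dirDeriv_add_fun (g.diff_pair hB hC) (g.diff_pair hB hC'),
    dirDeriv_add_fun (g.diff_pair hC hA) (g.diff_pair hC' hA)]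
  simp only [pair, bracket_add_left hC hC', bracket_add_right hC hC', map_add, Pi.add_apply,
    add_apply]
  ring

theorem dual_smul_right (hf : FunDiffAt (m := m) f p) (hA : DiffAt A p) (hB : DiffAt B p)
    (hC : DiffAt C p) : g.dual A B (f • C) p = f p * g.dual A B C p := by
  simp only [dual, pair_smul_left, pair_smul_right, dirDeriv_smul]
  rw [dirDeriv_mul_fun hf (g.diff_pair hB hC), dirDeriv_mul_fun hf (g.diff_pair hC hA)]
  simp only [pair, bracket_smul_left hf hC, bracket_smul_right hf hC, map_add, Pi.mul_apply,
    add_apply, map_smul, smul_apply, smul_eq_mul, map_neg, neg_apply, g.symm p (C p) (A p),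
    g.symm p (B p) (C p)]
  ring

theorem dual_add_mid (hA : DiffAt A p) (hB : DiffAt B p) (hB' : DiffAt B' p) (hC : DiffAt C p) :
    g.dual A (B + B') C p = g.dual A B C p + g.dual A B' C p := by
  have h1 := g.dual_metric A (B + B') C p
  have h2 := g.dual_metric A B C p
  have h3 := g.dual_metric A B' C p
  rw [g.dual_add_right hA hC hB hB', pair_add_left,
    dirDeriv_add_fun (g.diff_pair hB hC) (g.diff_pair hB' hC)] at h1
  linarith

/-- Metric compatibility trades the middle slot for the tensorial last one; the Leibniz term comes
from differentiating `f * ⟨B, C⟩`. -/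
theorem dual_smul_mid (hf : FunDiffAt (m := m) f p) (hA : DiffAt A p) (hB : DiffAt B p)
    (hC : DiffAt C p) :
    g.dual A (f • B) C p = dirDeriv A f p * g.pair B C p + f p * g.dual A B C p := by
  have h1 := g.dual_metric A (f • B) C p
  have h2 := g.dual_metric A B C p
  rw [g.dual_smul_right hf hA hC hB, pair_smul_left,
    dirDeriv_mul_fun hf (g.diff_pair hB hC)] at h1
  linear_combination h1 - f p * h2

theorem tensorialAt_dual_left (hB : DiffAt B p) (hC : DiffAt C p) :
    TensorialAt (𝓡 m) (EuclideanSpace ℝ (Fin m)) (fun X : VField m M ↦ g.dual X B C p) p where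
  smul hf hX := g.dual_smul_left hf hX hB hC
  add hX hY := g.dual_add_left hX hY hB hC

theorem tensorialAt_dual_right (hA : DiffAt A p) (hB : DiffAt B p) :
    TensorialAt (𝓡 m) (EuclideanSpace ℝ (Fin m)) (fun X : VField m M ↦ g.dual A B X p) p where
  smul hf hX := g.dual_smul_right hf hA hB hX
  add hX hY := g.dual_add_right hA hB hX hY

theorem dual_congr_left (hA : DiffAt A p) (hA' : DiffAt A' p) (hB : DiffAt B p) (hC : DiffAt C p)
    (h : A p = A' p) : g.dual A B C p = g.dual A' B C p :=
  (g.tensorialAt_dual_left hB hC).pointwise hA hA' h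

theorem dual_congr_right (hA : DiffAt A p) (hB : DiffAt B p) (hC : DiffAt C p) (hC' : DiffAt C' p)
    (h : C p = C' p) : g.dual A B C p = g.dual A B C' p :=
  (g.tensorialAt_dual_right hA hB).pointwise hC hC' h

end SymTensor

/-! ### Smoothness of determinants and inverse matrices -/

section Matrices

variable {n : Type*} [Fintype n] [DecidableEq n] {G : n → n → M → ℝ} {p : M}

theorem FunSmoothAt.prod {ι : Type*} {s : Finset ι} {F : ι → M → ℝ}
    (hF : ∀ i ∈ s, FunSmoothAt (m := m) (F i) p) : FunSmoothAt (m := m) (∏ i ∈ s, F i) p := by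
  classical
  induction s using Finset.induction_on with
  | empty => exact contMDiffAt_const
  | insert a s ha ih =>
    simp only [Finset.mem_insert, forall_eq_or_imp] at hF
    rw [Finset.prod_insert ha]
    exact .mul hF.1 (ih hF.2)

theorem FunSmoothAt.det (hG : ∀ i j, FunSmoothAt (m := m) (G i j) p) :
    FunSmoothAt (m := m) (fun q ↦ Matrix.det (Matrix.of fun i j ↦ G i j q)) p := by
  have : (fun q ↦ Matrix.det (Matrix.of fun i j ↦ G i j q))
      = ∑ σ : Equiv.Perm n, (fun _ ↦ ((Equiv.Perm.sign σ : ℤ) : ℝ)) * ∏ i, G (σ i) i := by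
    ext q
    simp [Matrix.det_apply']
  rw [this]
  exact .sum fun σ _ ↦ .mul (.const _) (.prod fun i _ ↦ hG _ _)

/-- Cramer's rule: the `(i, j)` entry is a quotient of determinants, with row `j` of the numerator
replaced by the `i`-th unit vector. -/
theorem FunSmoothAt.matrix_inv (hG : ∀ i j, FunSmoothAt (m := m) (G i j) p)
    (h0 : Matrix.det (Matrix.of fun i j ↦ G i j p) ≠ 0) (i j : n) :
    FunSmoothAt (m := m) (fun q ↦ (Matrix.of fun i j ↦ G i j q)⁻¹ i j) p := by
  have : (fun q ↦ (Matrix.of fun i j ↦ G i j q)⁻¹ i j)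
      = (fun q ↦ Matrix.det (Matrix.of fun i j ↦ G i j q))⁻¹ * fun q ↦ Matrix.det (Matrix.of
        fun k l ↦ (if k = j then fun _ ↦ if l = i then 1 else 0 else G k l : M → ℝ) q) := by
    ext q
    rw [Matrix.inv_def]
    simp only [Matrix.smul_apply, Pi.mul_apply, Pi.inv_apply, Ring.inverse_eq_inv, smul_eq_mul,
      Matrix.adjugate_apply]
    congr 2
    ext k l
    by_cases hk : k = j
    · subst hk; simp [Pi.single_apply]
    · simp [hk]
  rw [this]
  refine .mul (.inv (.det hG) h0) (.det fun k l ↦ ?_)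
  split_ifs
  · exact .const _
  · exact .const _
  · exact hG k l

end Matrices

namespace SymTensor

variable {A B C D Z A' B' C' Z' : VField m M} {f h : M → ℝ} {p : M} {ι : Type*} [Fintype ι]
  (g : SymTensor m M)

/-! ### Dual frames -/

instance (p : M) : FiniteDimensional ℝ (TangentSpace (𝓡 m) p) :=
  inferInstanceAs (FiniteDimensional ℝ (EuclideanSpace ℝ (Fin m)))

theorem finrank_tangentSpace (p : M) : Module.finrank ℝ (TangentSpace (𝓡 m) p) = m :=
  finrank_euclideanSpace_fin (𝕜 := ℝ) (n := m)

variable {g} in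
theorem eq_of_form_eq (hp : p ∉ g.sing) {v w : TangentSpace (𝓡 m) p}
    (h : ∀ z, g.form p v z = g.form p w z) : v = w := by
  by_contra hne
  exact hp ⟨v - w, fun z ↦ by simp [h], sub_ne_zero.2 hne⟩

theorem linearIndependent_of_gram [DecidableEq ι] {X : ι → TangentSpace (𝓡 m) p}
    (hX : Matrix.det (Matrix.of fun i j ↦ g.form p (X i) (X j)) ≠ 0) :
    LinearIndependent ℝ X := by
  rw [Fintype.linearIndependent_iff]
  intro c hc i
  have : Matrix.vecMul c (Matrix.of fun i j ↦ g.form p (X i) (X j)) = 0 := by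
    ext j
    have := congrArg (fun v ↦ g.form p v (X j)) hc
    simpa [Matrix.vecMul, dotProduct] using this
  exact congrFun (Matrix.eq_zero_of_vecMul_eq_zero hX this) i

theorem span_of_gram [DecidableEq ι] {X : ι → TangentSpace (𝓡 m) p} (hc : Fintype.card ι = m)
    (hX : Matrix.det (Matrix.of fun i j ↦ g.form p (X i) (X j)) ≠ 0) :
    Submodule.span ℝ (Set.range X) = ⊤ :=
  (g.linearIndependent_of_gram hX).span_eq_top_of_card_eq_finrank'
    (hc.trans (finrank_tangentSpace p).symm)

/-- `E` and `F` are mutually dual smooth frames of `TM` over the open set `W`. -/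
structure IsDualFrame (E F : ι → VField m M) (W : Set M) : Prop where
  isOpen : IsOpen W
  smooth_left : ∀ i, ∀ q ∈ W, SmoothAt (E i) q
  smooth_right : ∀ i, ∀ q ∈ W, SmoothAt (F i) q
  complete : ∀ q ∈ W, ∀ v : TangentSpace (𝓡 m) q, ∑ i, g.form q v (E i q) • F i q = v

/-- Extend a basis at `p` by smooth fields and apply the inverse of their Gram matrix, which stays
invertible near `p` by continuity. -/
theorem exists_isDualFrame (hp : p ∉ g.sing) :
    ∃ (E F : Fin m → VField m M) (W : Set M), g.IsDualFrame E F W ∧ p ∈ W := by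
  let b : Module.Basis (Fin m) ℝ (TangentSpace (𝓡 m) p) :=
    (EuclideanSpace.basisFun (Fin m) ℝ).toBasis
  let X : Fin m → VField m M := fun i ↦ FiberBundle.extend (EuclideanSpace ℝ (Fin m)) (b i)
  have hX : ∀ i, SmoothAt (X i) p := fun i ↦ smoothAt_extend _
  let G : M → Matrix (Fin m) (Fin m) ℝ := fun q ↦ Matrix.of fun i j ↦ g.pair (X i) (X j) q
  have hdet : (G p).det ≠ 0 := by
    intro h0
    obtain ⟨c, hc, hc0⟩ := Matrix.exists_vecMul_eq_zero_iff.2 h0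
    refine hp ⟨∑ i, c i • b i, fun w ↦ ?_, fun h ↦ hc ?_⟩
    · rw [← b.sum_repr w, map_sum]
      refine Finset.sum_eq_zero fun j _ ↦ ?_
      have := congrFun hc0 j
      simp only [Matrix.vecMul, dotProduct, G, Matrix.of_apply, pair, X,
        FiberBundle.extend_apply_self, Pi.zero_apply] at this
      simp [this]
    · exact funext (Fintype.linearIndependent_iff.1 b.linearIndependent c h)
  have hXe : ∃ W : Set M, IsOpen W ∧ p ∈ W ∧ (∀ i, ∀ q ∈ W, SmoothAt (X i) q) ∧
      ∀ q ∈ W, (G q).det ≠ 0 := by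
    have h1 : ∀ i, ∃ s ∈ 𝓝 p, ∀ q ∈ s, SmoothAt (X i) q := by
      intro i
      obtain ⟨s, hs, hs'⟩ := FiberBundle.exists_contMDiffOn_extend (k := ∞) (𝓡 m)
        (EuclideanSpace ℝ (Fin m)) (b i)
      refine ⟨interior s, interior_mem_nhds.2 hs, fun q hq ↦ ?_⟩
      exact ContMDiffOn.contMDiffAt hs' (mem_interior_iff_mem_nhds.1 hq)
    choose s hs hs' using h1
    have h2 : ContinuousAt (fun q ↦ (G q).det) p :=
      (FunSmoothAt.det (G := fun i j ↦ g.pair (X i) (X j))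
        fun i j ↦ g.smooth_pair (hX i) (hX j)).continuousAt
    have h3 : (⋂ i, s i) ∩ {q | (G q).det ≠ 0} ∈ 𝓝 p :=
      Filter.inter_mem (Filter.iInter_mem.2 hs) (h2.eventually_ne hdet)
    obtain ⟨W, hW, hWo, hpW⟩ := mem_nhds_iff.1 h3
    exact ⟨W, hWo, hpW, fun i q hq ↦ hs' i q (Set.mem_iInter.1 (hW hq).1 i),
      fun q hq ↦ (hW hq).2⟩
  obtain ⟨W, hWo, hpW, hXW, hGW⟩ := hXe
  refine ⟨X, fun i ↦ ∑ j, (fun q ↦ (G q)⁻¹ i j) • X j, W, ⟨hWo, hXW, fun i q hq ↦ ?_, ?_⟩, hpW⟩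
  · exact .sum fun j _ ↦ .smul (FunSmoothAt.matrix_inv (G := fun i j ↦ g.pair (X i) (X j))
      (fun i j ↦ g.smooth_pair (hXW i q hq) (hXW j q hq)) (hGW q hq) i j) (hXW j q hq)
  · intro q hq v
    have hspan := g.span_of_gram (X := fun i ↦ X i q) (Fintype.card_fin m) (hGW q hq)
    let L : TangentSpace (𝓡 m) q →ₗ[ℝ] TangentSpace (𝓡 m) q :=
      ∑ i, (g.form q (X i q)).toLinearMap.smulRight
        ((∑ j, (fun q ↦ (G q)⁻¹ i j) • X j : VField m M) q)
    have hL : L = LinearMap.id := by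
      refine LinearMap.ext_on_range hspan fun k ↦ ?_
      have h1 : G q * (G q)⁻¹ = 1 := Matrix.mul_nonsing_inv _ (hGW q hq).isUnit
      have h2 : ∀ j, ∑ i, g.form q (X i q) (X k q) * (G q)⁻¹ i j = if k = j then 1 else 0 := by
        intro j
        have := congrFun (congrFun h1 k) j
        simp only [Matrix.mul_apply, Matrix.one_apply, G, Matrix.of_apply, pair] at this
        rw [← this]
        exact Finset.sum_congr rfl fun i _ ↦ by rw [g.symm q (X i q)]; rfl
      simp only [L, LinearMap.coe_sum, Finset.sum_apply, LinearMap.smulRight_apply,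
        ContinuousLinearMap.coe_coe, Pi.smul_apply',
        Finset.smul_sum, smul_smul, LinearMap.id_apply]
      rw [Finset.sum_comm]
      simp only [← Finset.sum_smul, h2]
      simp
    have := congrArg (fun T ↦ T v) hL
    simp only [L, LinearMap.coe_sum, Finset.sum_apply, LinearMap.smulRight_apply,
      ContinuousLinearMap.coe_coe, LinearMap.id_apply] at this
    conv_rhs => rw [← this]
    exact Finset.sum_congr rfl fun i _ ↦ by rw [g.symm q v, Finset.sum_apply]

variable {g}

theorem IsDualFrame.notMem_sing {E F : ι → VField m M} {W : Set M} (hW : g.IsDualFrame E F W)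
    (hp : p ∈ W) : p ∉ g.sing := by
  rintro ⟨v, hv, hv0⟩
  refine hv0 ?_
  rw [← hW.complete p hp v]
  exact Finset.sum_eq_zero fun i _ ↦ by rw [hv, zero_smul]

/-- A dual frame exists on a neighbourhood of each nondegenerate point, and its existence forces
nondegeneracy there. -/
theorem isClosed_sing : IsClosed g.sing := by
  rw [← isOpen_compl_iff, isOpen_iff_mem_nhds]
  intro p hp
  obtain ⟨E, F, W, hW, hpW⟩ := g.exists_isDualFrame hp
  exact Filter.mem_of_superset (hW.isOpen.mem_nhds hpW) fun q hq ↦ hW.notMem_sing hq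

theorem eventually_notMem_sing (hp : p ∉ g.sing) : ∀ᶠ q in 𝓝 p, q ∉ g.sing :=
  isClosed_sing.isOpen_compl.mem_nhds hp

/-! ### The Levi-Civita connection off the singular set -/

/-- The functional `C ↦ dual A B C p` is tensorial, so nondegeneracy represents it by a vector. The
definition tests only smooth `C`; replacing `C` by the smooth extension of `C p` covers
differentiable ones. -/
theorem form_nabla (hp : p ∉ g.sing) (hA : DiffAt A p) (hB : DiffAt B p) (hC : DiffAt C p) :
    g.form p (g.nabla A B p) (C p) = g.dual A B C p := by
  have hex : ∃ v : TangentSpace (𝓡 m) p, ∀ C : VField m M, SmoothAt C p →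
      g.form p v (C p) = g.dual A B C p := by
    let lam := TensorialAt.mkHom _ p (g.tensorialAt_dual_right hA hB)
    let L : TangentSpace (𝓡 m) p →ₗ[ℝ] (TangentSpace (𝓡 m) p →ₗ[ℝ] ℝ) :=
      (ContinuousLinearMap.coeLM ℝ).comp (g.form p).toLinearMap
    have hL : Function.Injective L := by
      intro v w hvw
      exact eq_of_form_eq hp fun z ↦ LinearMap.congr_fun hvw z
    have hLs : Function.Surjective L :=
      (LinearMap.injective_iff_surjective_of_finrank_eq_finrank
        (Subspace.dual_finrank_eq (K := ℝ) (V := TangentSpace (𝓡 m) p)).symm).1 hL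
    obtain ⟨v, hv⟩ := hLs lam.toLinearMap
    refine ⟨v, fun C hC ↦ ?_⟩
    have h1 := LinearMap.congr_fun hv (C p)
    exact h1.trans (TensorialAt.mkHom_apply (g.tensorialAt_dual_right hA hB) hC.diff)
  set C' : VField m M := FiberBundle.extend (EuclideanSpace ℝ (Fin m)) (C p)
  have hC' : SmoothAt C' p := smoothAt_extend _
  have hCC' : C p = C' p := (FiberBundle.extend_apply_self ..).symm
  rw [nabla, dif_pos hex, hCC', hex.choose_spec C' hC',
    g.dual_congr_right hA hB hC hC'.diff hCC']

theorem eq_of_form_field (hp : p ∉ g.sing) {v w : TangentSpace (𝓡 m) p}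
    (h : ∀ C : VField m M, DiffAt C p → g.form p v (C p) = g.form p w (C p)) : v = w := by
  refine eq_of_form_eq hp fun z ↦ ?_
  have := h _ (smoothAt_extend z).diff
  rwa [FiberBundle.extend_apply_self] at this

/-- The value chosen by `nabla` depends on the fields only through the functional `C ↦ dual A B C
p`, hence only on their germs. -/
theorem nabla_congr (hA : A =ᶠ[𝓝 p] A') (hB : B =ᶠ[𝓝 p] B') : g.nabla A B p = g.nabla A' B' p := by
  have : (fun C ↦ g.dual A B C p) = fun C ↦ g.dual A' B' C p :=
    funext fun C ↦ g.dual_congr hA hB (.refl _ _)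
  exact congrArg (fun φ : VField m M → ℝ ↦ open Classical in
    if h : ∃ v : TangentSpace (𝓡 m) p, ∀ C : VField m M, SmoothAt C p →
      g.form p v (C p) = φ C then h.choose else 0) this

theorem nabla_add_left (hp : p ∉ g.sing) (hA : DiffAt A p) (hA' : DiffAt A' p) (hB : DiffAt B p) :
    g.nabla (A + A') B p = g.nabla A B p + g.nabla A' B p := by
  refine eq_of_form_field hp fun C hC ↦ ?_
  rw [form_nabla hp (hA.add hA') hB hC, map_add, add_apply, form_nabla hp hA hB hC,
    form_nabla hp hA' hB hC, g.dual_add_left hA hA' hB hC]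

theorem nabla_smul_left (hp : p ∉ g.sing) (hf : FunDiffAt (m := m) f p) (hA : DiffAt A p)
    (hB : DiffAt B p) : g.nabla (f • A) B p = f p • g.nabla A B p := by
  refine eq_of_form_field hp fun C hC ↦ ?_
  rw [form_nabla hp (hA.smul hf) hB hC, map_smul, smul_apply, form_nabla hp hA hB hC,
    g.dual_smul_left hf hA hB hC, smul_eq_mul]

theorem nabla_add_right (hp : p ∉ g.sing) (hA : DiffAt A p) (hB : DiffAt B p) (hB' : DiffAt B' p) :
    g.nabla A (B + B') p = g.nabla A B p + g.nabla A B' p := by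
  refine eq_of_form_field hp fun C hC ↦ ?_
  rw [form_nabla hp hA (hB.add hB') hC, map_add, add_apply, form_nabla hp hA hB hC,
    form_nabla hp hA hB' hC, g.dual_add_mid hA hB hB' hC]

theorem nabla_smul_right (hp : p ∉ g.sing) (hf : FunDiffAt (m := m) f p) (hA : DiffAt A p)
    (hB : DiffAt B p) : g.nabla A (f • B) p = dirDeriv A f p • B p + f p • g.nabla A B p := by
  refine eq_of_form_field hp fun C hC ↦ ?_
  rw [form_nabla hp hA (hB.smul hf) hC, map_add, add_apply, map_smul, map_smul, smul_apply,
    smul_apply, form_nabla hp hA hB hC, g.dual_smul_mid hf hA hB hC]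
  rfl

theorem IsDualFrame.nabla_eq {E F : ι → VField m M} {W : Set M} (hW : g.IsDualFrame E F W)
    (hp : p ∈ W) (hA : DiffAt A p) (hB : DiffAt B p) :
    g.nabla A B p = ∑ i, g.dual A B (E i) p • F i p := by
  conv_lhs => rw [← hW.complete p hp (g.nabla A B p)]
  exact Finset.sum_congr rfl fun i _ ↦ by
    rw [form_nabla (hW.notMem_sing hp) hA hB (hW.smooth_left i p hp).diff]

theorem smooth_nabla (hp : p ∉ g.sing) (hA : SmoothAt A p) (hB : SmoothAt B p) :
    SmoothAt (g.nabla A B) p := by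
  obtain ⟨E, F, W, hW, hpW⟩ := g.exists_isDualFrame hp
  have h1 : g.nabla A B =ᶠ[𝓝 p] ∑ i, g.dual A B (E i) • F i := by
    filter_upwards [hA.eventually_diff, hB.eventually_diff, hW.isOpen.mem_nhds hpW] with q h1 h2 h3
    rw [hW.nabla_eq h3 h1 h2]
    exact (Finset.sum_apply q _ (fun i ↦ g.dual A B (E i) • F i)).symm
  refine SmoothAt.congr (.sum fun i _ ↦ ?_) h1
  exact .smul (g.smooth_dual hA hB (hW.smooth_left i p hpW)) (hW.smooth_right i p hpW)

end SymTensor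

namespace SymTensor

variable {A B C D Z A' B' C' Z' : VField m M} {f h : M → ℝ} {p : M} {ι : Type*} [Fintype ι]
  {g : SymTensor m M}

/-! ### The curvature off the singular set -/

theorem curv_swap (hp : p ∉ g.sing) (hA : SmoothAt A p) (hZ : SmoothAt Z p) (hB : SmoothAt B p) :
    g.curv A Z B p = - g.curv Z A B p := by
  have h1 : bracket A Z = (fun _ : M ↦ (-1 : ℝ)) • bracket Z A := by
    ext1 q
    rw [bracket_swap]; simp
  have h2 := nabla_smul_left (f := fun _ : M ↦ (-1 : ℝ)) hp mdifferentiableAt_const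
    (hZ.bracket hA).diff hB.diff
  rw [← h1] at h2
  simp only [curv, h2]
  module

theorem curv_add_mid (hp : p ∉ g.sing) (hA : SmoothAt A p) (hZ : SmoothAt Z p)
    (hZ' : SmoothAt Z' p) (hB : SmoothAt B p) :
    g.curv A (Z + Z') B p = g.curv A Z B p + g.curv A Z' B p := by
  have h1 : g.nabla (Z + Z') B =ᶠ[𝓝 p] g.nabla Z B + g.nabla Z' B := by
    filter_upwards [hZ.eventually_diff, hZ'.eventually_diff, hB.eventually_diff,
      eventually_notMem_sing hp] with q h1 h2 h3 h4
    exact nabla_add_left h4 h1 h2 h3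
  have h2 : bracket A (Z + Z') =ᶠ[𝓝 p] bracket A Z + bracket A Z' := by
    filter_upwards [hZ.eventually_diff, hZ'.eventually_diff] with q h1 h2
    exact bracket_add_right h1 h2
  simp only [curv]
  rw [nabla_congr (.refl _ A) h1, nabla_congr h2 (.refl _ B),
    nabla_add_right hp hA.diff (smooth_nabla hp hZ hB).diff (smooth_nabla hp hZ' hB).diff,
    nabla_add_left hp hZ.diff hZ'.diff (smooth_nabla hp hA hB).diff,
    nabla_add_left hp (hA.bracket hZ).diff (hA.bracket hZ').diff hB.diff]
  module

theorem curv_smul_mid (hp : p ∉ g.sing) (hf : FunSmoothAt (m := m) f p) (hA : SmoothAt A p)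
    (hZ : SmoothAt Z p) (hB : SmoothAt B p) :
    g.curv A (f • Z) B p = f p • g.curv A Z B p := by
  have h1 : g.nabla (f • Z) B =ᶠ[𝓝 p] f • g.nabla Z B := by
    filter_upwards [hZ.eventually_diff, hf.eventually_diff, hB.eventually_diff,
      eventually_notMem_sing hp] with q h1 h2 h3 h4
    exact nabla_smul_left h4 h2 h1 h3
  have h2 := eventually_bracket_smul_right (A := A) hf hZ
  have hAf := FunSmoothAt.dirDeriv hA hf
  simp only [curv]
  rw [nabla_congr (.refl _ A) h1, nabla_congr h2 (.refl _ B),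
    nabla_smul_right hp hf.diff hA.diff (smooth_nabla hp hZ hB).diff,
    nabla_smul_left hp hf.diff hZ.diff (smooth_nabla hp hA hB).diff,
    nabla_add_left hp (SmoothAt.smul hAf hZ).diff (SmoothAt.smul hf (hA.bracket hZ)).diff hB.diff,
    nabla_smul_left hp hAf.diff hZ.diff hB.diff,
    nabla_smul_left hp hf.diff (hA.bracket hZ).diff hB.diff]
  module

theorem curv_add_right (hp : p ∉ g.sing) (hA : SmoothAt A p) (hZ : SmoothAt Z p)
    (hB : SmoothAt B p) (hB' : SmoothAt B' p) :
    g.curv A Z (B + B') p = g.curv A Z B p + g.curv A Z B' p := by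
  have h1 : ∀ {X : VField m M}, SmoothAt X p →
      g.nabla X (B + B') =ᶠ[𝓝 p] g.nabla X B + g.nabla X B' := fun hX ↦ by
    filter_upwards [hX.eventually_diff, hB'.eventually_diff, hB.eventually_diff,
      eventually_notMem_sing hp] with q h1 h2 h3 h4
    exact nabla_add_right h4 h1 h3 h2
  simp only [curv]
  rw [nabla_congr (.refl _ A) (h1 hZ), nabla_congr (.refl _ Z) (h1 hA),
    nabla_add_right hp hA.diff (smooth_nabla hp hZ hB).diff (smooth_nabla hp hZ hB').diff,
    nabla_add_right hp hZ.diff (smooth_nabla hp hA hB).diff (smooth_nabla hp hA hB').diff,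
    nabla_add_right hp (hA.bracket hZ).diff hB.diff hB'.diff]
  module

theorem curv_smul_right (hp : p ∉ g.sing) (hf : FunSmoothAt (m := m) f p) (hA : SmoothAt A p)
    (hZ : SmoothAt Z p) (hB : SmoothAt B p) :
    g.curv A Z (f • B) p = f p • g.curv A Z B p := by
  have h1 : ∀ {X : VField m M}, SmoothAt X p →
      g.nabla X (f • B) =ᶠ[𝓝 p] dirDeriv X f • B + f • g.nabla X B := fun hX ↦ by
    filter_upwards [hX.eventually_diff, hf.eventually_diff, hB.eventually_diff,
      eventually_notMem_sing hp] with q h1 h2 h3 h4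
    exact nabla_smul_right h4 h2 h1 h3
  have hAf := FunSmoothAt.dirDeriv hA hf
  have hZf := FunSmoothAt.dirDeriv hZ hf
  have hAB := smooth_nabla hp hA hB
  have hZB := smooth_nabla hp hZ hB
  simp only [curv]
  rw [nabla_congr (.refl _ A) (h1 hZ), nabla_congr (.refl _ Z) (h1 hA),
    nabla_add_right hp hA.diff (SmoothAt.smul hZf hB).diff (SmoothAt.smul hf hZB).diff,
    nabla_add_right hp hZ.diff (SmoothAt.smul hAf hB).diff (SmoothAt.smul hf hAB).diff,
    nabla_smul_right hp hf.diff (hA.bracket hZ).diff hB.diff,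
    nabla_smul_right hp hf.diff hA.diff hZB.diff, nabla_smul_right hp hf.diff hZ.diff hAB.diff,
    nabla_smul_right hp hAf.diff hZ.diff hB.diff, nabla_smul_right hp hZf.diff hA.diff hB.diff,
    dirDeriv_bracket hA hZ hf]
  module

theorem curv_congr_mid (hA : A =ᶠ[𝓝 p] A') (hZ : Z =ᶠ[𝓝 p] Z') (hB : B =ᶠ[𝓝 p] B') :
    g.curv A Z B p = g.curv A' Z' B' p := by
  have h1 : ∀ {X X' : VField m M}, X =ᶠ[𝓝 p] X' → g.nabla X B =ᶠ[𝓝 p] g.nabla X' B' :=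
    fun hX ↦ by
    filter_upwards [hX.eventuallyEq_nhds, hB.eventuallyEq_nhds] with q h1 h2
    exact nabla_congr h1 h2
  have h2 : bracket A Z =ᶠ[𝓝 p] bracket A' Z' := by
    filter_upwards [hA.eventuallyEq_nhds, hZ.eventuallyEq_nhds] with q h1 h2
    exact bracket_congr h1 h2
  simp only [curv]
  rw [nabla_congr hA (h1 hZ), nabla_congr hZ (h1 hA), nabla_congr h2 hB]

theorem curv_sum_mid (hp : p ∉ g.sing) (hA : SmoothAt A p) (hB : SmoothAt B p) {s : Finset ι}
    {X : ι → VField m M} (hX : ∀ i ∈ s, SmoothAt (X i) p) :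
    g.curv A (∑ i ∈ s, X i) B p = ∑ i ∈ s, g.curv A (X i) B p := by
  classical
  induction s using Finset.induction_on with
  | empty =>
    have hz : SmoothAt (0 : VField m M) p := by
      simpa using SmoothAt.sum (s := (∅ : Finset ι)) (X := X) (p := p) (by simp)
    have := curv_smul_mid (f := fun _ ↦ (0 : ℝ)) hp (.const 0) hA hz hB
    simpa using this
  | insert a s ha ih =>
    simp only [Finset.mem_insert, forall_eq_or_imp] at hX
    rw [Finset.sum_insert ha, Finset.sum_insert ha, curv_add_mid hp hA hX.1 (.sum hX.2) hB,
      ih hX.2]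

theorem IsDualFrame.curv_eq {E F : ι → VField m M} {W : Set M} (hW : g.IsDualFrame E F W)
    (hp : p ∈ W) (hA : SmoothAt A p) (hZ : SmoothAt Z p) (hB : SmoothAt B p) :
    g.curv A Z B p = ∑ i, g.form p (Z p) (E i p) • g.curv A (F i) B p := by
  have h1 : Z =ᶠ[𝓝 p] (∑ i, g.pair Z (E i) • F i : VField m M) := by
    filter_upwards [hW.isOpen.mem_nhds hp] with q hq
    exact (hW.complete q hq (Z q)).symm.trans
      (Finset.sum_apply q _ (fun i ↦ g.pair Z (E i) • F i)).symm
  have h2 := hW.notMem_sing hp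
  have h3 : ∀ i, FunSmoothAt (m := m) (g.pair Z (E i)) p :=
    fun i ↦ g.smooth_pair hZ (hW.smooth_left i p hp)
  rw [curv_congr_mid (.refl _ A) h1 (.refl _ B), curv_sum_mid h2 hA hB
    fun i _ ↦ .smul (h3 i) (hW.smooth_right i p hp)]
  exact Finset.sum_congr rfl fun i _ ↦ curv_smul_mid h2 (h3 i) hA (hW.smooth_right i p hp) hB

/-- The Riemann tensor `⟨R(A, Z) B, D⟩`. -/
def riem (g : SymTensor m M) (A Z B D : VField m M) (p : M) : ℝ := g.form p (g.curv A Z B p) (D p)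

/-- The endomorphism chosen in `ric` is determined by its values on the `F i p`; it is therefore a
sum of rank-one maps, whose traces are evaluations. -/
theorem IsDualFrame.ric_eq {E F : ι → VField m M} {W : Set M} (hW : g.IsDualFrame E F W)
    (hp : p ∈ W) (hA : SmoothAt A p) (hB : SmoothAt B p) :
    g.ric A B p = ∑ i, g.riem A (F i) B (E i) p := by
  have hex : ∃ T : TangentSpace (𝓡 m) p →ₗ[ℝ] TangentSpace (𝓡 m) p, ∀ Z : VField m M,
      SmoothAt Z p → T (Z p) = g.curv A Z B p := by
    refine ⟨∑ i, (g.form p (E i p)).toLinearMap.smulRight (g.curv A (F i) B p), fun Z hZ ↦ ?_⟩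
    rw [hW.curv_eq hp hA hZ hB]
    simp [g.symm p (E _ p)]
  have hT : hex.choose
      = ∑ i, (g.form p (E i p)).toLinearMap.smulRight (g.curv A (F i) B p) := by
    ext1 v
    conv_lhs => rw [← hW.complete p hp v]
    simp [g.symm p (E _ p), hex.choose_spec _ (hW.smooth_right _ p hp)]
  rw [ric, dif_pos hex, hT, map_sum]
  refine Finset.sum_congr rfl fun i _ ↦ ?_
  rw [LinearMap.trace_smulRight]
  exact g.symm ..

/-- The trace runs over the middle argument of the curvature, so linearity in the first is borrowed
from the middle one through `curv_swap`. -/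
theorem ric_add_left (hp : p ∉ g.sing) (hA : SmoothAt A p) (hA' : SmoothAt A' p)
    (hB : SmoothAt B p) : g.ric (A + A') B p = g.ric A B p + g.ric A' B p := by
  obtain ⟨E, F, W, hW, hpW⟩ := g.exists_isDualFrame hp
  rw [hW.ric_eq hpW (hA.add hA') hB, hW.ric_eq hpW hA hB, hW.ric_eq hpW hA' hB,
    ← Finset.sum_add_distrib]
  refine Finset.sum_congr rfl fun i _ ↦ ?_
  have hF := hW.smooth_right i p hpW
  simp only [riem]
  rw [curv_swap hp (hA.add hA') hF hB, curv_add_mid hp hF hA hA' hB, curv_swap hp hA hF hB,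
    curv_swap hp hA' hF hB]
  simp; ring

theorem ric_smul_left (hp : p ∉ g.sing) (hf : FunSmoothAt (m := m) f p) (hA : SmoothAt A p)
    (hB : SmoothAt B p) : g.ric (f • A) B p = f p * g.ric A B p := by
  obtain ⟨E, F, W, hW, hpW⟩ := g.exists_isDualFrame hp
  rw [hW.ric_eq hpW (hA.smul hf) hB, hW.ric_eq hpW hA hB, Finset.mul_sum]
  refine Finset.sum_congr rfl fun i _ ↦ ?_
  have hF := hW.smooth_right i p hpW
  simp only [riem]
  rw [curv_swap hp (hA.smul hf) hF hB, curv_smul_mid hp hf hF hA hB, curv_swap hp hA hF hB]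
  simp

theorem ric_add_right (hp : p ∉ g.sing) (hA : SmoothAt A p) (hB : SmoothAt B p)
    (hB' : SmoothAt B' p) : g.ric A (B + B') p = g.ric A B p + g.ric A B' p := by
  obtain ⟨E, F, W, hW, hpW⟩ := g.exists_isDualFrame hp
  rw [hW.ric_eq hpW hA (hB.add hB'), hW.ric_eq hpW hA hB, hW.ric_eq hpW hA hB',
    ← Finset.sum_add_distrib]
  refine Finset.sum_congr rfl fun i _ ↦ ?_
  have hF := hW.smooth_right i p hpW
  simp only [riem]
  rw [curv_add_right hp hA hF hB hB']
  simp

theorem ric_smul_right (hp : p ∉ g.sing) (hf : FunSmoothAt (m := m) f p) (hA : SmoothAt A p)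
    (hB : SmoothAt B p) : g.ric A (f • B) p = f p * g.ric A B p := by
  obtain ⟨E, F, W, hW, hpW⟩ := g.exists_isDualFrame hp
  rw [hW.ric_eq hpW hA (hB.smul hf), hW.ric_eq hpW hA hB, Finset.mul_sum]
  refine Finset.sum_congr rfl fun i _ ↦ ?_
  have hF := hW.smooth_right i p hpW
  simp only [riem]
  rw [curv_smul_right hp hf hA hF hB]
  simp

theorem ric_congr (hp : p ∉ g.sing) (hA : SmoothAt A p) (hB : SmoothAt B p) (h1 : A' =ᶠ[𝓝 p] A)
    (h2 : B' =ᶠ[𝓝 p] B) : g.ric A' B' p = g.ric A B p := by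
  obtain ⟨E, F, W, hW, hpW⟩ := g.exists_isDualFrame hp
  rw [hW.ric_eq hpW hA hB, hW.ric_eq hpW (hA.congr h1) (hB.congr h2)]
  refine Finset.sum_congr rfl fun i _ ↦ ?_
  simp only [riem]
  rw [curv_congr_mid h1 (.refl _ (F i)) h2]

theorem form_nabla_swap (hp : p ∉ g.sing) (hA : SmoothAt A p) (hB : SmoothAt B p)
    (hD : SmoothAt D p) (hZ : SmoothAt Z p) :
    g.form p (g.nabla A (g.nabla Z B) p) (D p)
      = dirDeriv A (g.dual Z B D) p - g.form p (g.nabla Z B p) (g.nabla A D p) := by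
  have hX := smooth_nabla hp hZ hB
  have h1 := g.dual_metric A (g.nabla Z B) D p
  have h2 : g.pair (g.nabla Z B) D =ᶠ[𝓝 p] g.dual Z B D := by
    filter_upwards [hZ.eventually_diff, hB.eventually_diff, hD.eventually_diff,
      eventually_notMem_sing hp] with q h1 h2 h3 h4
    exact form_nabla h4 h1 h2 h3
  rw [form_nabla hp hA.diff hX.diff hD.diff, g.symm, form_nabla hp hA.diff hD.diff hX.diff,
    ← dirDeriv_congr_fun h2]
  linarith

theorem IsDualFrame.form_eq {E F : ι → VField m M} {W : Set M} (hW : g.IsDualFrame E F W)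
    (hp : p ∈ W) (v w : TangentSpace (𝓡 m) p) :
    g.form p v w = ∑ i, g.form p v (E i p) * g.form p w (F i p) := by
  conv_lhs => rw [← hW.complete p hp v]
  simp [g.symm p w]

/-- The part of the Riemann tensor that only involves first derivatives of the dual connection. -/
def riemReg (g : SymTensor m M) (A Z B D : VField m M) (p : M) : ℝ :=
  dirDeriv A (g.dual Z B D) p - dirDeriv Z (g.dual A B D) p - g.dual (bracket A Z) B D p

theorem smooth_riemReg (hA : SmoothAt A p) (hZ : SmoothAt Z p) (hB : SmoothAt B p)
    (hD : SmoothAt D p) : FunSmoothAt (m := m) (g.riemReg A Z B D) p :=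
  .sub (.sub (.dirDeriv hA (g.smooth_dual hZ hB hD)) (.dirDeriv hZ (g.smooth_dual hA hB hD)))
    (g.smooth_dual (hA.bracket hZ) hB hD)

/-- Metric compatibility takes the outer derivative off each iterated ∇∇B and leaves products such
as ⟨∇_Z B, ∇_A D⟩, which the dual frame expands into values of □. Apart from the frame itself
everything is smooth across Σ. -/
theorem IsDualFrame.riem_eq {E F : ι → VField m M} {W : Set M} (hW : g.IsDualFrame E F W)
    (hp : p ∈ W) (hA : SmoothAt A p) (hZ : SmoothAt Z p) (hB : SmoothAt B p) (hD : SmoothAt D p) :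
    g.riem A Z B D p = g.riemReg A Z B D p
      + ∑ i, (g.dual A B (E i) p * g.dual Z D (F i) p - g.dual Z B (E i) p * g.dual A D (F i) p) := by
  have hp' := hW.notMem_sing hp
  have hE := fun i ↦ (hW.smooth_left i p hp).diff
  have hF := fun i ↦ (hW.smooth_right i p hp).diff
  simp only [riem, curv, map_sub, sub_apply, riemReg]
  rw [form_nabla_swap hp' hA hB hD hZ, form_nabla_swap hp' hZ hB hD hA,
    form_nabla hp' (hA.bracket hZ).diff hB.diff hD.diff, hW.form_eq hp (g.nabla Z B p),
    hW.form_eq hp (g.nabla A B p), Finset.sum_sub_distrib]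
  simp only [form_nabla hp' hA.diff hB.diff (hE _), form_nabla hp' hZ.diff hB.diff (hE _),
    form_nabla hp' hA.diff hD.diff (hF _), form_nabla hp' hZ.diff hD.diff (hF _)]
  ring

theorem smooth_ric (hp : p ∉ g.sing) (hA : SmoothAt A p) (hB : SmoothAt B p)
    (hA' : ∀ᶠ q in 𝓝 p, SmoothAt A q) (hB' : ∀ᶠ q in 𝓝 p, SmoothAt B q) :
    FunSmoothAt (m := m) (g.ric A B) p := by
  obtain ⟨E, F, W, hW, hpW⟩ := g.exists_isDualFrame hp
  have h1 : g.ric A B =ᶠ[𝓝 p] ∑ i, (g.riemReg A (F i) B (E i) + ∑ j,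
      (g.dual A B (E j) * g.dual (F i) (E i) (F j) - g.dual (F i) B (E j) * g.dual A (E i) (F j))) := by
    filter_upwards [hA', hB', hW.isOpen.mem_nhds hpW] with q h1 h2 h3
    rw [hW.ric_eq h3 h1 h2, Finset.sum_apply]
    refine Finset.sum_congr rfl fun i _ ↦ ?_
    rw [hW.riem_eq h3 h1 (hW.smooth_right i q h3) h2 (hW.smooth_left i q h3)]
    simp
  have hE := fun i ↦ hW.smooth_left i p hpW
  have hF := fun i ↦ hW.smooth_right i p hpW
  refine FunSmoothAt.congr (.sum fun i _ ↦ .add (smooth_riemReg hA (hF i) hB (hE i))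
    (.sum fun j _ ↦ .sub (.mul ?_ ?_) (.mul ?_ ?_))) h1
  · exact g.smooth_dual hA hB (hE j)
  · exact g.smooth_dual (hF i) (hE i) (hF j)
  · exact g.smooth_dual (hF i) hB (hE j)
  · exact g.smooth_dual hA (hE i) (hF j)

end SymTensor

/-! ### Division by a defining function -/

section Hadamard

open Set Filter

variable {E : Type} [NormedAddCommGroup E] [NormedSpace ℝ E] [FiniteDimensional ℝ E]

/-- Induction by differentiating under the integral sign; compactness of a closed ball times `[0,
1]` provides the dominating constant. -/
theorem contDiff_intervalIntegral_nat (n : ℕ) {F : Type} [NormedAddCommGroup F]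
    [NormedSpace ℝ F] [CompleteSpace F] {G : E → ℝ → F} (hG : ContDiff ℝ n (Function.uncurry G)) :
    ContDiff ℝ n (fun y ↦ ∫ s in (0 : ℝ)..1, G y s) := by
  induction n generalizing F with
  | zero =>
    simp only [CharP.cast_eq_zero, contDiff_zero] at hG ⊢
    exact intervalIntegral.continuous_parametric_intervalIntegral_of_continuous' hG 0 1
  | succ n ih =>
    have hG1 : ContDiff ℝ ((n : WithTop ℕ∞) + 1) (Function.uncurry G) := mod_cast hG
    let G' : E → ℝ → E →L[ℝ] F := fun y s ↦
      (fderiv ℝ (Function.uncurry G) (y, s)).comp (ContinuousLinearMap.inl ℝ E ℝ)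
    have hG' : ContDiff ℝ n (Function.uncurry G') :=
      (hG1.fderiv_right le_rfl).clm_comp contDiff_const
    have hd : ∀ y s, HasFDerivAt (fun y ↦ G y s) (G' y s) y := fun y s ↦ by
      have h1 : HasFDerivAt (Function.uncurry G) (fderiv ℝ (Function.uncurry G) (y, s)) (y, s) :=
        ((hG1.differentiable (by simp)) (y, s)).hasFDerivAt
      exact HasFDerivAt.comp (f := fun z : E ↦ (z, s)) y h1 (hasFDerivAt_prodMk_left y s)
    push_cast
    rw [contDiff_succ_iff_hasFDerivAt]
    refine ⟨fun y ↦ ∫ s in (0 : ℝ)..1, G' y s, ih hG', fun y ↦ ?_⟩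
    have hK : IsCompact (Metric.closedBall y 1 ×ˢ Icc (0 : ℝ) 1) :=
      (isCompact_closedBall y 1).prod isCompact_Icc
    obtain ⟨c, hc⟩ := hK.exists_bound_of_continuousOn (f := Function.uncurry G')
      hG'.continuous.continuousOn
    have hcont : ∀ y, Continuous (G y) := fun y ↦ hG.continuous.uncurry_left y
    have hcont' : ∀ y, Continuous (G' y) := fun y ↦ hG'.continuous.uncurry_left y
    refine intervalIntegral.hasFDerivAt_integral_of_dominated_of_fderiv_le (F' := G')
      (bound := fun _ ↦ c) (Metric.closedBall_mem_nhds y one_pos)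
      (.of_forall fun z ↦ (hcont z).aestronglyMeasurable) ((hcont y).intervalIntegrable ..)
      (hcont' y).aestronglyMeasurable (.of_forall fun s hs z hz ↦ ?_) (by simp)
      (.of_forall fun s _ z _ ↦ hd z s)
    rw [uIoc_of_le zero_le_one] at hs
    exact hc (z, s) ⟨hz, Ioc_subset_Icc_self hs⟩

theorem contDiff_intervalIntegral {F : Type} [NormedAddCommGroup F]
    [NormedSpace ℝ F] [CompleteSpace F] {G : E → ℝ → F} (hG : ContDiff ℝ ∞ (Function.uncurry G)) :
    ContDiff ℝ ∞ (fun y ↦ ∫ s in (0 : ℝ)..1, G y s) :=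
  contDiff_infty.2 fun n ↦ contDiff_intervalIntegral_nat n (hG.of_le (mod_cast le_top))

theorem exists_eq_mul_of_linear {l : E →L[ℝ] ℝ} {e : E} (he : l e = 1) {F : Type}
    [NormedAddCommGroup F] [NormedSpace ℝ F] [CompleteSpace F] {f : E → F}
    (hf : ContDiff ℝ ∞ f) (h0 : ∀ y, l y = 0 → f y = 0) :
    ∃ h : E → F, ContDiff ℝ ∞ h ∧ ∀ y, f y = l y • h y := by
  -- For fixed `y` this segment runs from the projection of `y` to `ker l` along `e`, at `s = 0`, to
  -- `y`, at `s = 1`. Since `f` vanishes at its start, integrating the derivative of `f` along it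
  -- gives `f y`, with `l y` as a factor.
  let c : E → ℝ → E := fun y s ↦ y - ((1 - s) * l y) • e
  have hc : ContDiff ℝ ∞ (Function.uncurry c) := by
    unfold c Function.uncurry
    fun_prop
  refine ⟨fun y ↦ ∫ s in (0 : ℝ)..1, fderiv ℝ f (c y s) e, contDiff_intervalIntegral ?_, ?_⟩
  · exact ((hf.fderiv_right (m := ∞) (by simp)).comp hc).clm_apply contDiff_const
  · intro y
    have hd : ∀ s, HasDerivAt (fun s ↦ f (c y s)) (l y • fderiv ℝ f (c y s) e) s := by
      intro s
      have h1 : HasDerivAt (c y) (l y • e) s := by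
        have : HasDerivAt (fun s : ℝ ↦ y - ((1 - s) * l y) • e) (-((-1 * l y) • e)) s :=
          ((((hasDerivAt_id s).const_sub 1).mul_const (l y)).smul_const e).const_sub y
        simpa using this
      have h2 := ((hf.differentiable (by simp)) (c y s)).hasFDerivAt.comp_hasDerivAt s h1
      rw [map_smul] at h2
      exact h2
    have hcont : Continuous fun s ↦ l y • fderiv ℝ f (c y s) e := by
      have : Continuous (c y) := hc.continuous.uncurry_left y
      exact (((hf.continuous_fderiv (by simp)).comp this).clm_apply continuous_const).const_smul _
    have := intervalIntegral.integral_eq_sub_of_hasDerivAt (fun s _ ↦ hd s)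
      (hcont.intervalIntegrable 0 1)
    have h00 : f (c y 0) = 0 := h0 _ (by simp [c, he])
    rw [h00, sub_zero, intervalIntegral.integral_smul] at this
    simpa [c] using this.symm

/-- Hadamard's lemma for a function with nonzero differential: straighten it to a linear function,
cut off, and use `exists_eq_mul_of_linear`. -/
theorem exists_eventually_eq_mul {u f : E → ℝ} {x : E} (hu : ∀ᶠ y in 𝓝 x, ContDiffAt ℝ ∞ u y)
    (hf : ∀ᶠ y in 𝓝 x, ContDiffAt ℝ ∞ f y) (hdu : fderiv ℝ u x ≠ 0)
    (h0 : ∀ᶠ y in 𝓝 x, u y = 0 → f y = 0) :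
    ∃ h : E → ℝ, ContDiffAt ℝ ∞ h x ∧ ∀ᶠ y in 𝓝 x, f y = u y * h y := by
  set l := fderiv ℝ u x
  obtain ⟨e, he⟩ : ∃ e, l e = 1 := by
    obtain ⟨v, hv⟩ := DFunLike.ne_iff.1 hdu
    exact ⟨(l v)⁻¹ • v, by simpa using inv_mul_cancel₀ (by simpa using hv)⟩
  -- This change of coordinates has the identity as derivative at `x` and satisfies `l ∘ Φ = u`.
  let Φ : E → E := fun y ↦ y + (u y - l y) • e
  have hlΦ : ∀ y, l (Φ y) = u y := fun y ↦ by simp [Φ, he]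
  have hΦ : ∀ᶠ y in 𝓝 x, ContDiffAt ℝ ∞ Φ y := by
    filter_upwards [hu] with y hy
    exact contDiffAt_id.add ((hy.sub l.contDiff.contDiffAt).smul contDiffAt_const)
  have hΦx : HasFDerivAt Φ ((ContinuousLinearEquiv.refl ℝ E : E ≃L[ℝ] E) : E →L[ℝ] E) x := by
    have h1 : HasFDerivAt u l x := (hu.self_of_nhds.differentiableAt (by simp)).hasFDerivAt
    have h2 := (hasFDerivAt_id x).add ((h1.sub l.hasFDerivAt).smul_const e)
    rw [sub_self] at h2
    have h3 : ((ContinuousLinearEquiv.refl ℝ E : E ≃L[ℝ] E) : E →L[ℝ] E)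
        = ContinuousLinearMap.id ℝ E + ContinuousLinearMap.smulRight (0 : E →L[ℝ] ℝ) e := by
      ext v; simp
    rw [h3]
    exact h2
  have hne : (∞ : WithTop ℕ∞) ≠ 0 := by simp
  let Ψ := hΦ.self_of_nhds.toOpenPartialHomeomorph Φ hΦx hne
  have hxs : x ∈ Ψ.source := hΦ.self_of_nhds.mem_toOpenPartialHomeomorph_source hΦx hne
  have hxt : Φ x ∈ Ψ.target := Ψ.map_source hxs
  have hΨx : Ψ.symm (Φ x) = x := Ψ.left_inv hxs
  have hcs : ContinuousAt Ψ.symm (Φ x) := Ψ.continuousAt_symm hxt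
  -- The inverse of `Φ` has to be smooth at all points near `Φ x`, so the derivative must be
  -- invertible near `x` and not only at `x`.
  have hinv : ∀ᶠ y in 𝓝 x, fderiv ℝ Φ y ∈ range ((↑) : (E ≃L[ℝ] E) → E →L[ℝ] E) := by
    have h1 : ContinuousAt (fderiv ℝ Φ) x :=
      (hΦ.self_of_nhds.fderiv_right (m := ∞) (by simp)).continuousAt
    refine h1 ?_
    rw [hΦx.fderiv]
    exact ContinuousLinearEquiv.nhds _
  have hΨ : ∀ᶠ z in 𝓝 (Φ x), ContDiffAt ℝ ∞ Ψ.symm z := by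
    rw [← hΨx] at hinv hΦ
    filter_upwards [hcs.eventually hinv, hcs.eventually hΦ, Ψ.open_target.mem_nhds hxt]
      with z h1 h2 h3
    obtain ⟨L, hL⟩ := h1
    refine Ψ.contDiffAt_symm (f₀' := L) h3 ?_ h2
    rw [hL]
    exact (h2.differentiableAt (by simp)).hasFDerivAt
  have hS : ∀ᶠ z in 𝓝 (Φ x), ContDiffAt ℝ ∞ (f ∘ Ψ.symm) z ∧ (l z = 0 → f (Ψ.symm z) = 0) := by
    rw [← hΨx] at hf h0
    filter_upwards [hcs.eventually hf, hcs.eventually h0, hΨ, Ψ.open_target.mem_nhds hxt]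
      with z h1 h2 h3 h4
    refine ⟨h1.comp z h3, fun hz ↦ h2 ?_⟩
    rw [← hlΦ]
    exact (congrArg l (Ψ.right_inv h4)).trans hz
  obtain ⟨r, hr, hrS⟩ := Metric.nhds_basis_closedBall.mem_iff.1 hS
  -- The cutoff turns the germ of `f ∘ Ψ.symm` into a globally smooth function that still vanishes
  -- on `ker l`.
  let χ : ContDiffBump (Φ x) := ⟨r / 2, r, half_pos hr, half_lt_self hr⟩
  have hF : ContDiff ℝ ∞ fun z ↦ χ z * f (Ψ.symm z) := by
    rw [contDiff_iff_contDiffAt]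
    intro z
    by_cases hz : z ∈ Metric.closedBall (Φ x) r
    · exact χ.contDiffAt.mul (hrS hz).1
    · refine contDiffAt_const (c := (0 : ℝ)) |>.congr_of_eventuallyEq ?_
      filter_upwards [Metric.isClosed_closedBall.isOpen_compl.mem_nhds hz] with w hw
      rw [χ.zero_of_le_dist (by
        have := not_le.1 (Metric.mem_closedBall.not.1 hw)
        exact this.le), zero_mul]
  obtain ⟨h, hh, hFh⟩ := exists_eq_mul_of_linear he hF fun z hz ↦ by
    by_cases hzr : z ∈ Metric.closedBall (Φ x) r
    · rw [(hrS hzr).2 hz, mul_zero]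
    · rw [χ.zero_of_le_dist (by exact (not_le.1 (Metric.mem_closedBall.not.1 hzr)).le), zero_mul]
  refine ⟨h ∘ Φ, hh.contDiffAt.comp x hΦ.self_of_nhds, ?_⟩
  have hχ : ∀ᶠ y in 𝓝 x, χ (Φ y) = 1 :=
    hΦ.self_of_nhds.continuousAt.eventually χ.eventuallyEq_one
  filter_upwards [hχ, Ψ.open_source.mem_nhds hxs] with y h1 h2
  have h3 := hFh (Φ y)
  have h4 : Ψ.symm (Φ y) = y := Ψ.left_inv h2
  rw [h1, one_mul, hlΦ, h4] at h3
  exact h3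

end Hadamard

/-! ### Hadamard's lemma and Lagrange multipliers on the manifold -/

section Chart

open Filter

variable {f u : M → ℝ} {p : M} {v : TangentSpace (𝓡 m) p}

theorem eventually_extChartAt_symm {P : M → Prop} (h : ∀ᶠ q in 𝓝 p, P q) :
    ∀ᶠ y in 𝓝 (extChartAt (𝓡 m) p p), P ((extChartAt (𝓡 m) p).symm y) := by
  have h1 : ContinuousAt (extChartAt (𝓡 m) p).symm (extChartAt (𝓡 m) p p) :=
    continuousAt_extChartAt_symm p
  rw [← extChartAt_to_inv (I := 𝓡 m) p] at h
  exact h1.eventually h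

theorem contDiffAt_comp_extChartAt_symm {y : EuclideanSpace ℝ (Fin m)}
    (hy : y ∈ (extChartAt (𝓡 m) p).target)
    (hf : FunSmoothAt (m := m) f ((extChartAt (𝓡 m) p).symm y)) :
    ContDiffAt ℝ ∞ (f ∘ (extChartAt (𝓡 m) p).symm) y := by
  rw [← contMDiffAt_iff_contDiffAt]
  exact ContMDiffAt.comp y hf
    ((contMDiffOn_extChartAt_symm p).contMDiffAt (extChartAt_target_mem_nhds' hy))

theorem mfderiv_eq_chart (hf : FunSmoothAt (m := m) f p) :
    mfderiv (𝓡 m) 𝓘(ℝ, ℝ) f p v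
      = fderiv ℝ (f ∘ (extChartAt (𝓡 m) p).symm) (extChartAt (𝓡 m) p p)
        (mfderiv (𝓡 m) 𝓘(ℝ, EuclideanSpace ℝ (Fin m)) (extChartAt (𝓡 m) p) p v) := by
  have h1 : f =ᶠ[𝓝 p] (f ∘ (extChartAt (𝓡 m) p).symm) ∘ extChartAt (𝓡 m) p := by
    filter_upwards [extChartAt_source_mem_nhds (I := 𝓡 m) p] with q hq
    exact congrArg f ((extChartAt (𝓡 m) p).left_inv hq).symm
  have h2 := contDiffAt_comp_extChartAt_symm (m := m) (p := p) (f := f)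
    (mem_extChartAt_target p) (by rwa [extChartAt_to_inv])
  rw [h1.mfderiv_eq, mfderiv_comp p (h2.contMDiffAt.mdifferentiableAt (by simp))
    (mdifferentiableAt_extChartAt (mem_chart_source _ p)), mfderiv_eq_fderiv]
  rfl

theorem exists_eventually_eq_mul_manifold (hu : ∀ᶠ q in 𝓝 p, FunSmoothAt (m := m) u q)
    (hf : ∀ᶠ q in 𝓝 p, FunSmoothAt (m := m) f q)
    (hdu : mfderiv (𝓡 m) 𝓘(ℝ, ℝ) u p v ≠ 0) (h0 : ∀ᶠ q in 𝓝 p, u q = 0 → f q = 0) :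
    ∃ h : M → ℝ, FunSmoothAt (m := m) h p ∧ ∀ᶠ q in 𝓝 p, f q = u q * h q := by
  set φ := extChartAt (𝓡 m) p
  have ht := extChartAt_target_mem_nhds (I := 𝓡 m) p
  obtain ⟨h, hh, hfh⟩ := exists_eventually_eq_mul (x := φ p) (u := u ∘ φ.symm) (f := f ∘ φ.symm)
    (by filter_upwards [eventually_extChartAt_symm hu, ht] with y h1 h2
        exact contDiffAt_comp_extChartAt_symm h2 h1)
    (by filter_upwards [eventually_extChartAt_symm hf, ht] with y h1 h2
        exact contDiffAt_comp_extChartAt_symm h2 h1)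
    (fun hz ↦ hdu (by rw [mfderiv_eq_chart hu.self_of_nhds, hz]; rfl))
    (eventually_extChartAt_symm h0)
  refine ⟨h ∘ φ, ContMDiffAt.comp p hh.contMDiffAt contMDiffAt_extChartAt, ?_⟩
  filter_upwards [(continuousAt_extChartAt p).eventually hfh,
    extChartAt_source_mem_nhds (I := 𝓡 m) p] with q h1 h2
  have h3 : φ.symm (φ q) = q := φ.left_inv h2
  have h4 : f (φ.symm (φ q)) = u (φ.symm (φ q)) * h (φ q) := h1
  rw [h3] at h4
  exact h4

/-- On the level set `u = 0` the function `f` is constant, so `p` is a constrained extremum and a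
Lagrange multiplier makes `df` proportional to `du`. This is how the kernel of `du` is placed inside
`tangentSing`. -/
theorem mfderiv_eq_zero_of_tangent (hu : FunSmoothAt (m := m) u p) (hf : FunSmoothAt (m := m) f p)
    (hup : u p = 0) {w : TangentSpace (𝓡 m) p} (hdu : mfderiv (𝓡 m) 𝓘(ℝ, ℝ) u p w ≠ 0)
    (h0 : ∀ᶠ q in 𝓝 p, u q = 0 → f q = 0) (hv : mfderiv (𝓡 m) 𝓘(ℝ, ℝ) u p v = 0) :
    mfderiv (𝓡 m) 𝓘(ℝ, ℝ) f p v = 0 := by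
  set φ := extChartAt (𝓡 m) p
  have hu' := contDiffAt_comp_extChartAt_symm (m := m) (p := p) (f := u)
    (mem_extChartAt_target p) (by rwa [extChartAt_to_inv])
  have hf' := contDiffAt_comp_extChartAt_symm (m := m) (p := p) (f := f)
    (mem_extChartAt_target p) (by rwa [extChartAt_to_inv])
  have hext : IsLocalExtrOn (f ∘ φ.symm)
      {y | (u ∘ φ.symm) y = (u ∘ φ.symm) (φ p)} (φ p) := by
    refine Or.inl ?_
    filter_upwards [nhdsWithin_le_nhds (eventually_extChartAt_symm h0), self_mem_nhdsWithin]
      with y h1 h2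
    have hz : u (φ.symm y) = 0 := by
      have : u (φ.symm y) = u (φ.symm (φ p)) := h2
      rw [this, extChartAt_to_inv, hup]
    have hz' : f (φ.symm (φ p)) = 0 := by
      rw [extChartAt_to_inv]; exact h0.self_of_nhds hup
    exact (hz'.trans (h1 hz).symm).le
  obtain ⟨a, b, hab, hsum⟩ := hext.exists_multipliers_of_hasStrictFDerivAt_1d
    (hu'.hasStrictFDerivAt (by simp)) (hf'.hasStrictFDerivAt (by simp))
  rw [mfderiv_eq_chart hu] at hdu hv
  rw [mfderiv_eq_chart hf]
  set D := mfderiv (𝓡 m) 𝓘(ℝ, EuclideanSpace ℝ (Fin m)) (extChartAt (𝓡 m) p) p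
  have key : ∀ z : TangentSpace (𝓡 m) p, a * fderiv ℝ (u ∘ φ.symm) (φ p) (D z)
      + b * fderiv ℝ (f ∘ φ.symm) (φ p) (D z) = 0 := fun z ↦ congrArg (fun T ↦ T (D z)) hsum
  have hb : b ≠ 0 := by
    rintro rfl
    have := key w
    rw [zero_mul, add_zero] at this
    exact hab (by rw [(mul_eq_zero.1 this).resolve_right hdu]; rfl)
  have h4 := key v
  have h5 : fderiv ℝ (u ∘ φ.symm) (φ p) (D v) = 0 := hv
  rw [h5, mul_zero, zero_add] at h4
  exact (mul_eq_zero.1 h4).resolve_left hb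

end Chart

/-! ### Coordinate fields -/

section Coordinates

variable {p q : M}

theorem eventually_smoothAt_extend (v : TangentSpace (𝓡 m) p) :
    ∀ᶠ q in 𝓝 p, SmoothAt (FiberBundle.extend (EuclideanSpace ℝ (Fin m)) v) q := by
  obtain ⟨s, hs, hs'⟩ := FiberBundle.exists_contMDiffOn_extend (k := ∞) (𝓡 m)
    (EuclideanSpace ℝ (Fin m)) v
  filter_upwards [interior_mem_nhds.2 hs] with q hq
  exact ContMDiffOn.contMDiffAt hs' (mem_interior_iff_mem_nhds.1 hq)

/-- The coordinate vector fields of the preferred chart at `p`. -/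
def coordField (p : M) (a : Fin m) : VField m M := fun q ↦
  (trivializationAt (EuclideanSpace ℝ (Fin m)) (TangentSpace (𝓡 m) : M → Type _) p).symmL ℝ q
    (EuclideanSpace.single a (1 : ℝ))

theorem eventually_smoothAt_coordField (p : M) (a : Fin m) :
    ∀ᶠ q in 𝓝 p, SmoothAt (coordField p a) q := by
  let t := trivializationAt (EuclideanSpace ℝ (Fin m)) (TangentSpace (𝓡 m) : M → Type _) p
  have hp : p ∈ t.baseSet := FiberBundle.mem_baseSet_trivializationAt' p
  have h2 : (t ⟨p, coordField p a p⟩).2 = EuclideanSpace.single a (1 : ℝ) := by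
    have h3 : coordField p a p = t.symm p (EuclideanSpace.single a (1 : ℝ)) :=
      t.symmL_apply (R := ℝ) hp _
    rw [h3, t.apply_mk_symm hp]
  filter_upwards [(eventually_smoothAt_extend (coordField p a p)).eventually_nhds,
    t.open_baseSet.eventually_mem hp] with q hq hq'
  refine hq.self_of_nhds.congr ?_
  filter_upwards [t.open_baseSet.eventually_mem hq'] with r hr
  exact (t.symmL_apply (R := ℝ) hr _).trans (congrArg (t.symm r) h2.symm)

theorem coordField_eq (hq : q ∈ (chartAt (EuclideanSpace ℝ (Fin m)) p).source) (a : Fin m) :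
    coordField p a q = mfderiv (𝓡 m) (𝓡 m) (chartAt (EuclideanSpace ℝ (Fin m)) p).symm
      (chartAt (EuclideanSpace ℝ (Fin m)) p q) (EuclideanSpace.single a (1 : ℝ)) := by
  rw [coordField, TangentBundle.symmL_trivializationAt hq]
  simp only [extChartAt_coe_symm, extChartAt_coe, modelWithCornersSelf_coe,
    modelWithCornersSelf_coe_symm, Set.range_id, mfderivWithin_univ]
  rfl

theorem exists_basis_coordField (hq : q ∈ (chartAt (EuclideanSpace ℝ (Fin m)) p).source) :
    ∃ b : Module.Basis (Fin m) ℝ (TangentSpace (𝓡 m) q), ∀ a, b a = coordField p a q := by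
  let t := trivializationAt (EuclideanSpace ℝ (Fin m)) (TangentSpace (𝓡 m) : M → Type _) p
  have hq' : q ∈ t.baseSet := by simpa [t] using hq
  refine ⟨(EuclideanSpace.basisFun (Fin m) ℝ).toBasis.map
    (t.continuousLinearEquivAt ℝ q hq').symm.toLinearEquiv, fun a ↦ ?_⟩
  simp only [Module.Basis.map_apply, OrthonormalBasis.coe_toBasis, EuclideanSpace.basisFun_apply]
  exact congrFun (t.symm_continuousLinearEquivAt_eq (R := ℝ) hq') _

end Coordinates

namespace SymTensor

variable {g : SymTensor m M} {p : M}

/-! ### A defining function of the singular set -/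

/-- The Gram determinant of the coordinate fields of the preferred chart at `p`. -/
def coordGram (g : SymTensor m M) (p q : M) : ℝ :=
  Matrix.det (Matrix.of fun a b : Fin m ↦ g.pair (coordField p a) (coordField p b) q)

theorem eventually_smooth_coordGram (p : M) :
    ∀ᶠ q in 𝓝 p, FunSmoothAt (m := m) (g.coordGram p) q := by
  have h := Filter.eventually_all.2 (fun a : Fin m ↦ eventually_smoothAt_coordField p a)
  filter_upwards [h] with q hq
  exact FunSmoothAt.det fun a b ↦ g.smooth_pair (hq a) (hq b)

theorem coordGram_eq_zero_iff {q : M} (hq : q ∈ (chartAt (EuclideanSpace ℝ (Fin m)) p).source) :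
    g.coordGram p q = 0 ↔ q ∈ g.sing := by
  obtain ⟨b, hb⟩ := exists_basis_coordField hq
  rw [coordGram, ← Matrix.exists_vecMul_eq_zero_iff]
  have key : ∀ c : Fin m → ℝ, Matrix.vecMul c
      (Matrix.of fun a b : Fin m ↦ g.pair (coordField p a) (coordField p b) q) = 0 ↔
      ∑ a, c a • b a ∈ g.rad q := by
    intro c
    have h1 : ∀ a, Matrix.vecMul c
        (Matrix.of fun a b : Fin m ↦ g.pair (coordField p a) (coordField p b) q) a
        = g.form q (∑ a, c a • b a) (b a) := by
      intro a
      simp [Matrix.vecMul, dotProduct, pair, hb]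
    constructor
    · intro h w
      rw [← b.sum_repr w, map_sum]
      exact Finset.sum_eq_zero fun a _ ↦ by rw [map_smul, ← h1, h]; simp
    · exact fun h ↦ funext fun a ↦ (h1 a).trans (h _)
  constructor
  · rintro ⟨c, hc, hc0⟩
    exact ⟨_, (key c).1 hc0, fun h ↦
      hc (funext (Fintype.linearIndependent_iff.1 b.linearIndependent c h))⟩
  · rintro ⟨v, hv, hv0⟩
    refine ⟨b.repr v, fun h ↦ hv0 ?_, (key _).2 (by rwa [b.sum_repr])⟩
    rw [← b.sum_repr v]
    exact Finset.sum_eq_zero fun a _ ↦ by rw [h]; simp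

theorem mfderiv_coordGram_ne_zero (hg : g.IsTransverseRiemannLorentz) (hp : p ∈ g.sing) :
    ∃ v : TangentSpace (𝓡 m) p, mfderiv (𝓡 m) 𝓘(ℝ, ℝ) (g.coordGram p) p v ≠ 0 := by
  let φ := chartAt (EuclideanSpace ℝ (Fin m)) p
  have hp' : p ∈ φ.source := mem_chart_source _ p
  have h1 : ∀ q ∈ φ.source, g.coordGram p q = g.gramDet φ (φ q) := by
    intro q hq
    -- The base point is generalised to `r`, because `φ.symm (φ q)` and `q` index different tangent
    -- spaces until their equality is substituted.
    have h2 : ∀ r, r = q → Matrix.det (Matrix.of fun a b : Fin m ↦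
        g.pair (coordField p a) (coordField p b) q) = Matrix.det (Matrix.of fun a b : Fin m ↦
        g.form r (mfderiv (𝓡 m) (𝓡 m) φ.symm (φ q) (EuclideanSpace.single a (1 : ℝ)))
        (mfderiv (𝓡 m) (𝓡 m) φ.symm (φ q) (EuclideanSpace.single b (1 : ℝ)))) := by
      rintro r rfl
      simp only [pair, coordField_eq hq]
      rfl
    exact h2 _ (φ.left_inv hq)
  have h3 := hg.transverse φ (IsManifold.chart_mem_maximalAtlas p) (φ p) (φ.map_source hp')
    (by rw [← h1 p hp', coordGram_eq_zero_iff hp']; exact hp)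
  by_contra! h
  refine h3 ?_
  have hinv := isInvertible_mfderiv_extChartAt (I := 𝓡 m) (mem_extChartAt_source (I := 𝓡 m) p)
  obtain ⟨L, hL⟩ := hinv
  ext w
  have h4 := h (L.symm w)
  rw [mfderiv_eq_chart (g.eventually_smooth_coordGram p).self_of_nhds, ← hL] at h4
  replace h4 := (congrArg (fderiv ℝ (g.coordGram p ∘ (extChartAt (𝓡 m) p).symm)
    (extChartAt (𝓡 m) p p)) (L.apply_symm_apply w)).symm.trans h4
  have h6 : g.gramDet φ =ᶠ[𝓝 (φ p)] g.coordGram p ∘ (extChartAt (𝓡 m) p).symm := by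
    filter_upwards [φ.open_target.mem_nhds (φ.map_source hp')] with y hy
    have := h1 (φ.symm y) (φ.map_target hy)
    rw [φ.right_inv hy] at this
    exact this.symm
  rw [h6.fderiv_eq]
  exact h4

end SymTensor

/-! ### The radical is a line -/

namespace SymTensor

variable {g : SymTensor m M} {p : M}

/-- Two independent radical vectors would make the Gram determinant vanish to second order, against
transversality. In coordinates, `v_a det G = ∑ j, (v G)_j adj(G)_{ja}`; the first factors vanish at
`p` because `v` is radical, the second because of another radical vector without `a`-th coordinate,
so the differential of the determinant is zero. -/
theorem exists_eq_smul_of_mem_rad (hg : g.IsTransverseRiemannLorentz) (hp : p ∈ g.sing)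
    {v w : TangentSpace (𝓡 m) p} (hv : v ∈ g.rad p) (hw : w ∈ g.rad p) (hv0 : v ≠ 0) :
    ∃ c : ℝ, w = c • v := by
  obtain ⟨b, hb⟩ := exists_basis_coordField (mem_chart_source (EuclideanSpace ℝ (Fin m)) p)
  obtain ⟨a, ha⟩ : ∃ a, b.repr v a ≠ 0 := by
    by_contra! h
    exact hv0 (b.repr.map_eq_zero_iff.1 (Finsupp.ext h))
  refine ⟨b.repr w a / b.repr v a, ?_⟩
  by_contra hne
  set u := w - (b.repr w a / b.repr v a) • v
  have hu0 : u ≠ 0 := sub_ne_zero.2 hne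
  have hu : u ∈ g.rad p := fun z ↦ by simp [u, hv z, hw z]
  have hua : b.repr u a = 0 := by simp [u, ha]
  obtain ⟨z, hz⟩ := mfderiv_coordGram_ne_zero hg hp
  let X : Fin m → VField m M := coordField p
  let Z : VField m M := FiberBundle.extend (EuclideanSpace ℝ (Fin m)) z
  have hX : ∀ i, SmoothAt (X i) p := fun i ↦ (eventually_smoothAt_coordField p i).self_of_nhds
  let G : M → Matrix (Fin m) (Fin m) ℝ := fun q ↦ Matrix.of fun i j ↦ g.pair (X i) (X j) q
  have hG : ∀ i j, FunSmoothAt (m := m) (g.pair (X i) (X j)) p :=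
    fun i j ↦ g.smooth_pair (hX i) (hX j)
  let ρ : Fin m → M → ℝ := fun j ↦ ∑ i, (fun _ ↦ b.repr v i) * g.pair (X i) (X j)
  let α : Fin m → M → ℝ := fun j q ↦ (G q).adjugate j a
  have hform : ∀ (x : TangentSpace (𝓡 m) p) j, ∑ i, b.repr x i * g.pair (X i) (X j) p
      = g.form p x (X j p) := by
    intro x j
    conv_rhs => rw [← b.sum_repr x]
    simp [pair, hb, X]
  have hρ0 : ∀ j, ρ j p = 0 := by
    intro j
    have := hform v j
    rw [hv] at this
    simpa [ρ] using this
  -- The minor has row `a` of the Gram matrix replaced; `u` has no `a`-th coordinate and thus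
  -- remains a left null vector.
  have hα0 : ∀ j, α j p = 0 := by
    intro j
    simp only [α, Matrix.adjugate_apply]
    refine Matrix.exists_vecMul_eq_zero_iff.1 ⟨b.repr u, fun h ↦ hu0 ?_, ?_⟩
    · exact b.repr.map_eq_zero_iff.1 (DFunLike.coe_injective h)
    · ext i
      have h1 := hform u i
      rw [hu] at h1
      refine Eq.trans ?_ h1
      rw [Matrix.vecMul, dotProduct]
      refine Finset.sum_congr rfl fun k _ ↦ ?_
      by_cases hk : k = a
      · simp [hk, hua]
      · simp [Matrix.updateRow_apply, hk, G]
  have hρ : ∀ j, FunSmoothAt (m := m) (ρ j) p := fun j ↦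
    .sum fun i _ ↦ .mul (.const _) (hG i j)
  have hα : ∀ j, FunSmoothAt (m := m) (α j) p := by
    intro j
    have : α j = fun q ↦ Matrix.det (Matrix.of fun k l ↦
        (if k = a then fun _ ↦ if l = j then 1 else 0 else g.pair (X k) (X l) : M → ℝ) q) := by
      ext q
      simp only [α, Matrix.adjugate_apply]
      congr 1
      ext k l
      by_cases hk : k = a <;> simp [Matrix.updateRow_apply, hk, Pi.single_apply, G]
    rw [this]
    refine FunSmoothAt.det fun k l ↦ ?_
    split_ifs
    · exact .const _
    · exact .const _
    · exact hG k l
  have key : (fun _ ↦ b.repr v a) * g.coordGram p = ∑ j, ρ j * α j := by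
    ext q
    have h1 := congrFun (congrArg (Matrix.vecMul (b.repr v)) (Matrix.mul_adjugate (G q))) a
    rw [← Matrix.vecMul_vecMul] at h1
    rw [Matrix.vecMul_smul, Matrix.vecMul_one] at h1
    rw [Finset.sum_apply]
    simp only [Matrix.vecMul, dotProduct, Pi.smul_apply, smul_eq_mul] at h1
    simp only [Pi.mul_apply, ρ, α, Finset.sum_apply, mul_comm (b.repr v a)]
    exact h1.symm
  have h1 := congrArg (fun f ↦ dirDeriv Z f p) key
  beta_reduce at h1
  rw [dirDeriv_mul_fun mdifferentiableAt_const
    (g.eventually_smooth_coordGram p).self_of_nhds.diff, dirDeriv_const,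
    dirDeriv_sum_fun fun j _ ↦ ((hρ j).mul (hα j)).diff, Finset.sum_eq_zero] at h1
  · rw [zero_mul, zero_add] at h1
    refine hz ?_
    have := (mul_eq_zero.1 h1).resolve_left ha
    have hZ : Z p = z := FiberBundle.extend_apply_self ..
    rw [dirDeriv, hZ] at this
    exact this
  · intro j _
    rw [dirDeriv_mul_fun (hρ j).diff (hα j).diff, hρ0, hα0, mul_zero, zero_mul, add_zero]

end SymTensor

/-! ### The main pair and its orthogonal correction -/

namespace SymTensor

variable {g : SymTensor m M} {p : M} {N R A B : VField m M} {U W : Set M} {f : M → ℝ}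

/-- Orthogonal fields `N`, `R` over the open set `W` which restrict over `Σ ∩ W` to the main normal
and to the main radical field, such that `⟨R, R⟩` is a defining function of `Σ ∩ W`. -/
structure IsNormalPair (g : SymTensor m M) (N R : VField m M) (W : Set M) : Prop where
  isOpen : IsOpen W
  smooth_N : ∀ q ∈ W, SmoothAt N q
  smooth_R : ∀ q ∈ W, SmoothAt R q
  perp : ∀ q ∈ W, g.pair R N q = 0
  norm_ne : ∀ q ∈ W, g.pair N N q ≠ 0
  sing_iff : ∀ q ∈ W, q ∈ g.sing ↔ g.pair R R q = 0
  unit : ∀ q ∈ W, q ∈ g.sing → g.pair N N q = 1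
  radical : ∀ q ∈ W, q ∈ g.sing → R q ∈ g.rad q
  deriv_norm : ∀ q ∈ W, q ∈ g.sing → ∀ v : TangentSpace (𝓡 m) q,
    mfderiv (𝓡 m) 𝓘(ℝ, ℝ) (g.pair R R) q v = (2 * g.form q v (N q) : ℝ)
  bracket_eq : ∀ q ∈ W, q ∈ g.sing → bracket N R q = 0
  isotropic : ∀ q ∈ W, q ∈ g.sing → g.dual N N R q = 0

theorem dirDeriv_eq_zero_of_mem_tangentSing (hA : A p ∈ g.tangentSing p)
    (hf : FunSmoothAt (m := m) f p) {c : ℝ} (hc : ∀ᶠ q in 𝓝 p, q ∈ g.sing → f q = c) :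
    dirDeriv A f p = 0 := by
  have h1 := hA (f - fun _ ↦ c) (hf.sub (.const c)) (by
    rw [eventually_nhdsWithin_iff]
    filter_upwards [hc] with q hq hqs
    simp [hq hqs])
  have h2 : dirDeriv A (f - fun _ ↦ c) p = 0 := h1
  rwa [dirDeriv_sub_fun hf.diff mdifferentiableAt_const, dirDeriv_const, sub_zero] at h2

namespace IsMainPair

variable (hNR : g.IsMainPair U N R) (hg : g.IsTransverseRiemannLorentz) (hU : IsOpen U)
  (hp : p ∈ g.sing ∩ U)

include hNR hg hU hp

theorem dirDeriv_R_eq_zero (hf : FunSmoothAt (m := m) f p) {c : ℝ}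
    (hc : ∀ q ∈ U, q ∈ g.sing → f q = c) : dirDeriv R f p = 0 :=
  dirDeriv_eq_zero_of_mem_tangentSing (hg.tangent_radical p hp.1 (hNR.radical p hp)) hf
    (by filter_upwards [hU.mem_nhds hp.2] with q hq using hc q hq)

/-- Differentiating ⟨R, N⟩ = 0 along Σ in the direction R gives □_R N (R) = -H(R, R) = 1. The
torsion term is killed by the radical vector R, so this equals □_N R (R), half of the derivative. -/
theorem dirDeriv_norm_R : dirDeriv N (g.pair R R) p = 2 := by
  have h1 := g.dual_metric R R N p
  have h2 := g.dual_torsion R N R p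
  have h3 := g.dual_self N R p
  have h4 : dirDeriv R (g.pair R N) p = 0 :=
    hNR.dirDeriv_R_eq_zero hg hU hp (g.smooth_pair (hNR.smooth_R.at hU hp.2)
      (hNR.smooth_N.at hU hp.2)) (c := 0) fun q hq hqs ↦ hNR.radical q ⟨hqs, hq⟩ _
  have h5 : g.pair (bracket R N) R p = 0 := by
    rw [pair_comm]; exact hNR.radical p hp _
  have h6 : g.dual R R N p = -1 := hNR.H_unitary p hp
  linarith

/-- N⟨R, N⟩ splits into □_N R (N) and □_N N (R). The first is □_R N (N) because the bracket
vanishes, that is half of R⟨N, N⟩, and ⟨N, N⟩ is constant along Σ; the second is II(N, N) = 0. -/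
theorem dirDeriv_pair_R_N (hR : bracket N R p = 0) : dirDeriv N (g.pair R N) p = 0 := by
  have hN' := hNR.smooth_N.at hU hp.2
  have h1 := g.dual_metric N R N p
  have h2 := g.dual_torsion N R N p
  have h3 := g.dual_self R N p
  have h4 : dirDeriv R (g.pair N N) p = 0 :=
    hNR.dirDeriv_R_eq_zero hg hU hp (g.smooth_pair hN' hN') (c := 1)
      fun q hq hqs ↦ hNR.unit q ⟨hqs, hq⟩
  have h5 : g.pair (bracket N R) N p = 0 := by
    rw [pair, hR]; simp
  have h6 : g.dual N N R p = 0 := hNR.isotropic p hp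
  linarith

omit hNR hU in
-- Otherwise N would be tangent to Σ, hence orthogonal to itself.
theorem dirDeriv_coordGram_ne_zero (hn : g.pair N N p = 1)
    (hT : ∀ w ∈ g.tangentSing p, g.form p (N p) w = 0) :
    dirDeriv N (g.coordGram p) p ≠ 0 := by
  intro h0
  obtain ⟨w, hw⟩ := mfderiv_coordGram_ne_zero hg hp.1
  have hs := g.eventually_smooth_coordGram p
  have h1 : N p ∈ g.tangentSing p := by
    intro f hf hf0
    refine mfderiv_eq_zero_of_tangent hs.self_of_nhds hf
      ((coordGram_eq_zero_iff (mem_chart_source _ p)).2 hp.1) hw ?_ h0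
    rw [eventually_nhdsWithin_iff] at hf0
    filter_upwards [hf0, (chartAt (EuclideanSpace ℝ (Fin m)) p).open_source.mem_nhds
      (mem_chart_source _ p)] with q h1 h2 h3
    exact h1 ((coordGram_eq_zero_iff h2).1 h3)
  have h2 := hT _ h1
  rw [pair] at hn
  linarith

omit hU in
-- By Hadamard's lemma `t` is the Gram determinant times some `h`, and the nonzero derivative of `t`
-- along `N` forces `h p ≠ 0`.
theorem eventually_sing_iff {t : M → ℝ} (ht : ∀ᶠ q in 𝓝 p, FunSmoothAt (m := m) t q)
    (h0 : ∀ᶠ q in 𝓝 p, q ∈ g.sing → t q = 0) (hNt : dirDeriv N t p ≠ 0) :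
    ∀ᶠ q in 𝓝 p, (q ∈ g.sing ↔ t q = 0) := by
  have hs := g.eventually_smooth_coordGram p
  have hsrc := (chartAt (EuclideanSpace ℝ (Fin m)) p).open_source.mem_nhds (mem_chart_source _ p)
  have hN0 := dirDeriv_coordGram_ne_zero hg hp (hNR.unit p hp) (hNR.normal p hp)
  obtain ⟨h, hh, hth⟩ := exists_eventually_eq_mul_manifold hs ht hN0 (by
    filter_upwards [h0, hsrc] with q h1 h2 h3
    exact h1 ((coordGram_eq_zero_iff h2).1 h3))
  have h1 : dirDeriv N t p = dirDeriv N (g.coordGram p) p * h p := by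
    rw [dirDeriv_congr_fun (h := g.coordGram p * h) hth,
      dirDeriv_mul_fun hs.self_of_nhds.diff hh.diff,
      (coordGram_eq_zero_iff (mem_chart_source _ p)).2 hp.1, zero_mul, add_zero]
  have h2 : h p ≠ 0 := by
    intro h2; rw [h1, h2, mul_zero] at hNt; exact hNt rfl
  filter_upwards [hth, hsrc, hh.continuousAt.eventually_ne h2] with q h3 h4 h5
  rw [h3, ← coordGram_eq_zero_iff h4]
  simp [h5]

theorem exists_isNormalPair (hR : ∀ q ∈ U, bracket N R q = 0) :
    ∃ (W : Set M) (c : M → ℝ), p ∈ W ∧ W ⊆ U ∧ g.IsNormalPair N (R + c • N) W ∧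
      (∀ q ∈ W, FunSmoothAt (m := m) c q) ∧
      ∀ q ∈ W, q ∈ g.sing → c q = 0 := by
  set n := g.pair N N
  set a := g.pair R N
  -- The Gram–Schmidt coefficient making `R + c • N` orthogonal to `N`.
  let c : M → ℝ := (fun _ ↦ -1) * (a * n⁻¹)
  have hNs : ∀ q ∈ U, SmoothAt N q := fun q hq ↦ hNR.smooth_N.at hU hq
  have hRs : ∀ q ∈ U, SmoothAt R q := fun q hq ↦ hNR.smooth_R.at hU hq
  have hn : ∀ q ∈ U, FunSmoothAt (m := m) n q := fun q hq ↦ g.smooth_pair (hNs q hq) (hNs q hq)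
  have ha : ∀ q ∈ U, FunSmoothAt (m := m) a q := fun q hq ↦ g.smooth_pair (hRs q hq) (hNs q hq)
  have hnp : n p ≠ 0 := by rw [show n p = 1 from hNR.unit p hp]; exact one_ne_zero
  obtain ⟨W₁, hW₁, hW₁o, hpW₁⟩ := mem_nhds_iff.1 (Filter.inter_mem (hU.mem_nhds hp.2)
    ((hn p hp.2).continuousAt.eventually_ne hnp))
  have hW₁U : W₁ ⊆ U := fun q hq ↦ (hW₁ hq).1
  have hn0 : ∀ q ∈ W₁, n q ≠ 0 := fun q hq ↦ (hW₁ hq).2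
  have hc : ∀ q ∈ W₁, FunSmoothAt (m := m) c q := fun q hq ↦
    .mul (.const _) (.mul (ha q (hW₁U hq)) (.inv (hn q (hW₁U hq)) (hn0 q hq)))
  have ha0 : ∀ q ∈ W₁, q ∈ g.sing → a q = 0 := fun q hq hqs ↦
    hNR.radical q ⟨hqs, hW₁U hq⟩ _
  have hc0 : ∀ q ∈ W₁, q ∈ g.sing → c q = 0 := fun q hq hqs ↦ by simp [c, ha0 q hq hqs]
  -- That `c` vanishes to second order along Σ preserves both `[N, R] = 0` on Σ and the normal
  -- derivative 2 of the norm.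
  have hNc : ∀ q ∈ W₁, q ∈ g.sing → dirDeriv N c q = 0 := by
    intro q hq hqs
    have h1 := hNR.dirDeriv_pair_R_N hg hU ⟨hqs, hW₁U hq⟩ (hR q (hW₁U hq))
    have h2 : FunSmoothAt (m := m) n⁻¹ q := .inv (hn q (hW₁U hq)) (hn0 q hq)
    rw [dirDeriv_mul_fun mdifferentiableAt_const ((ha q (hW₁U hq)).mul h2).diff, dirDeriv_const,
      dirDeriv_mul_fun (ha q (hW₁U hq)).diff h2.diff, h1, ha0 q hq hqs]
    ring
  have hR₀ : ∀ q ∈ W₁, SmoothAt (R + c • N) q := fun q hq ↦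
    (hRs q (hW₁U hq)).add (.smul (hc q hq) (hNs q (hW₁U hq)))
  have hR₀R : ∀ q ∈ W₁, q ∈ g.sing → (R + c • N) q = R q := fun q hq hqs ↦ by
    simp [hc0 q hq hqs]
  set t := g.pair (R + c • N) (R + c • N)
  have ht : ∀ q ∈ W₁, FunSmoothAt (m := m) t q := fun q hq ↦ g.smooth_pair (hR₀ q hq) (hR₀ q hq)
  have ht0 : ∀ q ∈ W₁, q ∈ g.sing → t q = 0 := fun q hq hqs ↦ by
    simp only [t, pair, hR₀R q hq hqs]
    exact hNR.radical q ⟨hqs, hW₁U hq⟩ _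
  have hNt : ∀ q ∈ W₁, q ∈ g.sing → dirDeriv N t q = 2 := by
    intro q hq hqs
    have h1 : t = g.pair R R + c * (a + a + c * n) := by
      simp only [t, pair_add_left, pair_add_right, pair_smul_left, pair_smul_right, a, n,
        g.pair_comm N R]
      ring
    have hq' := hW₁U hq
    have h2 := ((ha q hq').add (ha q hq')).add ((hc q hq).mul (hn q hq'))
    rw [h1, dirDeriv_add_fun (g.smooth_pair (hRs q hq') (hRs q hq')).diff ((hc q hq).mul h2).diff,
      dirDeriv_mul_fun (hc q hq).diff h2.diff, hNc q hq hqs, hc0 q hq hqs,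
      hNR.dirDeriv_norm_R hg hU ⟨hqs, hq'⟩]
    ring
  have hev : ∀ᶠ q in 𝓝 p, (q ∈ g.sing ↔ t q = 0) :=
    hNR.eventually_sing_iff hg hp
      (by filter_upwards [hW₁o.mem_nhds hpW₁] with q hq using ht q hq)
      (by filter_upwards [hW₁o.mem_nhds hpW₁] with q hq using ht0 q hq)
      (by rw [hNt p hpW₁ hp.1]; norm_num)
  obtain ⟨W, hW, hWo, hpW⟩ := mem_nhds_iff.1 (Filter.inter_mem (hW₁o.mem_nhds hpW₁) hev)
  have hWW₁ : W ⊆ W₁ := fun q hq ↦ (hW hq).1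
  have hiff : ∀ q ∈ W, q ∈ g.sing ↔ t q = 0 := fun q hq ↦ (hW hq).2
  refine ⟨W, c, hpW, hWW₁.trans hW₁U, ⟨hWo, fun q hq ↦ hNs q (hW₁U (hWW₁ hq)),
    fun q hq ↦ hR₀ q (hWW₁ hq), fun q hq ↦ ?_, fun q hq ↦ hn0 q (hWW₁ hq), hiff,
    fun q hq hqs ↦ hNR.unit q ⟨hqs, hW₁U (hWW₁ hq)⟩, fun q hq hqs ↦ ?_, fun q hq hqs v ↦ ?_,
    fun q hq hqs ↦ ?_, fun q hq hqs ↦ ?_⟩, fun q hq ↦ hc q (hWW₁ hq),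
    fun q hq hqs ↦ hc0 q (hWW₁ hq) hqs⟩
  · rw [pair_add_left, pair_smul_left]
    have := hn0 q (hWW₁ hq)
    simp only [Pi.add_apply, Pi.mul_apply, c, Pi.inv_apply]
    change a q + -1 * (a q * (n q)⁻¹) * n q = 0
    field_simp
    ring
  · rw [hR₀R q (hWW₁ hq) hqs]
    exact hNR.radical q ⟨hqs, hW₁U (hWW₁ hq)⟩
  · have hq' := hWW₁ hq
    have hN2 := hNt q hq' hqs
    -- Subtracting from `v` the multiple of `N` with the same derivative of `t` leaves a vector
    -- tangent to Σ, hence orthogonal to `N`; this computes the derivative of `t` along `v`.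
    set k : ℝ := mfderiv (𝓡 m) 𝓘(ℝ, ℝ) t q v
    have h1 : mfderiv (𝓡 m) 𝓘(ℝ, ℝ) t q (v - (k / 2) • N q) = (0 : ℝ) := by
      rw [map_sub, map_smul]
      change k - (k / 2) * dirDeriv N t q = 0
      rw [hN2]; ring
    have h2 : v - (k / 2) • N q ∈ g.tangentSing q := by
      intro f hf hf0
      refine mfderiv_eq_zero_of_tangent (u := t) (w := N q) (ht q hq') hf (ht0 q hq' hqs) ?_ ?_ h1
      · change dirDeriv N t q ≠ 0
        rw [hN2]; norm_num
      · rw [eventually_nhdsWithin_iff] at hf0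
        filter_upwards [hf0, hWo.mem_nhds hq] with r h3 h4 h5
        exact h3 ((hiff r h4).2 h5)
    have h3 := hNR.normal q ⟨hqs, hW₁U hq'⟩ _ h2
    have h4 := hNR.unit q ⟨hqs, hW₁U hq'⟩
    rw [pair] at h4
    rw [map_sub, map_smul, h4, g.symm] at h3
    simp only [smul_eq_mul] at h3
    change k = _
    linarith
  · have hq' := hW₁U (hWW₁ hq)
    rw [bracket_add_right (hRs q hq').diff (DiffAt.smul (hc q (hWW₁ hq)).diff (hNs q hq').diff),
      bracket_smul_right (hc q (hWW₁ hq)).diff (hNs q hq').diff, hR q hq',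
      hc0 q (hWW₁ hq) hqs, hNc q (hWW₁ hq) hqs]
    simp
  · have hq' := hW₁U (hWW₁ hq)
    rw [g.dual_congr_right (hNs q hq').diff (hNs q hq').diff (hR₀ q (hWW₁ hq)).diff
      (hRs q hq').diff (hR₀R q (hWW₁ hq) hqs)]
    exact hNR.isotropic q ⟨hqs, hq'⟩

end IsMainPair

end SymTensor

/-! ### Division by ⟨R, R⟩ and identities for □ along Σ -/

namespace SymTensor

open Classical in
/-- The quotient of the function `f`, vanishing on `Σ`, by the function `⟨R, R⟩` with `N`-derivative
`2` along `Σ`. -/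
def quot (g : SymTensor m M) (N R : VField m M) (f : M → ℝ) (q : M) : ℝ :=
  if q ∈ g.sing then dirDeriv N f q / 2 else f q / g.pair R R q

namespace IsNormalPair

variable {g : SymTensor m M} {p q : M} {N R A B X Y : VField m M} {U W : Set M} {f h : M → ℝ}

variable (hP : g.IsNormalPair N R W) (hq : q ∈ W) (hqs : q ∈ g.sing)

include hP

theorem smooth_t (hq : q ∈ W) : FunSmoothAt (m := m) (g.pair R R) q :=
  g.smooth_pair (hP.smooth_R q hq) (hP.smooth_R q hq)

include hq

theorem eventually_mem : ∀ᶠ r in 𝓝 q, r ∈ W := hP.isOpen.mem_nhds hq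

theorem eventually_eq_zero {f : M → ℝ} (h : ∀ r ∈ W, f r = 0) : f =ᶠ[𝓝 q] fun _ ↦ 0 := by
  filter_upwards [hP.eventually_mem hq] with r hr using h r hr

include hqs

theorem t_eq_zero : g.pair R R q = 0 := (hP.sing_iff q hq).1 hqs

theorem dirDeriv_t : dirDeriv A (g.pair R R) q = 2 * g.pair A N q := hP.deriv_norm q hq hqs _

theorem dirDeriv_N_t : dirDeriv N (g.pair R R) q = 2 := by
  rw [hP.dirDeriv_t hq hqs, hP.unit q hq hqs, mul_one]

theorem mem_tangentSing (hA : g.pair A N q = 0) : A q ∈ g.tangentSing q := by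
  intro f hf hf0
  refine mfderiv_eq_zero_of_tangent (w := N q) (hP.smooth_t hq) hf
    (hP.t_eq_zero hq hqs) ?_ ?_ ?_
  · change dirDeriv N (g.pair R R) q ≠ 0
    rw [hP.dirDeriv_N_t hq hqs]; norm_num
  · rw [eventually_nhdsWithin_iff] at hf0
    filter_upwards [hf0, hP.eventually_mem hq] with r h3 h4 h5
    exact h3 ((hP.sing_iff r h4).2 h5)
  · have := hP.dirDeriv_t hq hqs (A := A)
    rw [hA, mul_zero] at this
    exact this

theorem dirDeriv_eq_zero (hA : g.pair A N q = 0) (hf : FunSmoothAt (m := m) f q) (c : ℝ)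
    (hc : ∀ r ∈ W, r ∈ g.sing → f r = c) : dirDeriv A f q = 0 :=
  dirDeriv_eq_zero_of_mem_tangentSing (hP.mem_tangentSing hq hqs hA) hf
    (by filter_upwards [hP.eventually_mem hq] with r hr using hc r hr)

omit hq hqs in
-- Hadamard's lemma gives f = t h near Σ, and there N(f) = 2h on Σ since t = 0 and N(t) = 2; so both
-- branches of `quot` are values of the one smooth function h.
theorem exists_quot (hf : ∀ q ∈ W, FunSmoothAt (m := m) f q)
    (h0 : ∀ q ∈ W, q ∈ g.sing → f q = 0) (hq : q ∈ W) :
    ∃ h, FunSmoothAt (m := m) h q ∧ g.quot N R f =ᶠ[𝓝 q] h ∧ f =ᶠ[𝓝 q] g.pair R R * h := by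
  by_cases hqs : q ∈ g.sing
  · obtain ⟨h, hh, hfh⟩ := exists_eventually_eq_mul_manifold (u := g.pair R R) (f := f) (p := q)
      (v := N q) (by filter_upwards [hP.eventually_mem hq] with r hr using hP.smooth_t hr)
      (by filter_upwards [hP.eventually_mem hq] with r hr using hf r hr)
      (by change dirDeriv N (g.pair R R) q ≠ 0
          rw [hP.dirDeriv_N_t hq hqs]; norm_num)
      (by filter_upwards [hP.eventually_mem hq] with r hr hrt
          exact h0 r hr ((hP.sing_iff r hr).2 hrt))
    refine ⟨h, hh, ?_, hfh⟩
    filter_upwards [hP.eventually_mem hq, hfh.eventually_nhds, hh.eventually_diff] with r h1 h2 h3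
    by_cases hr : r ∈ g.sing
    · rw [quot, if_pos hr, dirDeriv_congr_fun (h := g.pair R R * h) h2,
        dirDeriv_mul_fun (hP.smooth_t h1).diff h3, hP.dirDeriv_N_t h1 hr, hP.t_eq_zero h1 hr]
      ring
    · have ht : g.pair R R r ≠ 0 := fun h ↦ hr ((hP.sing_iff r h1).2 h)
      rw [quot, if_neg hr, h2.self_of_nhds]
      field_simp
  · have ht : ∀ r ∈ W, r ∉ g.sing → g.pair R R r ≠ 0 := fun r hr hrs h ↦
      hrs ((hP.sing_iff r hr).2 h)
    refine ⟨f * (g.pair R R)⁻¹, (hf q hq).mul (.inv (hP.smooth_t hq) (ht q hq hqs)), ?_, ?_⟩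
    · filter_upwards [eventually_notMem_sing hqs] with r hr
      rw [quot, if_neg hr]
      rfl
    · filter_upwards [eventually_notMem_sing hqs, hP.eventually_mem hq] with r hr hr'
      have := ht r hr' hr
      simp only [Pi.mul_apply, Pi.inv_apply]
      field_simp

omit hq hqs in
theorem smooth_quot (hf : ∀ q ∈ W, FunSmoothAt (m := m) f q)
    (h0 : ∀ q ∈ W, q ∈ g.sing → f q = 0) : ∀ q ∈ W, FunSmoothAt (m := m) (g.quot N R f) q := by
  intro q hq
  obtain ⟨h, hh, h1, -⟩ := hP.exists_quot hf h0 hq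
  exact hh.congr h1

omit hq hqs in
theorem t_mul_quot (hf : ∀ q ∈ W, FunSmoothAt (m := m) f q)
    (h0 : ∀ q ∈ W, q ∈ g.sing → f q = 0) :
    ∀ q ∈ W, g.pair R R q * g.quot N R f q = f q := by
  intro q hq
  obtain ⟨h, hh, h1, h2⟩ := hP.exists_quot hf h0 hq
  rw [h1.self_of_nhds, h2.self_of_nhds]
  rfl

omit hP hq in
theorem quot_sing : g.quot N R f q = dirDeriv N f q / 2 := if_pos hqs

theorem pair_R_right : g.pair A R q = 0 := by
  rw [pair_comm]; exact hP.radical q hq hqs _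

/-! ### The forms `II` and `H` along the singular set -/

/-- The torsion term pairs a bracket with the radical vector R. -/
theorem dual_R_comm : g.dual A B R q = g.dual B A R q := by
  have h1 := g.dual_torsion A B R q
  rw [hP.pair_R_right hq hqs] at h1
  linarith

theorem dual_R_R : g.dual A R R q = g.pair A N q := by
  rw [dual_self, hP.dirDeriv_t hq hqs]; ring

theorem dual_R_left_R : g.dual R A R q = g.pair A N q := by
  rw [hP.dual_R_comm hq hqs, hP.dual_R_R hq hqs]

omit hqs in
theorem dirDeriv_pair_N_R : dirDeriv A (g.pair N R) q = 0 := by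
  rw [dirDeriv_congr_fun (h := fun _ ↦ (0 : ℝ)), dirDeriv_const]
  exact hP.eventually_eq_zero hq fun r hr ↦ by rw [pair_comm, hP.perp r hr]

omit hqs in
theorem dual_N_R : g.dual A N R q = - g.dual A R N q := by
  have := g.dual_metric A N R q
  rw [hP.dirDeriv_pair_N_R hq] at this
  linarith

/-- Apply the bracket to t: the functions A(t) and B(t) vanish on Σ, so their derivatives along the
tangent fields B and A vanish too, while [A, B](t) = 2⟨[A, B], N⟩. -/
theorem pair_bracket_N (hA : SmoothAt A q) (hB : SmoothAt B q)
    (hAN : ∀ r ∈ W, r ∈ g.sing → g.pair A N r = 0) (hBN : ∀ r ∈ W, r ∈ g.sing → g.pair B N r = 0) :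
    g.pair (bracket A B) N q = 0 := by
  have h1 := dirDeriv_bracket hA hB (hP.smooth_t hq)
  rw [hP.dirDeriv_t hq hqs,
    hP.dirDeriv_eq_zero hq hqs (hAN q hq hqs) (.dirDeriv hB (hP.smooth_t hq)) 0 fun r hr hrs ↦ by
      rw [hP.dirDeriv_t hr hrs, hBN r hr hrs, mul_zero],
    hP.dirDeriv_eq_zero hq hqs (hBN q hq hqs) (.dirDeriv hA (hP.smooth_t hq)) 0 fun r hr hrs ↦ by
      rw [hP.dirDeriv_t hr hrs, hAN r hr hrs, mul_zero]] at h1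
  linarith

theorem H_comm (hA : SmoothAt A q) (hB : SmoothAt B q)
    (hAN : ∀ r ∈ W, r ∈ g.sing → g.pair A N r = 0) (hBN : ∀ r ∈ W, r ∈ g.sing → g.pair B N r = 0) :
    g.dual A B N q = g.dual B A N q := by
  have h1 := g.dual_torsion A B N q
  rw [hP.pair_bracket_N hq hqs hA hB hAN hBN] at h1
  linarith

theorem dual_A_N_tangent (hX : SmoothAt X q) (hA : g.pair A N q = 0)
    (hXN : ∀ r ∈ W, r ∈ g.sing → g.pair X N r = 0) : g.dual A N X q = - g.dual A X N q := by
  have h1 := g.dual_metric A N X q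
  have h2 : dirDeriv A (g.pair N X) q = 0 := by
    rw [pair_comm]
    exact hP.dirDeriv_eq_zero hq hqs hA (g.smooth_pair hX (hP.smooth_N q hq)) 0 hXN
  linarith

theorem dual_N_R_tangent (hX : SmoothAt X q) (hXN : ∀ r ∈ W, r ∈ g.sing → g.pair X N r = 0) :
    g.dual N R X q = - g.dual X R N q := by
  have h1 := g.dual_torsion N R X q
  have h2 : g.pair (bracket N R) X q = 0 := by
    rw [pair, hP.bracket_eq q hq hqs]; simp
  have h3 := hP.dual_A_N_tangent hq hqs hX (hP.perp q hq) hXN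
  have h4 := hP.H_comm hq hqs hX (hP.smooth_R q hq) hXN fun r hr _ ↦ hP.perp r hr
  linarith

/-- Both □_N X (R) and □_N R (X) equal -H(X, R). -/
theorem dirDeriv_N_pair_R (hX : SmoothAt X q) (hXN : ∀ r ∈ W, r ∈ g.sing → g.pair X N r = 0) :
    dirDeriv N (g.pair X R) q = -2 * g.dual X R N q := by
  have h1 := g.dual_metric N X R q
  have h2 := hP.dual_R_comm hq hqs (A := N) (B := X)
  have h3 := hP.dual_N_R hq (A := X)
  have h4 := hP.dual_N_R_tangent hq hqs hX hXN
  linarith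

/-- Orthogonality to R is automatic on Σ; it is orthogonality off Σ that makes the N-derivative of
⟨X, R⟩ vanish and puts X in the screen. -/
theorem H_R_eq_zero_of_perp (hX : SmoothAt X q) (hXN : ∀ r ∈ W, r ∈ g.sing → g.pair X N r = 0)
    (hXR : ∀ r ∈ W, g.pair X R r = 0) : g.dual X R N q = 0 := by
  have h1 := hP.dirDeriv_N_pair_R hq hqs hX hXN
  rw [dirDeriv_congr_fun (hP.eventually_eq_zero hq hXR), dirDeriv_const] at h1
  linarith

theorem H_R_R : g.dual R R N q = -1 := by
  have h1 := hP.dual_N_R hq (A := R)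
  have h2 := hP.dual_R_left_R hq hqs (A := N)
  have h3 := hP.unit q hq hqs
  linarith

/-- `II(N, X) = -H(X, R)`. -/
theorem dual_N_tangent_R : g.dual N X R q = - g.dual X R N q := by
  rw [hP.dual_R_comm hq hqs, hP.dual_N_R hq]

end IsNormalPair

end SymTensor

/-! ### Frames adapted to N and R -/

namespace SymTensor

variable {g : SymTensor m M} {p q : M} {N R A B : VField m M} {U W W' : Set M} {f h : M → ℝ}
  {ι : Type*} [Fintype ι]

theorem IsNormalPair.mono (hP : g.IsNormalPair N R W) (hW' : IsOpen W') (h : W' ⊆ W) :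
    g.IsNormalPair N R W' where
  isOpen := hW'
  smooth_N q hq := hP.smooth_N q (h hq)
  smooth_R q hq := hP.smooth_R q (h hq)
  perp q hq := hP.perp q (h hq)
  norm_ne q hq := hP.norm_ne q (h hq)
  sing_iff q hq := hP.sing_iff q (h hq)
  unit q hq := hP.unit q (h hq)
  radical q hq := hP.radical q (h hq)
  deriv_norm q hq := hP.deriv_norm q (h hq)
  bracket_eq q hq := hP.bracket_eq q (h hq)
  isotropic q hq := hP.isotropic q (h hq)

/-- H is tensorial in its first slot and H(R, R) = -1. -/
theorem IsNormalPair.R_ne_zero (hP : g.IsNormalPair N R W) (hq : q ∈ W) (hqs : q ∈ g.sing) :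
    R q ≠ 0 := by
  intro h0
  have hR := (hP.smooth_R q hq).diff
  have hN := (hP.smooth_N q hq).diff
  have h1 := g.dual_smul_left (f := fun _ : M ↦ (0 : ℝ)) mdifferentiableAt_const hR hR hN
  rw [g.dual_congr_left (DiffAt.smul mdifferentiableAt_const hR) hR hR hN (by simp [h0]),
    hP.H_R_R hq hqs] at h1
  simp at h1

/-- `E` and `F` are mutually dual smooth frames of the orthogonal complement of `N` and `R`. -/
structure IsAdaptedFrame (g : SymTensor m M) (N R : VField m M) (E F : ι → VField m M)
    (W : Set M) : Prop where
  smooth_left : ∀ i, ∀ q ∈ W, SmoothAt (E i) q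
  smooth_right : ∀ i, ∀ q ∈ W, SmoothAt (F i) q
  left_N : ∀ i, ∀ q ∈ W, g.pair (E i) N q = 0
  left_R : ∀ i, ∀ q ∈ W, g.pair (E i) R q = 0
  right_N : ∀ i, ∀ q ∈ W, g.pair (F i) N q = 0
  right_R : ∀ i, ∀ q ∈ W, g.pair (F i) R q = 0
  complete : ∀ q ∈ W, q ∉ g.sing → ∀ v : TangentSpace (𝓡 m) q,
    (g.form q v (R q) / g.pair R R q) • R q + (g.form q v (N q) / g.pair N N q) • N q
      + ∑ i, g.form q v (E i q) • F i q = v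

theorem IsNormalPair.exists_basis (hP : g.IsNormalPair N R W) (hp : p ∈ W) (hps : p ∈ g.sing) :
    ∃ (ι : Type) (_ : Fintype ι) (b : Module.Basis (Fin 2 ⊕ ι) ℝ (TangentSpace (𝓡 m) p)),
      b (.inl 0) = R p ∧ b (.inl 1) = N p := by
  have hli : LinearIndependent ℝ ![R p, N p] := by
    refine LinearIndependent.pair_iff.2 fun s t hst ↦ ?_
    have h1 := congrArg (fun v ↦ g.form p v (N p)) hst
    have h2 := hP.perp p hp
    have h3 := hP.unit p hp hps
    simp only [pair] at h2 h3
    simp only [map_add, map_smul, add_apply, smul_apply, h2, h3, smul_eq_mul, mul_zero, mul_one,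
      zero_add, map_zero, zero_apply] at h1
    subst h1
    simp only [zero_smul, add_zero, smul_eq_zero] at hst
    exact ⟨hst.resolve_right (hP.R_ne_zero hp hps), rfl⟩
  let b := Module.Basis.sumExtend hli
  have := FiniteDimensional.fintypeBasisIndex b
  exact ⟨_, Fintype.ofInjective (Sum.inr : _ → Fin 2 ⊕ Module.Basis.sumExtendIndex hli)
    Sum.inr_injective, b, by simp [b, Module.Basis.sumExtend]; rfl,
    by simp [b, Module.Basis.sumExtend]; rfl⟩

/-- A combination of the `e i` orthogonal to all of them is also orthogonal to N and R, hence
radical, hence a multiple of R; its coordinates along the `b (.inr j)` are then zero. -/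
theorem IsNormalPair.gram_ne_zero [DecidableEq ι] (hg : g.IsTransverseRiemannLorentz)
    (hP : g.IsNormalPair N R W) (hp : p ∈ W) (hps : p ∈ g.sing)
    (b : Module.Basis (Fin 2 ⊕ ι) ℝ (TangentSpace (𝓡 m) p)) (hb0 : b (.inl 0) = R p)
    (hb1 : b (.inl 1) = N p) (α β : ι → ℝ) (e : ι → TangentSpace (𝓡 m) p)
    (he : ∀ i, e i = b (.inr i) - α i • N p - β i • R p) (heN : ∀ i, g.form p (e i) (N p) = 0) :
    Matrix.det (Matrix.of fun i j ↦ g.form p (e i) (e j)) ≠ 0 := by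
  intro h0
  obtain ⟨c, hc, hc0⟩ := Matrix.exists_vecMul_eq_zero_iff.2 h0
  set v := ∑ i, c i • e i
  have hve : ∀ j, g.form p v (e j) = 0 := by
    intro j
    have := congrFun hc0 j
    simpa [Matrix.vecMul, dotProduct, v] using this
  have hvN : g.form p v (N p) = 0 := by simp [v, heN]
  have hR := hP.radical p hp hps
  have hvR : g.form p v (R p) = 0 := by rw [g.symm]; exact hR v
  have hv : v ∈ g.rad p := by
    intro w
    rw [← b.sum_repr w, map_sum]
    refine Finset.sum_eq_zero fun k _ ↦ ?_
    rw [map_smul]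
    rcases k with k | k
    · fin_cases k
      · simp only [Fin.zero_eta, hb0, hvR, smul_zero]
      · simp only [Fin.mk_one, hb1, hvN, smul_zero]
    · have h1 : b (.inr k) = e k + α k • N p + β k • R p := by rw [he]; abel
      rw [h1]
      simp [hve, hvN, hvR]
  obtain ⟨a, ha⟩ := exists_eq_smul_of_mem_rad hg hps hR hv (hP.R_ne_zero hp hps)
  refine hc (funext fun j ↦ ?_)
  have h2 := congrArg (fun w ↦ b.repr w (.inr j)) ha
  have h3 : b.repr (R p) (.inr j) = 0 := by rw [← hb0]; simp
  have h4 : b.repr (N p) (.inr j) = 0 := by rw [← hb1]; simp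
  have h5 : ∀ i, b.repr (e i) (.inr j) = if i = j then 1 else 0 := by
    intro i
    rw [he]
    simp [h3, h4, Finsupp.single_apply]
  simpa [v, h3, h5] using h2

theorem complete_of_gram [DecidableEq ι] {r n : TangentSpace (𝓡 m) q}
    {e f : ι → TangentSpace (𝓡 m) q} (hm : Fintype.card (Fin 2 ⊕ ι) = m)
    (hr : g.form q r r ≠ 0) (hn : g.form q n n ≠ 0) (hrn : g.form q r n = 0)
    (her : ∀ i, g.form q (e i) r = 0) (hen : ∀ i, g.form q (e i) n = 0)
    (hdet : Matrix.det (Matrix.of fun i j ↦ g.form q (e i) (e j)) ≠ 0)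
    (hf : ∀ i, f i = ∑ j, (Matrix.of fun i j ↦ g.form q (e i) (e j))⁻¹ i j • e j)
    (v : TangentSpace (𝓡 m) q) :
    (g.form q v r / g.form q r r) • r + (g.form q v n / g.form q n n) • n
      + ∑ i, g.form q v (e i) • f i = v := by
  set G : Matrix ι ι ℝ := Matrix.of fun i j ↦ g.form q (e i) (e j)
  let Z : Fin 2 ⊕ ι → TangentSpace (𝓡 m) q := Sum.elim ![r, n] e
  have hnr : g.form q n r = 0 := by rw [g.symm, hrn]
  have hre : ∀ i, g.form q r (e i) = 0 := fun i ↦ by rw [g.symm, her]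
  have hne : ∀ i, g.form q n (e i) = 0 := fun i ↦ by rw [g.symm, hen]
  have hli : LinearIndependent ℝ Z := by
    rw [Fintype.linearIndependent_iff]
    intro c hc
    simp only [Fintype.sum_sum_type, Fin.sum_univ_two, Z, Sum.elim_inl, Sum.elim_inr,
      Matrix.cons_val_zero, Matrix.cons_val_one] at hc
    have h1 := congrArg (fun w ↦ g.form q w r) hc
    have h2 := congrArg (fun w ↦ g.form q w n) hc
    have h3 : Matrix.vecMul (fun i ↦ c (.inr i)) G = 0 := by
      ext j
      have := congrArg (fun w ↦ g.form q w (e j)) hc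
      simpa [hre, hne, G, Matrix.vecMul, dotProduct] using this
    have h4 : (fun i ↦ c (.inr i)) = 0 := by
      by_contra h
      exact hdet (Matrix.exists_vecMul_eq_zero_iff.1 ⟨_, h, h3⟩)
    simp [her, hnr, hr] at h1
    simp [hen, hrn, hn] at h2
    rintro (k | k)
    · fin_cases k
      · exact h1
      · exact h2
    · exact congrFun h4 k
  have hspan := hli.span_eq_top_of_card_eq_finrank' (hm.trans (finrank_tangentSpace q).symm)
  let L : TangentSpace (𝓡 m) q →ₗ[ℝ] TangentSpace (𝓡 m) q :=
    (g.form q r).toLinearMap.smulRight ((g.form q r r)⁻¹ • r)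
      + (g.form q n).toLinearMap.smulRight ((g.form q n n)⁻¹ • n)
      + ∑ i, (g.form q (e i)).toLinearMap.smulRight (f i)
  have hLv : ∀ w, L w = (g.form q w r / g.form q r r) • r + (g.form q w n / g.form q n n) • n
      + ∑ i, g.form q w (e i) • f i := by
    intro w
    simp only [L, LinearMap.add_apply, LinearMap.coe_sum, Finset.sum_apply,
      LinearMap.smulRight_apply, ContinuousLinearMap.coe_coe, smul_smul, g.symm q w, div_eq_mul_inv]
  have hL : L = LinearMap.id := by
    refine LinearMap.ext_on_range hspan fun k ↦ ?_
    rw [hLv, LinearMap.id_apply]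
    rcases k with k | k
    · fin_cases k
      · simp [Z, hr, hrn, hre]
      · simp [Z, hn, hnr, hne]
    · have h1 : G * G⁻¹ = 1 := Matrix.mul_nonsing_inv _ hdet.isUnit
      have h2 : ∀ j, ∑ i, g.form q (e k) (e i) * G⁻¹ i j = if k = j then 1 else 0 := fun j ↦ by
        rw [← Matrix.one_apply, ← h1, Matrix.mul_apply]
        rfl
      simp only [Z, Sum.elim_inr, her, hen, zero_div, zero_smul, zero_add, hf, Finset.smul_sum,
        smul_smul]
      rw [Finset.sum_comm]
      simp only [← Finset.sum_smul, h2]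
      simp
  rw [← hLv, hL, LinearMap.id_apply]

/-- Gram–Schmidt against N and R, followed by multiplication with the inverse Gram matrix of the
remaining fields, which is regular at `p` because the radical is only the line of R. -/
theorem IsNormalPair.exists_isAdaptedFrame (hg : g.IsTransverseRiemannLorentz)
    (hP : g.IsNormalPair N R W) (hp : p ∈ W) (hps : p ∈ g.sing) :
    ∃ (ι : Type) (_ : Fintype ι) (E F : ι → VField m M) (W' : Set M), p ∈ W' ∧ W' ⊆ W ∧
      g.IsNormalPair N R W' ∧ g.IsAdaptedFrame N R E F W' := by
  classical
  obtain ⟨ι, _, b, hb0, hb1⟩ := hP.exists_basis hp hps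
  have hm : Fintype.card (Fin 2 ⊕ ι) = m := by
    rw [← Module.finrank_eq_card_basis b, finrank_tangentSpace]
  let X : ι → VField m M := fun i ↦ FiberBundle.extend (EuclideanSpace ℝ (Fin m)) (b (.inr i))
  obtain ⟨W₁, hW₁, hW₁o, hpW₁⟩ := mem_nhds_iff.1 (Filter.inter_mem (hP.isOpen.mem_nhds hp)
    (Filter.eventually_all.2 fun i : ι ↦ eventually_smoothAt_extend (b (.inr i))))
  have hX : ∀ i, ∀ q ∈ W₁, SmoothAt (X i) q := fun i q hq ↦ (hW₁ hq).2 i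
  have hP₁ : g.IsNormalPair N R W₁ := hP.mono hW₁o fun q hq ↦ (hW₁ hq).1
  let α : ι → M → ℝ := fun i ↦ g.pair (X i) N * (g.pair N N)⁻¹
  have hα : ∀ i, ∀ q ∈ W₁, FunSmoothAt (m := m) (α i) q := fun i q hq ↦
    .mul (g.smooth_pair (hX i q hq) (hP₁.smooth_N q hq))
      (.inv (g.smooth_pair (hP₁.smooth_N q hq) (hP₁.smooth_N q hq)) (hP₁.norm_ne q hq))
  let Y : ι → VField m M := fun i ↦ X i - α i • N
  have hY : ∀ i, ∀ q ∈ W₁, SmoothAt (Y i) q := fun i q hq ↦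
    (hX i q hq).sub (.smul (hα i q hq) (hP₁.smooth_N q hq))
  -- Orthogonalising against R divides by t, which is harmless because ⟨Y, R⟩ vanishes on Σ.
  let β : ι → M → ℝ := fun i ↦ g.quot N R (g.pair (Y i) R)
  have hYR : ∀ i, ∀ q ∈ W₁, FunSmoothAt (m := m) (g.pair (Y i) R) q := fun i q hq ↦
    g.smooth_pair (hY i q hq) (hP₁.smooth_R q hq)
  have hYR0 : ∀ i, ∀ q ∈ W₁, q ∈ g.sing → g.pair (Y i) R q = 0 := fun i q hq hqs ↦
    hP₁.pair_R_right hq hqs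
  have hβ : ∀ i, ∀ q ∈ W₁, FunSmoothAt (m := m) (β i) q := fun i ↦
    hP₁.smooth_quot (hYR i) (hYR0 i)
  let E : ι → VField m M := fun i ↦ Y i - β i • R
  have hE : ∀ i, ∀ q ∈ W₁, SmoothAt (E i) q := fun i q hq ↦
    (hY i q hq).sub (.smul (hβ i q hq) (hP₁.smooth_R q hq))
  have hYN : ∀ i, ∀ q ∈ W₁, g.pair (Y i) N q = 0 := by
    intro i q hq
    have := hP₁.norm_ne q hq
    rw [pair_sub_left, pair_smul_left]
    simp only [Pi.sub_apply, Pi.mul_apply, α, Pi.inv_apply]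
    field_simp
    ring
  have hEN : ∀ i, ∀ q ∈ W₁, g.pair (E i) N q = 0 := by
    intro i q hq
    rw [pair_sub_left, pair_smul_left]
    simp [hYN i q hq, hP₁.perp q hq]
  have hER : ∀ i, ∀ q ∈ W₁, g.pair (E i) R q = 0 := by
    intro i q hq
    have := hP₁.t_mul_quot (hYR i) (hYR0 i) q hq
    rw [pair_sub_left, pair_smul_left, Pi.sub_apply, Pi.mul_apply, ← this]
    ring
  let G : M → Matrix ι ι ℝ := fun q ↦ Matrix.of fun i j ↦ g.pair (E i) (E j) q
  have hG : ∀ q ∈ W₁, ∀ i j, FunSmoothAt (m := m) (g.pair (E i) (E j)) q := fun q hq i j ↦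
    g.smooth_pair (hE i q hq) (hE j q hq)
  have hdet : (G p).det ≠ 0 := by
    refine hP₁.gram_ne_zero hg hpW₁ hps b hb0 hb1 (fun i ↦ α i p) (fun i ↦ β i p)
      (fun i ↦ E i p) (fun i ↦ ?_) fun i ↦ hEN i p hpW₁
    have : X i p = b (.inr i) := FiberBundle.extend_apply_self ..
    rw [← this]
    rfl
  have hdc : ContinuousAt (fun q ↦ (G q).det) p :=
    (FunSmoothAt.det (G := fun i j ↦ g.pair (E i) (E j)) (hG p hpW₁)).continuousAt
  obtain ⟨W₂, hW₂, hW₂o, hpW₂⟩ := mem_nhds_iff.1 (Filter.inter_mem (hW₁o.mem_nhds hpW₁)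
    (hdc.eventually_ne hdet))
  have h21 : ∀ q ∈ W₂, q ∈ W₁ := fun q hq ↦ (hW₂ hq).1
  have hdet₂ : ∀ q ∈ W₂, (G q).det ≠ 0 := fun q hq ↦ (hW₂ hq).2
  let F : ι → VField m M := fun i ↦ ∑ j, (fun q ↦ (G q)⁻¹ i j) • E j
  have hF : ∀ i q, F i q = ∑ j, (G q)⁻¹ i j • E j q := fun i q ↦
    Finset.sum_apply q _ (fun j ↦ (fun q ↦ (G q)⁻¹ i j) • E j)
  have hFpair : ∀ i q (B : VField m M), (∀ j, g.pair (E j) B q = 0) → g.pair (F i) B q = 0 := by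
    intro i q B hB
    simp only [pair] at hB
    rw [pair, hF]
    simp [hB]
  refine ⟨ι, inferInstance, E, F, W₂, hpW₂, fun q hq ↦ (hW₁ (h21 q hq)).1, hP₁.mono hW₂o h21,
    fun i q hq ↦ hE i q (h21 q hq), fun i q hq ↦ ?_, fun i q hq ↦ hEN i q (h21 q hq),
    fun i q hq ↦ hER i q (h21 q hq), fun i q hq ↦ hFpair i q N fun j ↦ hEN j q (h21 q hq),
    fun i q hq ↦ hFpair i q R fun j ↦ hER j q (h21 q hq), fun q hq hqs v ↦ ?_⟩
  · exact .sum fun j _ ↦ .smul (FunSmoothAt.matrix_inv (G := fun i j ↦ g.pair (E i) (E j))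
      (hG q (h21 q hq)) (hdet₂ q hq) i j) (hE j q (h21 q hq))
  · exact g.complete_of_gram hm (fun h ↦ hqs ((hP₁.sing_iff q (h21 q hq)).2 h))
      (hP₁.norm_ne q (h21 q hq)) (hP₁.perp q (h21 q hq)) (fun i ↦ hER i q (h21 q hq))
      (fun i ↦ hEN i q (h21 q hq)) (hdet₂ q hq) (fun i ↦ hF i q) v

end SymTensor

/-! ### Expansion of the Ricci curvature in powers of 1/⟨R, R⟩ -/

namespace SymTensor

variable {g : SymTensor m M} {p q : M} {N R A B V X Y Z D : VField m M} {U W : Set M}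
  {f h : M → ℝ} {ι : Type*} [Fintype ι] {E F : ι → VField m M}

/-- `□_A B (X) □_Z D (Y) - □_Z B (X) □_A D (Y)`. -/
def wedge (g : SymTensor m M) (A Z B D X Y : VField m M) : M → ℝ :=
  g.dual A B X * g.dual Z D Y - g.dual Z B X * g.dual A D Y

/-- The part of the Riemann tensor without pole along `Σ`. -/
def riemFin (g : SymTensor m M) (N : VField m M) (E F : ι → VField m M) (A Z B D : VField m M) :
    M → ℝ :=
  g.riemReg A Z B D + (g.pair N N)⁻¹ * g.wedge A Z B D N N + ∑ i, g.wedge A Z B D (E i) (F i)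

/-- The trace over the orthogonal complement of `R` of a bilinear expression. -/
def trPerp (g : SymTensor m M) (N : VField m M) (E F : ι → VField m M)
    (T : VField m M → VField m M → M → ℝ) : M → ℝ :=
  (g.pair N N)⁻¹ * T N N + ∑ i, T (F i) (E i)

/-- The coefficient of `⟨R, R⟩⁻¹` in the Ricci curvature. -/
def ricPole (g : SymTensor m M) (N R : VField m M) (E F : ι → VField m M) (A B : VField m M) :
    M → ℝ :=
  g.riemFin N E F A R B R + g.trPerp N E F fun Z D ↦ g.wedge A Z B D R R

/-- The part of the Ricci curvature without pole along `Σ`. -/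
def ricFin (g : SymTensor m M) (N : VField m M) (E F : ι → VField m M) (A B : VField m M) :
    M → ℝ :=
  g.trPerp N E F fun Z D ↦ g.riemFin N E F A Z B D

theorem smooth_wedge (hA : SmoothAt A p) (hZ : SmoothAt Z p) (hB : SmoothAt B p)
    (hD : SmoothAt D p) (hX : SmoothAt X p) (hY : SmoothAt Y p) :
    FunSmoothAt (m := m) (g.wedge A Z B D X Y) p :=
  .sub (.mul (g.smooth_dual hA hB hX) (g.smooth_dual hZ hD hY))
    (.mul (g.smooth_dual hZ hB hX) (g.smooth_dual hA hD hY))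

theorem wedge_self (A B D X Y : VField m M) : g.wedge A A B D X Y = 0 := sub_self _

theorem riemReg_self (hA : SmoothAt A p) (hB : SmoothAt B p) (hD : SmoothAt D p) :
    g.riemReg A A B D p = 0 := by
  have h1 : bracket A A = 0 := VectorField.mlieBracket_self
  have h2 := g.dual_smul_left (f := fun _ : M ↦ (0 : ℝ)) mdifferentiableAt_const hA.diff hB.diff
    hD.diff
  have h3 : (fun _ : M ↦ (0 : ℝ)) • A = bracket A A := by
    rw [h1]; funext q; simp
  rw [h3, zero_mul] at h2
  rw [riemReg, h2]
  ring

theorem riem_smul_mid (hp : p ∉ g.sing) (hf : FunSmoothAt (m := m) f p) (hA : SmoothAt A p)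
    (hZ : SmoothAt Z p) (hB : SmoothAt B p) : g.riem A (f • Z) B D p = f p * g.riem A Z B D p := by
  rw [riem, curv_smul_mid hp hf hA hZ hB, map_smul]
  rfl

namespace IsAdaptedFrame

variable (hP : g.IsNormalPair N R W) (hE : g.IsAdaptedFrame N R E F W)

include hP hE

theorem isDualFrame : g.IsDualFrame
    (fun k : Option (Option ι) ↦ k.elim R fun j ↦ j.elim N E)
    (fun k ↦ k.elim ((g.pair R R)⁻¹ • R) fun j ↦ j.elim ((g.pair N N)⁻¹ • N) F) (W \ g.sing) where
  isOpen := hP.isOpen.sdiff isClosed_sing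
  smooth_left k q hq := by
    rcases k with _ | _ | k
    · exact hP.smooth_R q hq.1
    · exact hP.smooth_N q hq.1
    · exact hE.smooth_left k q hq.1
  smooth_right k q hq := by
    rcases k with _ | _ | k
    · exact .smul (.inv (hP.smooth_t hq.1) fun h ↦ hq.2 ((hP.sing_iff q hq.1).2 h))
        (hP.smooth_R q hq.1)
    · exact .smul (.inv (g.smooth_pair (hP.smooth_N q hq.1) (hP.smooth_N q hq.1))
        (hP.norm_ne q hq.1)) (hP.smooth_N q hq.1)
    · exact hE.smooth_right k q hq.1
  complete q hq v := by
    have := hE.complete q hq.1 hq.2 v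
    simp only [Fintype.sum_option, Option.elim_none, Option.elim_some, Pi.smul_apply',
      Pi.inv_apply, smul_smul, ← div_eq_mul_inv]
    rwa [← add_assoc]

theorem riem_eq (hq : q ∈ W) (hqs : q ∉ g.sing) (hA : SmoothAt A q) (hZ : SmoothAt Z q)
    (hB : SmoothAt B q) (hD : SmoothAt D q) :
    g.riem A Z B D q = g.riemFin N E F A Z B D q
      + (g.pair R R q)⁻¹ * g.wedge A Z B D R R q := by
  have ht : FunDiffAt (m := m) (g.pair R R)⁻¹ q :=
    (FunSmoothAt.inv (hP.smooth_t hq) fun h ↦ hqs ((hP.sing_iff q hq).2 h)).diff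
  have hR := (hP.smooth_R q hq).diff
  have hN := (hP.smooth_N q hq).diff
  have hn : FunDiffAt (m := m) (g.pair N N)⁻¹ q :=
    (FunSmoothAt.inv (g.smooth_pair (hP.smooth_N q hq) (hP.smooth_N q hq)) (hP.norm_ne q hq)).diff
  rw [(hE.isDualFrame hP).riem_eq ⟨hq, hqs⟩ hA hZ hB hD]
  simp only [Fintype.sum_option, Option.elim_none, Option.elim_some,
    g.dual_smul_right ht hZ.diff hD.diff hR, g.dual_smul_right ht hA.diff hD.diff hR,
    g.dual_smul_right hn hZ.diff hD.diff hN, g.dual_smul_right hn hA.diff hD.diff hN,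
    riemFin, wedge, Pi.add_apply, Pi.mul_apply, Pi.sub_apply, Finset.sum_apply, Pi.inv_apply]
  ring

/-- Each use of the dual vector R/t costs one factor 1/t. It occurs once in the trace and once
inside the Riemann tensor, so only the R-term of the trace can have a double pole. -/
theorem t_sq_ric (hq : q ∈ W) (hqs : q ∉ g.sing) (hA : SmoothAt A q) (hB : SmoothAt B q) :
    g.pair R R q ^ 2 * g.ric A B q = g.wedge A R B R R R q
      + g.pair R R q * g.ricPole N R E F A B q + g.pair R R q ^ 2 * g.ricFin N E F A B q := by
  have ht0 : g.pair R R q ≠ 0 := fun h ↦ hqs ((hP.sing_iff q hq).2 h)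
  have ht : FunSmoothAt (m := m) (g.pair R R)⁻¹ q := .inv (hP.smooth_t hq) ht0
  have hR := hP.smooth_R q hq
  have hN := hP.smooth_N q hq
  have hn : FunSmoothAt (m := m) (g.pair N N)⁻¹ q := .inv (g.smooth_pair hN hN) (hP.norm_ne q hq)
  rw [(hE.isDualFrame hP).ric_eq ⟨hq, hqs⟩ hA hB]
  simp only [Fintype.sum_option, Option.elim_none, Option.elim_some,
    riem_smul_mid hqs ht hA hR hB, riem_smul_mid hqs hn hA hN hB, hE.riem_eq hP hq hqs hA hR hB hR,
    hE.riem_eq hP hq hqs hA hN hB hN]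
  have h1 : ∀ i, g.riem A (F i) B (E i) q = g.riemFin N E F A (F i) B (E i) q
      + (g.pair R R q)⁻¹ * g.wedge A (F i) B (E i) R R q := fun i ↦
    hE.riem_eq hP hq hqs hA (hE.smooth_right i q hq) hB (hE.smooth_left i q hq)
  simp only [h1, Finset.sum_add_distrib, ← Finset.mul_sum, ricPole, ricFin, trPerp, Pi.add_apply,
    Pi.mul_apply, Finset.sum_apply, Pi.inv_apply]
  field_simp
  ring

theorem smooth_riemFin (hq : q ∈ W) (hA : SmoothAt A q) (hZ : SmoothAt Z q)
    (hB : SmoothAt B q) (hD : SmoothAt D q) :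
    FunSmoothAt (m := m) (g.riemFin N E F A Z B D) q := by
  have hN := hP.smooth_N q hq
  exact .add (.add (g.smooth_riemReg hA hZ hB hD)
    (.mul (.inv (g.smooth_pair hN hN) (hP.norm_ne q hq)) (smooth_wedge hA hZ hB hD hN hN)))
    (.sum fun i _ ↦ smooth_wedge hA hZ hB hD (hE.smooth_left i q hq) (hE.smooth_right i q hq))

omit hE in
theorem smooth_trPerp (hq : q ∈ W) {T : VField m M → VField m M → M → ℝ}
    (hN : FunSmoothAt (m := m) (T N N) q) (hT : ∀ i, FunSmoothAt (m := m) (T (F i) (E i)) q) :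
    FunSmoothAt (m := m) (g.trPerp N E F T) q :=
  .add (.mul (.inv (g.smooth_pair (hP.smooth_N q hq) (hP.smooth_N q hq)) (hP.norm_ne q hq)) hN)
    (.sum fun i _ ↦ hT i)

theorem smooth_ricPole (hq : q ∈ W) (hA : SmoothAt A q) (hB : SmoothAt B q) :
    FunSmoothAt (m := m) (g.ricPole N R E F A B) q := by
  have hN := hP.smooth_N q hq
  have hR := hP.smooth_R q hq
  exact .add (hE.smooth_riemFin hP hq hA hR hB hR) (smooth_trPerp hP hq
    (smooth_wedge hA hN hB hN hR hR) fun i ↦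
      smooth_wedge hA (hE.smooth_right i q hq) hB (hE.smooth_left i q hq) hR hR)

theorem smooth_ricFin (hq : q ∈ W) (hA : SmoothAt A q) (hB : SmoothAt B q) :
    FunSmoothAt (m := m) (g.ricFin N E F A B) q := by
  have hN := hP.smooth_N q hq
  exact smooth_trPerp hP hq (hE.smooth_riemFin hP hq hA hN hB hN) fun i ↦
    hE.smooth_riemFin hP hq hA (hE.smooth_right i q hq) hB (hE.smooth_left i q hq)

end IsAdaptedFrame

namespace IsNormalPair

variable (hP : g.IsNormalPair N R W) (hq : q ∈ W) (hqs : q ∈ g.sing)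

include hP hq hqs

theorem dual_R_R_R : g.dual R R R q = 0 := by
  rw [hP.dual_R_R hq hqs, hP.perp q hq]

theorem wedge_R_sing : g.wedge A R B R R R q = -(g.pair A N q * g.pair B N q) := by
  simp only [wedge, Pi.sub_apply, Pi.mul_apply, hP.dual_R_R hq hqs, hP.dual_R_left_R hq hqs,
    hP.perp q hq]
  ring

/-- □_R R (R) is half of R(t). On Σ the derivatives N and R commute on t, and N(t) = 2 is constant
along Σ. -/
theorem dirDeriv_N_dual_R_R_R : dirDeriv N (g.dual R R R) q = 0 := by
  have hN := hP.smooth_N q hq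
  have hR := hP.smooth_R q hq
  have ht := hP.smooth_t hq
  have h1 : g.dual R R R = (fun _ ↦ 1 / 2) * dirDeriv R (g.pair R R) :=
    funext fun r ↦ g.dual_self R R r
  have h2 := dirDeriv_bracket hN hR ht
  have h3 : dirDeriv (bracket N R) (g.pair R R) q = 0 := by
    rw [hP.dirDeriv_t hq hqs, pair, hP.bracket_eq q hq hqs]; simp
  have h4 : dirDeriv R (dirDeriv N (g.pair R R)) q = 0 :=
    hP.dirDeriv_eq_zero hq hqs (hP.perp q hq) (.dirDeriv hN ht) 2
      fun r hr hrs ↦ hP.dirDeriv_N_t hr hrs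
  rw [h1, dirDeriv_mul_fun mdifferentiableAt_const (FunSmoothAt.dirDeriv hR ht).diff,
    dirDeriv_const]
  rw [h3, h4] at h2
  have h5 : dirDeriv N (dirDeriv R (g.pair R R)) q = 0 := by linarith
  rw [h5]
  ring

theorem dirDeriv_N_wedge_R (hA : SmoothAt A q) (hB : SmoothAt B q) :
    dirDeriv N (g.wedge A R B R R R) q = - (dirDeriv N (g.dual R B R) q * g.pair A N q)
      - g.pair B N q * dirDeriv N (g.dual A R R) q := by
  have hR := hP.smooth_R q hq
  have h1 := (g.smooth_dual hA hB hR).diff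
  have h2 := (g.smooth_dual hR hR hR).diff
  have h3 := (g.smooth_dual hR hB hR).diff
  have h4 := (g.smooth_dual hA hR hR).diff
  rw [wedge, dirDeriv_sub_fun (((g.smooth_dual hA hB hR).mul (g.smooth_dual hR hR hR)).diff)
    (((g.smooth_dual hR hB hR).mul (g.smooth_dual hA hR hR)).diff), dirDeriv_mul_fun h1 h2,
    dirDeriv_mul_fun h3 h4, hP.dual_R_R_R hq hqs, hP.dirDeriv_N_dual_R_R_R hq hqs,
    hP.dual_R_left_R hq hqs, hP.dual_R_R hq hqs]
  ring

end IsNormalPair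

end SymTensor

/-! ### Residues of the Ricci curvature along Σ -/

namespace SymTensor

variable {g : SymTensor m M} {p q : M} {N R A B V X Y Z D : VField m M} {U W : Set M}
  {f h r : M → ℝ} {ι : Type*} [Fintype ι] {E F : ι → VField m M}

/-- `⟨R, R⟩ Ric(A, B)` extends smoothly to `W`, with boundary values `r` on `Σ ∩ W`. -/
def HasRicPole (g : SymTensor m M) (R : VField m M) (W : Set M) (A B : VField m M)
    (r : M → ℝ) : Prop :=
  ∃ S : M → ℝ, (∀ q ∈ W, FunSmoothAt (m := m) S q) ∧
    (∀ q ∈ W, q ∉ g.sing → g.pair R R q * g.ric A B q = S q) ∧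
    ∀ q ∈ W, q ∈ g.sing → S q = r q

/-- Over `Σ ∩ W`, the field `X` is a section of the screen distribution. -/
structure IsLocalScreen (g : SymTensor m M) (N R : VField m M) (W : Set M) (X : VField m M) :
    Prop where
  smooth : ∀ q ∈ W, SmoothAt X q
  normal : ∀ q ∈ W, q ∈ g.sing → g.pair X N q = 0
  H_eq_zero : ∀ q ∈ W, q ∈ g.sing → g.dual X R N q = 0

/-- `Σ ∩ W` is `II`-flat. -/
def IsLocalFlat (g : SymTensor m M) (N R : VField m M) (W : Set M) : Prop :=
  ∀ X Y : VField m M, g.IsLocalScreen N R W X → g.IsLocalScreen N R W Y →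
    ∀ q ∈ W, q ∈ g.sing → g.dual X Y R q = 0

theorem HasRicPole.congr {r' : M → ℝ} (h : g.HasRicPole R W A B r)
    (hr : ∀ q ∈ W, q ∈ g.sing → r q = r' q) : g.HasRicPole R W A B r' := by
  obtain ⟨S, h1, h2, h3⟩ := h
  exact ⟨S, h1, h2, fun q hq hqs ↦ (h3 q hq hqs).trans (hr q hq hqs)⟩

theorem dual_left_eq_zero (hA : DiffAt A p) (hB : DiffAt B p) (hD : DiffAt D p) (h0 : A p = 0) :
    g.dual A B D p = 0 := by
  have h1 := g.dual_smul_left (f := fun _ : M ↦ (0 : ℝ)) mdifferentiableAt_const hA hB hD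
  rwa [g.dual_congr_left (DiffAt.smul mdifferentiableAt_const hA) hA hB hD (by simp [h0]),
    zero_mul] at h1

namespace IsNormalPair

variable (hP : g.IsNormalPair N R W)

include hP

theorem t_ne_zero (hq : q ∈ W) (hqs : q ∉ g.sing) : g.pair R R q ≠ 0 :=
  fun h ↦ hqs ((hP.sing_iff q hq).2 h)

theorem dual_N_screen (hX : g.IsLocalScreen N R W X) (hq : q ∈ W) (hqs : q ∈ g.sing) :
    g.dual N X R q = 0 := by
  rw [hP.dual_N_tangent_R hq hqs, hX.H_eq_zero q hq hqs, neg_zero]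

/-- Since H(R, R) = -1, the field X + H(X, R) R is a screen section, and the added term contributes
II(R, Y) = ν(Y) = 0. -/
theorem dual_tangent_of_flat (hflat : g.IsLocalFlat N R W) (hX : ∀ q ∈ W, SmoothAt X q)
    (hXN : ∀ q ∈ W, q ∈ g.sing → g.pair X N q = 0) (hY : g.IsLocalScreen N R W Y)
    (hq : q ∈ W) (hqs : q ∈ g.sing) : g.dual X Y R q = 0 := by
  have hc : ∀ r ∈ W, FunSmoothAt (m := m) (g.dual X R N) r := fun r hr ↦
    g.smooth_dual (hX r hr) (hP.smooth_R r hr) (hP.smooth_N r hr)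
  have hadd : ∀ (D D' : VField m M) r, r ∈ W → SmoothAt D r → SmoothAt D' r →
      g.dual (X + g.dual X R N • R) D D' r = g.dual X D D' r + g.dual X R N r * g.dual R D D' r := by
    intro D D' r hr hD hD'
    have hR := (hP.smooth_R r hr).diff
    rw [g.dual_add_left (hX r hr).diff (hR.smul (hc r hr).diff) hD.diff hD'.diff,
      g.dual_smul_left (hc r hr).diff hR hD.diff hD'.diff]
  have hX' : g.IsLocalScreen N R W (X + g.dual X R N • R) := by
    refine ⟨fun r hr ↦ (hX r hr).add (.smul (hc r hr) (hP.smooth_R r hr)), fun r hr hrs ↦ ?_,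
      fun r hr hrs ↦ ?_⟩
    · rw [pair_add_left, pair_smul_left, Pi.add_apply, Pi.mul_apply, hXN r hr hrs, hP.perp r hr]
      ring
    · rw [hadd R N r hr (hP.smooth_R r hr) (hP.smooth_N r hr), hP.H_R_R hr hrs]
      ring
  have h1 := hflat _ _ hX' hY q hq hqs
  rw [hadd Y R q hq (hY.smooth q hq) (hP.smooth_R q hq), hP.dual_R_left_R hq hqs,
    hY.normal q hq hqs] at h1
  linarith

omit hP in
theorem dual_R_perp (hP : g.IsNormalPair N R W) (hX : ∀ r ∈ W, g.pair X R r = 0) (hq : q ∈ W) :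
    g.dual A R X q = - g.dual A X R q := by
  have h1 := g.dual_metric A X R q
  rw [dirDeriv_congr_fun (hP.eventually_eq_zero hq hX), dirDeriv_const] at h1
  linarith

end IsNormalPair

namespace IsAdaptedFrame

variable (hP : g.IsNormalPair N R W) (hE : g.IsAdaptedFrame N R E F W)

include hP hE

theorem screen_left (i : ι) : g.IsLocalScreen N R W (E i) :=
  ⟨hE.smooth_left i, fun q hq _ ↦ hE.left_N i q hq, fun q hq hqs ↦
    hP.H_R_eq_zero_of_perp hq hqs (hE.smooth_left i q hq) (fun r hr _ ↦ hE.left_N i r hr)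
      (hE.left_R i)⟩

theorem screen_right (i : ι) : g.IsLocalScreen N R W (F i) :=
  ⟨hE.smooth_right i, fun q hq _ ↦ hE.right_N i q hq, fun q hq hqs ↦
    hP.H_R_eq_zero_of_perp hq hqs (hE.smooth_right i q hq) (fun r hr _ ↦ hE.right_N i r hr)
      (hE.right_R i)⟩

/-- `⟨R, R⟩² Ric(A, B)` extends smoothly across `Σ`, with boundary values `-ν(A) ν(B)`. -/
theorem exists_t_sq_ric (hA : ∀ q ∈ W, SmoothAt A q) (hB : ∀ q ∈ W, SmoothAt B q) :
    ∃ S : M → ℝ, (∀ q ∈ W, FunSmoothAt (m := m) S q) ∧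
      (∀ q ∈ W, q ∉ g.sing → g.pair R R q ^ 2 * g.ric A B q = S q) ∧
      ∀ q ∈ W, q ∈ g.sing → S q = -(g.pair A N q * g.pair B N q) := by
  refine ⟨g.wedge A R B R R R + g.pair R R * g.ricPole N R E F A B
    + g.pair R R * g.pair R R * g.ricFin N E F A B, fun q hq ↦ ?_, fun q hq hqs ↦ ?_,
    fun q hq hqs ↦ ?_⟩
  · have hR := hP.smooth_R q hq
    have ht := hP.smooth_t hq
    exact .add (.add (smooth_wedge (hA q hq) hR (hB q hq) hR hR hR)
      (.mul ht (hE.smooth_ricPole hP hq (hA q hq) (hB q hq))))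
      (.mul (.mul ht ht) (hE.smooth_ricFin hP hq (hA q hq) (hB q hq)))
  · rw [hE.t_sq_ric hP hq hqs (hA q hq) (hB q hq)]
    simp only [Pi.add_apply, Pi.mul_apply]
    ring
  · simp only [Pi.add_apply, Pi.mul_apply, hP.wedge_R_sing hq hqs, hP.t_eq_zero hq hqs]
    ring

/-- The double-pole coefficient now vanishes on Σ, so its quotient by t joins the simple pole; the
boundary value of that quotient is half the N-derivative, computed by `dirDeriv_N_wedge_R`. -/
theorem hasRicPole (hA : ∀ q ∈ W, SmoothAt A q) (hB : ∀ q ∈ W, SmoothAt B q)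
    (h0 : ∀ q ∈ W, q ∈ g.sing → g.pair A N q * g.pair B N q = 0) :
    g.HasRicPole R W A B fun q ↦ (- (dirDeriv N (g.dual R B R) q * g.pair A N q)
      - g.pair B N q * dirDeriv N (g.dual A R R) q) / 2 + g.ricPole N R E F A B q := by
  have hw : ∀ q ∈ W, FunSmoothAt (m := m) (g.wedge A R B R R R) q := fun q hq ↦
    have hR := hP.smooth_R q hq
    smooth_wedge (hA q hq) hR (hB q hq) hR hR hR
  have hw0 : ∀ q ∈ W, q ∈ g.sing → g.wedge A R B R R R q = 0 := fun q hq hqs ↦ by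
    rw [hP.wedge_R_sing hq hqs, h0 q hq hqs, neg_zero]
  refine ⟨g.quot N R (g.wedge A R B R R R) + g.ricPole N R E F A B
    + g.pair R R * g.ricFin N E F A B, fun q hq ↦ ?_, fun q hq hqs ↦ ?_, fun q hq hqs ↦ ?_⟩
  · exact .add (.add (hP.smooth_quot hw hw0 q hq)
      (hE.smooth_ricPole hP hq (hA q hq) (hB q hq)))
      (.mul (hP.smooth_t hq) (hE.smooth_ricFin hP hq (hA q hq) (hB q hq)))
  · have h1 := hE.t_sq_ric hP hq hqs (hA q hq) (hB q hq)
    rw [← hP.t_mul_quot hw hw0 q hq] at h1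
    have ht := hP.t_ne_zero hq hqs
    refine mul_left_cancel₀ ht ?_
    simp only [Pi.add_apply, Pi.mul_apply]
    linear_combination h1
  · simp only [Pi.add_apply, Pi.mul_apply, hP.t_eq_zero hq hqs, IsNormalPair.quot_sing hqs,
      hP.dirDeriv_N_wedge_R hq hqs (hA q hq) (hB q hq)]
    ring

/-- Expand bilinearly: t Ric(tX, B) = t² Ric(X, B) has boundary value -ν(X)ν(B), symmetrically for
Y, and the mixed term retains a factor t. -/
theorem hasRicPole_perturb (hA : ∀ q ∈ W, SmoothAt A q) (hB : ∀ q ∈ W, SmoothAt B q)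
    (hX : ∀ q ∈ W, SmoothAt X q) (hY : ∀ q ∈ W, SmoothAt Y q) (h : g.HasRicPole R W A B r) :
    g.HasRicPole R W (A + g.pair R R • X) (B + g.pair R R • Y) fun q ↦
      r q - g.pair X N q * g.pair B N q - g.pair A N q * g.pair Y N q := by
  obtain ⟨S, h1, h2, h3⟩ := h
  obtain ⟨S₁, h11, h12, h13⟩ := hE.exists_t_sq_ric hP hX hB
  obtain ⟨S₂, h21, h22, h23⟩ := hE.exists_t_sq_ric hP hA hY
  obtain ⟨S₃, h31, h32, h33⟩ := hE.exists_t_sq_ric hP hX hY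
  refine ⟨S + S₁ + S₂ + g.pair R R * S₃, fun q hq ↦ ?_, fun q hq hqs ↦ ?_, fun q hq hqs ↦ ?_⟩
  · exact .add (.add (.add (h1 q hq) (h11 q hq)) (h21 q hq)) (.mul (hP.smooth_t hq) (h31 q hq))
  · have ht := hP.smooth_t hq
    have hA' := hA q hq
    have hB' := hB q hq
    have hX' := hX q hq
    have hY' := hY q hq
    rw [ric_add_left hqs hA' (hX'.smul ht) (hB'.add (hY'.smul ht)),
      ric_smul_left hqs ht hX' (hB'.add (hY'.smul ht)), ric_add_right hqs hA' hB' (hY'.smul ht),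
      ric_add_right hqs hX' hB' (hY'.smul ht), ric_smul_right hqs ht hA' hY',
      ric_smul_right hqs ht hX' hY']
    simp only [Pi.add_apply, Pi.mul_apply, ← h2 q hq hqs, ← h12 q hq hqs, ← h22 q hq hqs,
      ← h32 q hq hqs]
    ring
  · simp only [Pi.add_apply, Pi.mul_apply, h3 q hq hqs, h13 q hq hqs, h23 q hq hqs,
      hP.t_eq_zero hq hqs]
    ring

theorem ricPole_sing (hq : q ∈ W) (hqs : q ∈ g.sing) :
    g.ricPole N R E F A B q = g.riemReg A R B R q + g.wedge A R B R N N q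
      + ∑ i, g.wedge A R B R (E i) (F i) q + g.wedge A N B N R R q
      + ∑ i, g.wedge A (F i) B (E i) R R q := by
  simp only [ricPole, riemFin, trPerp, Pi.add_apply, Pi.mul_apply, Pi.inv_apply, Finset.sum_apply,
    hP.unit q hq hqs]
  ring

theorem dual_R_R_left (hq : q ∈ W) (hqs : q ∈ g.sing) (i : ι) : g.dual R R (E i) q = 0 := by
  rw [hP.dual_R_perp (hE.left_R i) hq, hP.dual_R_left_R hq hqs, hE.left_N i q hq, neg_zero]

theorem dual_R_R_right (hq : q ∈ W) (hqs : q ∈ g.sing) (i : ι) : g.dual R R (F i) q = 0 := by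
  rw [hP.dual_R_perp (hE.right_R i) hq, hP.dual_R_left_R hq hqs, hE.right_N i q hq, neg_zero]

theorem ricPole_R_screen (hV : g.IsLocalScreen N R W V) (hq : q ∈ W) (hqs : q ∈ g.sing) :
    g.ricPole N R E F R V q = 0 := by
  rw [hE.ricPole_sing hP hq hqs, riemReg_self (hP.smooth_R q hq) (hV.smooth q hq)
    (hP.smooth_R q hq)]
  simp only [wedge_self, Pi.zero_apply]
  simp only [wedge, Pi.sub_apply, Pi.mul_apply, hP.dual_R_left_R hq hqs, hV.normal q hq hqs,
    hE.left_N _ q hq, hP.dual_N_screen hV hq hqs]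
  simp

/-- The only surviving term is -□_N R (R) □_R N (R), and both factors are ⟨N, N⟩ = 1. -/
theorem ricPole_R_R (hq : q ∈ W) (hqs : q ∈ g.sing) : g.ricPole N R E F R R q = -1 := by
  rw [hE.ricPole_sing hP hq hqs, riemReg_self (hP.smooth_R q hq) (hP.smooth_R q hq)
    (hP.smooth_R q hq)]
  simp only [wedge_self, Pi.zero_apply]
  simp only [wedge, Pi.sub_apply, Pi.mul_apply, hP.dual_R_left_R hq hqs, hP.dual_R_R hq hqs,
    hP.perp q hq, hE.left_N _ q hq, hE.right_N _ q hq, hP.unit q hq hqs]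
  simp

/-- II-flatness removes every term except □_V B (N) □_R R (N), whose second factor is -1. -/
theorem ricPole_screen_screen (hflat : g.IsLocalFlat N R W) (hV : g.IsLocalScreen N R W V)
    (hB : g.IsLocalScreen N R W B) (hq : q ∈ W) (hqs : q ∈ g.sing) :
    g.ricPole N R E F V B q = - g.dual V B N q := by
  have hR := hP.smooth_R q hq
  have h1 : g.riemReg V R B R q = 0 := by
    have h2 : dirDeriv V (g.dual R B R) q = 0 :=
      hP.dirDeriv_eq_zero hq hqs (hV.normal q hq hqs) (g.smooth_dual hR (hB.smooth q hq) hR) 0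
        fun r hr hrs ↦ by rw [hP.dual_R_left_R hr hrs, hB.normal r hr hrs]
    have h3 : dirDeriv R (g.dual V B R) q = 0 :=
      hP.dirDeriv_eq_zero hq hqs (hP.perp q hq)
        (g.smooth_dual (hV.smooth q hq) (hB.smooth q hq) hR) 0 (hflat _ _ hV hB)
    have h4 : g.dual (bracket V R) B R q = 0 :=
      hP.dual_tangent_of_flat hflat
        (fun r hr ↦ (hV.smooth r hr).bracket (hP.smooth_R r hr))
        (fun r hr hrs ↦ hP.pair_bracket_N hr hrs (hV.smooth r hr) (hP.smooth_R r hr) hV.normal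
          fun s hs _ ↦ hP.perp s hs) hB hq hqs
    rw [riemReg, h2, h3, h4]
    ring
  rw [hE.ricPole_sing hP hq hqs, h1]
  simp only [wedge, Pi.sub_apply, Pi.mul_apply, hP.H_R_R hq hqs, hV.H_eq_zero q hq hqs,
    hE.dual_R_R_right hP hq hqs, hP.dual_R_perp (hE.right_R _) hq,
    hflat _ _ hV (hE.screen_right hP _) q hq hqs, hflat _ _ hV hB q hq hqs,
    hflat _ _ (hE.screen_right hP _) hB q hq hqs, hP.dual_N_screen hB hq hqs]
  simp

/-- II-flatness is needed only for the trace ∑ II(F_i, E_i), which appears with the factor □_N R (R)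
= 1. -/
theorem ricPole_N_R (hflat : g.IsLocalFlat N R W) (hq : q ∈ W) (hqs : q ∈ g.sing) :
    g.ricPole N R E F N R q = 0 := by
  have hR := hP.smooth_R q hq
  have hN := hP.smooth_N q hq
  have h1 : g.riemReg N R R R q = 0 := by
    have h3 : dirDeriv R (g.dual N R R) q = 0 :=
      hP.dirDeriv_eq_zero hq hqs (hP.perp q hq) (g.smooth_dual hN hR hR) 1
        fun r hr hrs ↦ by rw [hP.dual_R_R hr hrs, hP.unit r hr hrs]
    rw [riemReg, hP.dirDeriv_N_dual_R_R_R hq hqs, h3,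
      dual_left_eq_zero (hN.bracket hR).diff hR.diff hR.diff (hP.bracket_eq q hq hqs)]
    ring
  rw [hE.ricPole_sing hP hq hqs, h1]
  simp only [wedge_self, Pi.zero_apply]
  simp only [wedge, Pi.sub_apply, Pi.mul_apply, hE.dual_R_R_right hP hq hqs,
    hE.dual_R_R_left hP hq hqs, hP.dual_R_R hq hqs, hE.right_N _ q hq,
    hflat _ _ (hE.screen_right hP _) (hE.screen_left hP _) q hq hqs]
  simp [mul_comm]

/-- The single quantity N(□_R V (R)) = -2 H([R, V], R) enters with weight -1/2 through the
double-pole coefficient and with weight 1 through `riemReg`; all products of □ vanish. -/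
theorem ricPole_N_screen (hV : g.IsLocalScreen N R W V)
    (hNV : ∀ q ∈ W, q ∈ g.sing → bracket N V q = 0) (hq : q ∈ W) (hqs : q ∈ g.sing) :
    - dirDeriv N (g.dual R V R) q / 2 + g.ricPole N R E F N V q
      = - g.dual (bracket R V) R N q := by
  have hR := hP.smooth_R q hq
  have hN := hP.smooth_N q hq
  have hVq := hV.smooth q hq
  have ht := hP.smooth_t hq
  have h1 : g.riemReg N R V R q = dirDeriv N (g.dual R V R) q := by
    have h3 : dirDeriv R (g.dual N V R) q = 0 :=
      hP.dirDeriv_eq_zero hq hqs (hP.perp q hq) (g.smooth_dual hN hVq hR) 0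
        fun r hr hrs ↦ hP.dual_N_screen hV hr hrs
    rw [riemReg, h3, dual_left_eq_zero (hN.bracket hR).diff hVq.diff hR.diff
      (hP.bracket_eq q hq hqs)]
    ring
  have h2 : g.dual N V N q = 0 := by
    have h3 := g.dual_torsion N V N q
    have h4 : dirDeriv V (g.pair N N) q = 0 :=
      hP.dirDeriv_eq_zero hq hqs (hV.normal q hq hqs) (g.smooth_pair hN hN) 1 hP.unit
    rw [pair, hNV q hq hqs, map_zero, zero_apply, dual_self, h4] at h3
    linarith
  have h5 : g.dual R V N q = 0 := by
    rw [← hP.H_comm hq hqs hVq hR hV.normal fun r hr _ ↦ hP.perp r hr, hV.H_eq_zero q hq hqs]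
  have h6 : ∀ i, g.dual N R (F i) q = 0 := fun i ↦ by
    rw [hP.dual_N_R_tangent hq hqs (hE.smooth_right i q hq) fun r hr _ ↦ hE.right_N i r hr,
      (hE.screen_right hP i).H_eq_zero q hq hqs, neg_zero]
  have h7 : g.dual R V R = (fun _ ↦ 1 / 2) * dirDeriv V (g.pair R R)
      + g.pair (bracket R V) R := by
    funext r
    have h8 := g.dual_torsion R V R r
    rw [dual_self] at h8
    simp only [Pi.add_apply, Pi.mul_apply]
    linarith
  have h9 : dirDeriv N (dirDeriv V (g.pair R R)) q = 0 := by
    have h10 := dirDeriv_bracket hN hVq ht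
    have h11 : dirDeriv V (dirDeriv N (g.pair R R)) q = 0 :=
      hP.dirDeriv_eq_zero hq hqs (hV.normal q hq hqs) (.dirDeriv hN ht) 2
        fun r hr hrs ↦ hP.dirDeriv_N_t hr hrs
    rw [hP.dirDeriv_t hq hqs, pair, hNV q hq hqs, map_zero, zero_apply, h11] at h10
    linarith
  have h12 : dirDeriv N (g.dual R V R) q = -2 * g.dual (bracket R V) R N q := by
    have hVt : FunSmoothAt (m := m) (dirDeriv V (g.pair R R)) q := .dirDeriv hVq ht
    rw [h7, dirDeriv_add_fun (FunSmoothAt.mul (.const _) hVt).diff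
      (g.smooth_pair (hR.bracket hVq) hR).diff,
      dirDeriv_mul_fun mdifferentiableAt_const hVt.diff, h9, dirDeriv_const,
      hP.dirDeriv_N_pair_R hq hqs (hR.bracket hVq) fun r hr hrs ↦
        hP.pair_bracket_N hr hrs (hP.smooth_R r hr) (hV.smooth r hr)
          (fun s hs _ ↦ hP.perp s hs) hV.normal]
    ring
  rw [hE.ricPole_sing hP hq hqs, h1, h12]
  simp only [wedge_self, Pi.zero_apply]
  simp only [wedge, Pi.sub_apply, Pi.mul_apply, h2, h5, hE.dual_R_R_right hP hq hqs, h6,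
    hP.dual_N_screen hV hq hqs, hP.dual_N_screen (hE.screen_left hP _) hq hqs]
  simp
  ring

/-- A smooth field which vanishes on `Σ` is divisible by `⟨R, R⟩`. -/
theorem exists_eq_smul (hA : ∀ q ∈ W, SmoothAt A q) (h0 : ∀ q ∈ W, q ∈ g.sing → A q = 0) :
    ∃ X : VField m M, (∀ q ∈ W, SmoothAt X q) ∧ ∀ q ∈ W, A q = (g.pair R R • X) q := by
  have hpair : ∀ B : VField m M, (∀ q ∈ W, SmoothAt B q) →
      (∀ q ∈ W, FunSmoothAt (m := m) (g.pair A B) q) ∧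
      ∀ q ∈ W, q ∈ g.sing → g.pair A B q = 0 := fun B hB ↦
    ⟨fun q hq ↦ g.smooth_pair (hA q hq) (hB q hq), fun q hq hqs ↦ by
      rw [pair, h0 q hq hqs]; simp⟩
  obtain ⟨hR, hR0⟩ := hpair R hP.smooth_R
  obtain ⟨hN, hN0⟩ := hpair N hP.smooth_N
  have hEi := fun i ↦ hpair (E i) (hE.smooth_left i)
  have hRq := hP.smooth_quot hR hR0
  -- The R-coefficient of `A` is ⟨A, R⟩/t, and one more factor t has to be extracted from it, so ⟨A,
  -- R⟩ must be divisible by t².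
  have hRq0 : ∀ q ∈ W, q ∈ g.sing → g.quot N R (g.pair A R) q = 0 := by
    intro q hq hqs
    have h1 := g.dual_metric N A R q
    have h2 := hP.dual_R_comm hq hqs (A := N) (B := A)
    rw [dual_left_eq_zero (hA q hq).diff (hP.smooth_N q hq).diff (hP.smooth_R q hq).diff
      (h0 q hq hqs)] at h2
    have h3 : g.dual N R A q = 0 := by
      have h4 := g.dual_congr_right (hP.smooth_N q hq).diff (hP.smooth_R q hq).diff
        (hA q hq).diff (C' := (fun _ ↦ (0 : ℝ)) • A)
        (DiffAt.smul mdifferentiableAt_const (hA q hq).diff) (by simp [h0 q hq hqs])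
      rw [h4, g.dual_smul_right mdifferentiableAt_const (hP.smooth_N q hq).diff
        (hP.smooth_R q hq).diff (hA q hq).diff, zero_mul]
    rw [IsNormalPair.quot_sing hqs, ← h1, h2, h3]
    ring
  refine ⟨g.quot N R (g.quot N R (g.pair A R)) • R
    + (g.quot N R (g.pair A N) * (g.pair N N)⁻¹) • N
    + ∑ i, g.quot N R (g.pair A (E i)) • F i, fun q hq ↦ ?_, fun q hq ↦ ?_⟩
  · have hNs := hP.smooth_N q hq
    exact .add (.add (.smul (hP.smooth_quot hRq hRq0 q hq) (hP.smooth_R q hq))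
      (.smul (.mul (hP.smooth_quot hN hN0 q hq) (.inv (g.smooth_pair hNs hNs) (hP.norm_ne q hq)))
        hNs))
      (.sum fun i _ ↦ .smul (hP.smooth_quot (hEi i).1 (hEi i).2 q hq) (hE.smooth_right i q hq))
  · by_cases hqs : q ∈ g.sing
    · rw [h0 q hq hqs, Pi.smul_apply', hP.t_eq_zero hq hqs, zero_smul]
    · have ht := hP.t_ne_zero hq hqs
      have h1 := hP.t_mul_quot hRq hRq0 q hq
      have h2 := hP.t_mul_quot hR hR0 q hq
      have h3 := hP.t_mul_quot hN hN0 q hq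
      have h4 := fun i ↦ hP.t_mul_quot (hEi i).1 (hEi i).2 q hq
      have hsum : (∑ i, g.quot N R (g.pair A (E i)) • F i : VField m M) q
          = ∑ i, g.quot N R (g.pair A (E i)) q • F i q :=
        Finset.sum_apply q _ (fun i ↦ g.quot N R (g.pair A (E i)) • F i)
      conv_lhs => rw [← hE.complete q hq hqs (A q)]
      rw [Pi.smul_apply', Pi.add_apply, Pi.add_apply, hsum]
      simp only [smul_add, Finset.smul_sum, smul_smul, Pi.smul_apply', Pi.mul_apply, Pi.inv_apply,
        ← mul_assoc, h1, h3, h4]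
      congr 2
      congr 1
      rw [div_eq_iff ht, mul_comm, h2]
      rfl

end IsAdaptedFrame

end SymTensor

namespace SymTensor

variable {g : SymTensor m M} {p q : M} {N R A B A' B' V X Y Z D : VField m M} {U W : Set M}
  {f h r : M → ℝ} {ι : Type*} [Fintype ι] {E F : ι → VField m M}

/-! ### Smooth extension across the singular set -/

theorem RiemannAt.notMem_sing (h : g.RiemannAt p) : p ∉ g.sing := by
  rintro ⟨v, hv, hv0⟩
  exact (h v hv0).ne' (hv v)

/-- Every point of Σ is a limit of Riemannian points. Density of the complement makes continuous
extensions across Σ unique. -/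
theorem IsTransverseRiemannLorentz.frequently_notMem_sing (hg : g.IsTransverseRiemannLorentz)
    (p : M) : ∃ᶠ q in 𝓝 p, q ∉ g.sing := by
  by_cases hp : p ∈ g.sing
  · exact (mem_closure_iff_frequently.1 (hg.riemann_to_lorentz p hp).1).mono
      fun q hq ↦ RiemannAt.notMem_sing hq
  · exact (eventually_notMem_sing hp).frequently

theorem IsTransverseRiemannLorentz.eq_of_eq_off (hg : g.IsTransverseRiemannLorentz)
    {Y : Type*} [TopologicalSpace Y] [T2Space Y] {f h : M → Y} (hf : ContinuousAt f p)
    (hh : ContinuousAt h p) (he : ∀ᶠ q in 𝓝 p, q ∉ g.sing → f q = h q) : f p = h p :=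
  tendsto_nhds_unique_of_frequently_eq hf hh
    (((hg.frequently_notMem_sing p).and_eventually he).mono fun _ hq ↦ hq.2 hq.1)

theorem IsTransverseRiemannLorentz.field_eq_of_eq_off (hg : g.IsTransverseRiemannLorentz)
    (hA : DiffAt A p) (hB : DiffAt B p) (he : ∀ᶠ q in 𝓝 p, q ∉ g.sing → A q = B q) :
    A p = B p := by
  let t := trivializationAt (EuclideanSpace ℝ (Fin m)) (TangentSpace (𝓡 m) : M → Type _) p
  have hp : p ∈ t.baseSet := FiberBundle.mem_baseSet_trivializationAt' p
  have hc : ∀ D : VField m M, DiffAt D p →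
      ContinuousAt (fun q ↦ (t (⟨q, D q⟩ : TangentBundle (𝓡 m) M)).2) p := fun D hD ↦
    ((mdifferentiableAt_section (𝓡 m) D).1 hD).continuousAt
  have h1 := hg.eq_of_eq_off (hc A hA) (hc B hB)
    (he.mono fun q hq hqs ↦ by rw [hq hqs])
  exact (t.continuousLinearEquivAt ℝ p hp).injective h1

/-- Uniqueness makes the local extensions agree near each point, so the diagonal choice `F q q` is
smooth and no partition of unity is needed. -/
theorem GoodLimit.of_local (hg : g.IsTransverseRiemannLorentz) (hU : IsOpen U)
    (h : ∀ p ∈ U, ∃ F : M → ℝ, FunSmoothAt (m := m) F p ∧ ∀ᶠ q in 𝓝 p, q ∉ g.sing → F q = f q) :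
    g.GoodLimit U f := by
  classical
  choose! F hF hFf using h
  refine ⟨fun q ↦ F q q, fun p hp ↦ ?_, fun p hp ↦ (hFf p hp.1).self_of_nhds hp.2⟩
  refine ((hF p hp).congr ?_).contMDiffWithinAt
  filter_upwards [hU.mem_nhds hp, (hF p hp).eventually_diff, (hFf p hp).eventually_nhds]
    with q hq h1 h2
  refine hg.eq_of_eq_off (hF q hq).continuousAt h1.continuousAt ?_
  filter_upwards [hFf q hq, h2] with r h3 h4 h5
  rw [h3 h5, h4 h5]

theorem exists_smooth_extension (hg : g.IsTransverseRiemannLorentz) (hU : IsOpen U)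
    (h : ∀ p ∈ U, ∃ Z : VField m M, SmoothAt Z p ∧ ∀ᶠ q in 𝓝 p, q ∉ g.sing → Z q = A q) :
    ∃ Z : VField m M, SmoothOn Z U ∧ ∀ p ∈ U \ g.sing, Z p = A p := by
  have h' : ∀ p, ∃ Z : VField m M, p ∈ U → SmoothAt Z p ∧
      ∀ᶠ q in 𝓝 p, q ∉ g.sing → Z q = A q := fun p ↦ by
    by_cases hp : p ∈ U
    · obtain ⟨Z, hZ⟩ := h p hp
      exact ⟨Z, fun _ ↦ hZ⟩
    · exact ⟨0, fun h ↦ absurd h hp⟩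
  choose Z hZ using h'
  refine ⟨fun q ↦ Z q q, smoothOn_of_forall fun p hp ↦ ?_,
    fun p hp ↦ (hZ p hp.1).2.self_of_nhds hp.2⟩
  refine (hZ p hp).1.congr ?_
  filter_upwards [hU.mem_nhds hp, (hZ p hp).1.eventually_diff, (hZ p hp).2.eventually_nhds]
    with q hq h1 h2
  refine hg.field_eq_of_eq_off (A := Z q) (B := Z p) (hZ q hq).1.diff h1 ?_
  filter_upwards [(hZ q hq).2, h2] with r h3 h4 h5
  rw [h3 h5, h4 h5]

theorem eventually_smoothAt (hU : IsOpen U) (hA : SmoothOn A U) (hp : p ∈ U) :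
    ∀ᶠ q in 𝓝 p, SmoothAt A q := by
  filter_upwards [hU.mem_nhds hp] with q hq using hA.at hU hq

/-- Locally Ric = S/t with S smooth: if Ric extends, S = t Ric vanishes on Σ by continuity, and
conversely a vanishing S is divisible by t. The pair N, R may vary with the point, but the residue
`r` is the same function throughout. -/
theorem goodLimit_ric_iff (hg : g.IsTransverseRiemannLorentz) (hU : IsOpen U)
    (hA : SmoothOn A U) (hB : SmoothOn B U) (r : M → ℝ)
    (h : ∀ p ∈ g.sing ∩ U, ∃ (W : Set M) (N R : VField m M), p ∈ W ∧ W ⊆ U ∧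
      g.IsNormalPair N R W ∧ g.HasRicPole R W A B r) :
    g.GoodLimit U (g.ric A B) ↔ ∀ p ∈ g.sing ∩ U, r p = 0 := by
  constructor
  · rintro ⟨F, hF, hFr⟩ p hp
    obtain ⟨W, N, R, hpW, hWU, hP, S, hS, hSr, hS0⟩ := h p hp
    rw [← hS0 p hpW hp.1]
    have h1 : FunSmoothAt (m := m) (g.pair R R * F) p :=
      .mul (hP.smooth_t hpW) (hF.contMDiffAt (hU.mem_nhds hp.2))
    have h2 := hg.eq_of_eq_off (hS p hpW).continuousAt h1.continuousAt (by
      filter_upwards [hP.isOpen.mem_nhds hpW] with q hq hqs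
      rw [← hSr q hq hqs, Pi.mul_apply, hFr q ⟨hWU hq, hqs⟩])
    rw [h2, Pi.mul_apply, hP.t_eq_zero hpW hp.1, zero_mul]
  · intro h0
    refine GoodLimit.of_local hg hU fun p hp ↦ ?_
    by_cases hps : p ∈ g.sing
    · obtain ⟨W, N, R, hpW, hWU, hP, S, hS, hSr, hS0⟩ := h p ⟨hps, hp⟩
      have hS0' : ∀ q ∈ W, q ∈ g.sing → S q = 0 := fun q hq hqs ↦
        (hS0 q hq hqs).trans (h0 q ⟨hqs, hWU hq⟩)
      refine ⟨g.quot N R S, hP.smooth_quot hS hS0' p hpW, ?_⟩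
      filter_upwards [hP.isOpen.mem_nhds hpW] with q hq hqs
      refine mul_left_cancel₀ (hP.t_ne_zero hq hqs) ?_
      rw [hP.t_mul_quot hS hS0' q hq, hSr q hq hqs]
    · exact ⟨g.ric A B, smooth_ric hps (hA.at hU hp) (hB.at hU hp)
        (eventually_smoothAt hU hA hp) (eventually_smoothAt hU hB hp), .of_forall fun _ _ ↦ rfl⟩

theorem HasRicPole.congr_fields (h : g.HasRicPole R W A B r) (hW : IsOpen W)
    (hA : ∀ q ∈ W, SmoothAt A q) (hB : ∀ q ∈ W, SmoothAt B q) (hA' : ∀ q ∈ W, A' q = A q)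
    (hB' : ∀ q ∈ W, B' q = B q) : g.HasRicPole R W A' B' r := by
  obtain ⟨S, h1, h2, h3⟩ := h
  refine ⟨S, h1, fun q hq hqs ↦ ?_, h3⟩
  rw [ric_congr hqs (hA q hq) (hB q hq) (by filter_upwards [hW.mem_nhds hq] with s hs using hA' s hs)
    (by filter_upwards [hW.mem_nhds hq] with s hs using hB' s hs), h2 q hq hqs]

/-- The pole of `Ric(A', B')` if `A'`, `B'` agree with `A`, `B` along `Σ`. -/
theorem HasRicPole.of_eq_on_sing (hP : g.IsNormalPair N R W) (hE : g.IsAdaptedFrame N R E F W)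
    (h : g.HasRicPole R W A B r) (hA : ∀ q ∈ W, SmoothAt A q) (hB : ∀ q ∈ W, SmoothAt B q)
    (hA' : ∀ q ∈ W, SmoothAt A' q) (hB' : ∀ q ∈ W, SmoothAt B' q)
    (hAA' : ∀ q ∈ W, q ∈ g.sing → A' q = A q) (hBB' : ∀ q ∈ W, q ∈ g.sing → B' q = B q) :
    g.HasRicPole R W A' B' fun q ↦
      r q - dirDeriv N (g.pair A' N - g.pair A N) q / 2 * g.pair B N q
        - g.pair A N q * (dirDeriv N (g.pair B' N - g.pair B N) q / 2) := by
  -- The difference is divisible by t, say tX, and ν(X) is recovered as half the N-derivative of the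
  -- normal component, so the residue formula does not mention X.
  have key : ∀ D D' : VField m M, (∀ q ∈ W, SmoothAt D q) → (∀ q ∈ W, SmoothAt D' q) →
      (∀ q ∈ W, q ∈ g.sing → D' q = D q) → ∃ X : VField m M, (∀ q ∈ W, SmoothAt X q) ∧
        (∀ q ∈ W, D' q = (D + g.pair R R • X) q) ∧
        ∀ q ∈ W, q ∈ g.sing → dirDeriv N (g.pair D' N - g.pair D N) q / 2 = g.pair X N q := by
    intro D D' hD hD' hDD'
    obtain ⟨X, hX, hX'⟩ := hE.exists_eq_smul hP (A := D' - D)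
      (fun q hq ↦ (hD' q hq).sub (hD q hq)) fun q hq hqs ↦ by
        rw [Pi.sub_apply, hDD' q hq hqs, sub_self]
    refine ⟨X, hX, fun q hq ↦ ?_, fun q hq hqs ↦ ?_⟩
    · rw [Pi.add_apply, ← hX' q hq, Pi.sub_apply, add_sub_cancel]
    · have h1 : g.pair D' N - g.pair D N =ᶠ[𝓝 q] g.pair R R * g.pair X N := by
        filter_upwards [hP.eventually_mem hq] with s hs
        rw [← pair_sub_left, ← pair_smul_left, pair, hX' s hs, pair]
      rw [dirDeriv_congr_fun h1, dirDeriv_mul_fun (hP.smooth_t hq).diff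
        (g.smooth_pair (hX q hq) (hP.smooth_N q hq)).diff, hP.dirDeriv_N_t hq hqs,
        hP.t_eq_zero hq hqs]
      ring
  obtain ⟨X, hX, hX1, hX2⟩ := key A A' hA hA' hAA'
  obtain ⟨Y, hY, hY1, hY2⟩ := key B B' hB hB' hBB'
  refine ((hE.hasRicPole_perturb hP hA hB hX hY h).congr_fields hP.isOpen
    (fun q hq ↦ (hA q hq).add ((hX q hq).smul (hP.smooth_t hq)))
    (fun q hq ↦ (hB q hq).add ((hY q hq).smul (hP.smooth_t hq))) hX1 hY1).congr
    fun q hq hqs ↦ ?_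
  rw [hX2 q hq hqs, hY2 q hq hqs]

/-! ### Screen fields -/

theorem exists_bump [T2Space M] (hW : IsOpen W) (hp : p ∈ W) :
    ∃ ψ : M → ℝ, (∀ q, FunSmoothAt (m := m) ψ q) ∧ ψ =ᶠ[𝓝 p] (fun _ ↦ 1) ∧ tsupport ψ ⊆ W := by
  obtain ⟨ψ, -, hψ⟩ := (SmoothBumpFunction.nhds_basis_tsupport (I := 𝓡 m) p).mem_iff.1
    (hW.mem_nhds hp)
  exact ⟨ψ, fun q ↦ ψ.contMDiffAt, ψ.eventuallyEq_one, hψ⟩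

end SymTensor

/-! ### Comparison of R with its correction R + cN -/

namespace SymTensor

variable {g : SymTensor m M} {p q : M} {N R A B A' B' V X Y Z D : VField m M} {U W : Set M}
  {c f h r : M → ℝ} {ι : Type*} [Fintype ι] {E F : ι → VField m M}

/-- Over `W ⊆ U`, the field `R + c N` is orthogonal to `N`, and agrees with `R` along `Σ`. -/
structure IsCorrection (g : SymTensor m M) (U : Set M) (N R : VField m M) (W : Set M)
    (c : M → ℝ) : Prop where
  subset : W ⊆ U
  normalPair : g.IsNormalPair N (R + c • N) W
  smooth : ∀ q ∈ W, FunSmoothAt (m := m) c q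
  eq_zero : ∀ q ∈ W, q ∈ g.sing → c q = 0

theorem IsMainPair.exists_isAdaptedFrame (hNR : g.IsMainPair U N R)
    (hg : g.IsTransverseRiemannLorentz) (hU : IsOpen U) (hR : ∀ q ∈ U, bracket N R q = 0)
    (hp : p ∈ g.sing ∩ U) :
    ∃ (ι : Type) (_ : Fintype ι) (E F : ι → VField m M) (W : Set M) (c : M → ℝ), p ∈ W ∧
      g.IsCorrection U N R W c ∧ g.IsAdaptedFrame N (R + c • N) E F W := by
  obtain ⟨W, c, hpW, hWU, hP, hc, hc0⟩ := hNR.exists_isNormalPair hg hU hp hR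
  obtain ⟨ι, _, E, F, W', hpW', hW'W, hP', hE⟩ := hP.exists_isAdaptedFrame hg hpW hp.1
  exact ⟨ι, inferInstance, E, F, W', c, hpW', ⟨hW'W.trans hWU, hP', fun q hq ↦ hc q (hW'W hq),
    fun q hq hqs ↦ hc0 q (hW'W hq) hqs⟩, hE⟩

namespace IsCorrection

variable (hC : g.IsCorrection U N R W c) (hNR : g.IsMainPair U N R) (hU : IsOpen U) (hq : q ∈ W)
  (hqs : q ∈ g.sing)

include hC

theorem apply_eq (hq : q ∈ W) (hqs : q ∈ g.sing) : (R + c • N) q = R q := by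
  simp [hC.eq_zero q hq hqs]

include hNR hU in
theorem smooth_R (hq : q ∈ W) : SmoothAt R q := hNR.smooth_R.at hU (hC.subset hq)

include hq hqs

theorem dirDeriv_tangent (hA : g.pair A N q = 0) : dirDeriv A c q = 0 :=
  hC.normalPair.dirDeriv_eq_zero hq hqs hA (hC.smooth q hq) 0 hC.eq_zero

include hNR hU

/-- On Σ both `c` and its derivative in the tangent direction `A` vanish, so the Leibniz rule leaves
no trace of the correction. -/
theorem dual_mid (hA : SmoothAt A q) (hD : SmoothAt D q) (hAN : g.pair A N q = 0) :
    g.dual A (R + c • N) D q = g.dual A R D q := by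
  have hN := (hC.normalPair.smooth_N q hq).diff
  have hc := (hC.smooth q hq).diff
  rw [g.dual_add_mid hA.diff (hC.smooth_R hNR hU hq).diff (hN.smul hc) hD.diff,
    g.dual_smul_mid hc hA.diff hN hD.diff, hC.dirDeriv_tangent hq hqs hAN, hC.eq_zero q hq hqs]
  ring

theorem dual_right (hA : SmoothAt A q) (hB : SmoothAt B q) :
    g.dual A B (R + c • N) q = g.dual A B R q :=
  g.dual_congr_right hA.diff hB.diff (hC.normalPair.smooth_R q hq).diff
    (hC.smooth_R hNR hU hq).diff (hC.apply_eq hq hqs)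

theorem bracket_left (hAN : g.pair A N q = 0) :
    bracket (R + c • N) A q = bracket R A q := by
  have hN := (hC.normalPair.smooth_N q hq).diff
  have hc := (hC.smooth q hq).diff
  rw [bracket_add_left (hC.smooth_R hNR hU hq).diff (hN.smul hc), bracket_smul_left hc hN,
    hC.dirDeriv_tangent hq hqs hAN, hC.eq_zero q hq hqs]
  simp

/-- `V(⟨R, R⟩) = 2 ν(V)` along `Σ`. -/
theorem dirDeriv_norm_R : dirDeriv A (g.pair R R) q = 2 * g.pair A N q := by
  have hP := hC.normalPair
  have hN := g.smooth_pair (hP.smooth_N q hq) (hP.smooth_N q hq)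
  have hc := hC.smooth q hq
  have h1 : g.pair R R =ᶠ[𝓝 q] g.pair (R + c • N) (R + c • N) + c * (c * g.pair N N) := by
    filter_upwards [hP.eventually_mem hq] with s hs
    have h2 := hP.perp s hs
    simp only [pair_add_left, pair_add_right, pair_smul_left, pair_smul_right, Pi.add_apply,
      Pi.mul_apply, g.pair_comm N R] at h2 ⊢
    linear_combination -2 * c s * h2
  rw [dirDeriv_congr_fun h1, dirDeriv_add_fun (hP.smooth_t hq).diff (hc.mul (hc.mul hN)).diff,
    dirDeriv_mul_fun hc.diff (hc.mul hN).diff, dirDeriv_mul_fun hc.diff hN.diff,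
    hP.dirDeriv_t hq hqs, hC.eq_zero q hq hqs]
  simp only [Pi.mul_apply, hC.eq_zero q hq hqs]
  ring

omit hq hqs

theorem isLocalScreen (hV : g.IsScreen U N R V) : g.IsLocalScreen N (R + c • N) W V := by
  have hVs : ∀ q ∈ W, SmoothAt V q := fun q hq ↦ hV.1.at hU (hC.subset hq)
  have hVN : ∀ q ∈ W, q ∈ g.sing → g.pair V N q = 0 := fun q hq hqs ↦ by
    rw [pair_comm]
    exact hNR.normal q ⟨hqs, hC.subset hq⟩ _ (hV.2 q ⟨hqs, hC.subset hq⟩).1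
  refine ⟨hVs, hVN, fun q hq hqs ↦ ?_⟩
  rw [hC.dual_mid hNR hU hq hqs (hVs q hq) (hC.normalPair.smooth_N q hq) (hVN q hq hqs)]
  exact (hV.2 q ⟨hqs, hC.subset hq⟩).2

/-- Flatness over `U` speaks of fields on all of `U`, whereas frame fields are controlled only on
`W`; a cutoff supported in `W` bridges the two. -/
theorem isScreen_smul (hX : g.IsLocalScreen N (R + c • N) W X) {ψ : M → ℝ}
    (hψ : ∀ q, FunSmoothAt (m := m) ψ q) (hψW : tsupport ψ ⊆ W) : g.IsScreen U N R (ψ • X) := by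
  have hzero : ∀ q, q ∉ W → ψ • X =ᶠ[𝓝 q] 0 := by
    intro q hq
    have h1 : q ∈ (tsupport ψ)ᶜ := fun h ↦ hq (hψW h)
    filter_upwards [(isClosed_tsupport ψ).isOpen_compl.mem_nhds h1] with s hs
    rw [Pi.smul_apply', image_eq_zero_of_notMem_tsupport hs, zero_smul]
    rfl
  have hsm : ∀ q ∈ U, SmoothAt (ψ • X) q := by
    intro q hq
    by_cases hqW : q ∈ W
    · exact (hX.smooth q hqW).smul (hψ q)
    · have h0 : SmoothAt ((fun _ : M ↦ (0 : ℝ)) • R) q :=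
        .smul (.const 0) (hNR.smooth_R.at hU hq)
      refine h0.congr ((hzero q hqW).trans (.of_forall fun s ↦ ?_))
      exact (zero_smul ℝ (R s)).symm
  refine ⟨smoothOn_of_forall hsm, fun q hq ↦ ?_⟩
  by_cases hqW : q ∈ W
  · constructor
    · refine hC.normalPair.mem_tangentSing hqW hq.1 ?_
      rw [pair_smul_left, Pi.mul_apply, hX.normal q hqW hq.1, mul_zero]
    · have hXq := hX.smooth q hqW
      have hN := hC.normalPair.smooth_N q hqW
      rw [H, g.dual_smul_left (hψ q).diff hXq.diff (hC.smooth_R hNR hU hqW).diff hN.diff,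
        ← hC.dual_mid hNR hU hqW hq.1 hXq hN (hX.normal q hqW hq.1), hX.H_eq_zero q hqW hq.1,
        mul_zero]
  · have h0 := (hzero q hqW).self_of_nhds
    constructor
    · rw [h0]
      intro f _ _
      exact map_zero _
    · exact dual_left_eq_zero (hsm q hq.2).diff (hNR.smooth_R.at hU hq.2).diff
        (hNR.smooth_N.at hU hq.2).diff h0

theorem isLocalFlat [T2Space M] (hflat : g.IIFlat U N R) : g.IsLocalFlat N (R + c • N) W := by
  intro X Y hX hY q hq hqs
  obtain ⟨ψ, hψ, hψ1, hψW⟩ := exists_bump (m := m) hC.normalPair.isOpen hq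
  have h1 := hflat _ _ (hC.isScreen_smul hNR hU hX hψ hψW) (hC.isScreen_smul hNR hU hY hψ hψW)
    q ⟨hqs, hC.subset hq⟩
  have h2 : ∀ Z : VField m M, ψ • Z =ᶠ[𝓝 q] Z := fun Z ↦ by
    filter_upwards [hψ1] with s hs
    rw [Pi.smul_apply', hs, one_smul]
  rw [hC.dual_right hNR hU hq hqs (hX.smooth q hq) (hY.smooth q hq), ← h1, II]
  exact (g.dual_congr (h2 X) (h2 Y) (.refl _ R)).symm

end IsCorrection

/-! ### The forms `III` and `ρ` -/

/-- In an adapted frame the only coefficient of ∇_V X with a denominator vanishing on Σ is □_V X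
(R)/t, and II-flatness makes its numerator vanish on Σ. -/
theorem IsMainPair.exists_nabla_extension [T2Space M] (hNR : g.IsMainPair U N R)
    (hg : g.IsTransverseRiemannLorentz) (hU : IsOpen U) (hR : ∀ q ∈ U, bracket N R q = 0)
    (hflat : g.IIFlat U N R) (hV : g.IsScreen U N R V) (hX : g.IsScreen U N R X) :
    ∃ Z : VField m M, SmoothOn Z U ∧ ∀ p ∈ U \ g.sing, Z p = g.nabla V X p := by
  refine exists_smooth_extension hg hU fun p hp ↦ ?_
  by_cases hps : p ∈ g.sing
  · obtain ⟨ι, _, E, F, W, c, hpW, hC, hE⟩ := hNR.exists_isAdaptedFrame hg hU hR ⟨hps, hp⟩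
    have hP := hC.normalPair
    have hV' := hC.isLocalScreen hNR hU hV
    have hX' := hC.isLocalScreen hNR hU hX
    have hf : ∀ q ∈ W, FunSmoothAt (m := m) (g.dual V X (R + c • N)) q := fun q hq ↦
      g.smooth_dual (hV'.smooth q hq) (hX'.smooth q hq) (hP.smooth_R q hq)
    have hf0 : ∀ q ∈ W, q ∈ g.sing → g.dual V X (R + c • N) q = 0 :=
      hC.isLocalFlat hNR hU hflat _ _ hV' hX'
    refine ⟨g.quot N (R + c • N) (g.dual V X (R + c • N)) • (R + c • N)
      + (g.dual V X N * (g.pair N N)⁻¹) • N + ∑ i, g.dual V X (E i) • F i, ?_, ?_⟩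
    · have hN := hP.smooth_N p hpW
      have hVp := hV'.smooth p hpW
      have hXp := hX'.smooth p hpW
      exact .add (.add (.smul (hP.smooth_quot hf hf0 p hpW) (hP.smooth_R p hpW))
        (.smul (.mul (g.smooth_dual hVp hXp hN) (.inv (g.smooth_pair hN hN) (hP.norm_ne p hpW)))
          hN))
        (.sum fun i _ ↦ .smul (g.smooth_dual hVp hXp (hE.smooth_left i p hpW))
          (hE.smooth_right i p hpW))
    · filter_upwards [hP.isOpen.mem_nhds hpW] with q hq hqs
      have hsum : (∑ i, g.dual V X (E i) • F i : VField m M) q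
          = ∑ i, g.dual V X (E i) q • F i q :=
        Finset.sum_apply q _ (fun i ↦ g.dual V X (E i) • F i)
      have hVq := (hV'.smooth q hq).diff
      have hXq := (hX'.smooth q hq).diff
      have h1 : ∀ i, g.form q (g.nabla V X q) (E i q) = g.dual V X (E i) q := fun i ↦
        form_nabla hqs hVq hXq (hE.smooth_left i q hq).diff
      have h2 := form_nabla hqs hVq hXq (hP.smooth_R q hq).diff
      have h3 := form_nabla hqs hVq hXq (hP.smooth_N q hq).diff
      rw [← hE.complete q hq hqs (g.nabla V X q), Pi.add_apply, hsum]
      simp only [h1, h2, h3]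
      simp only [Pi.add_apply (g.quot N (R + c • N) (g.dual V X (R + c • N)) • (R + c • N))]
      simp only [Pi.smul_apply', Pi.mul_apply, Pi.inv_apply, quot, if_neg hqs, div_eq_mul_inv]
  · exact ⟨g.nabla V X, smooth_nabla hps (hV.1.at hU hp) (hX.1.at hU hp), .of_forall fun _ _ ↦ rfl⟩

/-- For Z the extension of ∇_V X, the form is □_Z R (R), half of Z⟨R, R⟩, hence ν(Z); by continuity
from off Σ the normal component of Z is □_V X (N). -/
theorem IsMainPair.III_eq [T2Space M] (hNR : g.IsMainPair U N R)
    (hg : g.IsTransverseRiemannLorentz) (hU : IsOpen U) (hR : ∀ q ∈ U, bracket N R q = 0)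
    (hflat : g.IIFlat U N R) (hV : g.IsScreen U N R V) (hX : g.IsScreen U N R X)
    (hp : p ∈ g.sing ∩ U) : g.III U R V X R p = g.dual V X N p := by
  have hex := hNR.exists_nabla_extension hg hU hR hflat hV hX
  obtain ⟨hZ, hZn⟩ : SmoothOn (g.nablaExt U V X) U ∧
      ∀ p ∈ U \ g.sing, g.nablaExt U V X p = g.nabla V X p := by
    rw [nablaExt, dif_pos hex]
    exact hex.choose_spec
  obtain ⟨ι, _, E, F, W, c, hpW, hC, -⟩ := hNR.exists_isAdaptedFrame hg hU hR hp
  have hN := hNR.smooth_N.at hU hp.2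
  have h1 : g.pair (g.nablaExt U V X) N p = g.dual V X N p := by
    refine hg.eq_of_eq_off (g.smooth_pair (hZ.at hU hp.2) hN).continuousAt
      (g.smooth_dual (hV.1.at hU hp.2) (hX.1.at hU hp.2) hN).continuousAt ?_
    filter_upwards [hU.mem_nhds hp.2] with q hq hqs
    rw [pair, hZn q ⟨hq, hqs⟩, form_nabla hqs (hV.1.at hU hq).diff (hX.1.at hU hq).diff
      (hNR.smooth_N.at hU hq).diff]
  rw [III, II, dual_self, hC.dirDeriv_norm_R hNR hU hpW hp.1, h1]
  ring

/-- The bracket is tangent to Σ, so the ν-term in ρ drops out; reversing the bracket absorbs the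
sign in ρ. -/
theorem IsCorrection.rho_eq (hC : g.IsCorrection U N R W c) (hNR : g.IsMainPair U N R)
    (hU : IsOpen U) (hV : g.IsScreen U N R V) (hq : q ∈ W) (hqs : q ∈ g.sing) :
    g.rho N R (bracket V R) q = g.dual (bracket (R + c • N) V) (R + c • N) N q := by
  have hP := hC.normalPair
  have hV' := hC.isLocalScreen hNR hU hV
  have hVq := hV'.smooth q hq
  have hRq := hC.smooth_R hNR hU hq
  have hN := hP.smooth_N q hq
  have h1 : g.pair (bracket (R + c • N) V) N q = 0 :=
    hP.pair_bracket_N hq hqs (hP.smooth_R q hq) hVq (fun s hs _ ↦ hP.perp s hs) hV'.normal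
  have h2 : bracket (R + c • N) V q = - bracket V R q := by
    rw [hC.bracket_left hNR hU hq hqs (hV'.normal q hq hqs), bracket_swap]
  have h3 : g.nu N (bracket V R) q = 0 := by
    rw [pair, h2, map_neg, neg_apply, neg_eq_zero] at h1
    exact h1
  have h4 : SmoothAt (bracket V R - g.nu N (bracket V R) • N) q :=
    (hVq.bracket hRq).sub (.smul (g.smooth_pair (hVq.bracket hRq) hN) hN)
  have h5 := g.dual_smul_left (f := fun _ : M ↦ (-1 : ℝ)) mdifferentiableAt_const h4.diff hRq.diff
    hN.diff
  rw [hC.dual_mid hNR hU hq hqs ((hP.smooth_R q hq).bracket hVq) hN h1,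
    g.dual_congr_left ((hP.smooth_R q hq).bracket hVq).diff
      (DiffAt.smul mdifferentiableAt_const h4.diff) hRq.diff hN.diff, h5, rho, H]
  · rw [neg_one_mul]
    rfl
  · rw [h2, Pi.smul_apply', Pi.sub_apply, Pi.smul_apply', h3]
    simp

end SymTensor

namespace SymTensor

namespace IsMainPair

variable {g : SymTensor m M} {p q : M} {N R N' R' V V' X X' Y : VField m M} {U W : Set M}

variable (hNR : g.IsMainPair U N R) (hg : g.IsTransverseRiemannLorentz) (hU : IsOpen U)
  (hR : ∀ p ∈ U, bracket N R p = 0)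

include hNR hg hU hR

/-! ### The Ricci curvature along the main normal and radical fields -/

/-- A smooth extension would give t² Ric the boundary value 0, but it is -ν(N)² = -1. -/
theorem not_goodLimit_ric_normal (hUS : (g.sing ∩ U).Nonempty) (hN' : g.IsExtension U N' N) :
    ¬ g.GoodLimit U (g.ric N' N') := by
  rintro ⟨f, hf, hfr⟩
  obtain ⟨p, hp⟩ := hUS
  obtain ⟨ι, _, E, F, W, c, hpW, hC, hE⟩ := hNR.exists_isAdaptedFrame hg hU hR hp
  have hP := hC.normalPair
  have hs : ∀ q ∈ W, SmoothAt N' q := fun q hq ↦ hN'.1.at hU (hC.subset hq)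
  obtain ⟨S, hS, hSr, hS0⟩ := hE.exists_t_sq_ric hP hs hs
  have ht := hP.smooth_t hpW
  have h1 : FunSmoothAt (m := m) (g.pair (R + c • N) (R + c • N) * g.pair (R + c • N) (R + c • N)
      * f) p := .mul (.mul ht ht) (hf.contMDiffAt (hU.mem_nhds hp.2))
  have h2 := hg.eq_of_eq_off (hS p hpW).continuousAt h1.continuousAt (by
    filter_upwards [hP.isOpen.mem_nhds hpW] with q hq hqs
    rw [← hSr q hq hqs, Pi.mul_apply, Pi.mul_apply, hfr q ⟨hC.subset hq, hqs⟩, sq])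
  rw [hS0 p hpW hp.1, Pi.mul_apply, Pi.mul_apply, hP.t_eq_zero hpW hp.1, pair, hN'.2 p hp] at h2
  have h3 := hNR.unit p hp
  rw [pair] at h3
  rw [h3] at h2
  norm_num at h2

/-- The canonical pair (N, V) has residue -ρ([V, R]), and adding τX to V contributes -ν(N)ν(X) =
-ν(X). The extension of N is irrelevant because its change is multiplied by ν(V) = 0. -/
theorem goodLimit_ric_normal_screen_iff (hN' : g.IsExtension U N' N) (hV : g.IsScreen U N R V)
    (hNV : ∀ p ∈ U, bracket N V p = 0) (hX : SmoothOn X U) :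
    g.GoodLimit U (g.ric N' (g.addTau R V X)) ↔
      ∀ p ∈ g.sing ∩ U, g.rho N R (bracket V R) p + g.nu N X p = 0 := by
  have hsm : ∀ q ∈ U, SmoothAt (g.addTau R V X) q := fun q hq ↦
    (hV.1.at hU hq).add (.smul (g.smooth_pair (hNR.smooth_R.at hU hq) (hNR.smooth_R.at hU hq))
      (hX.at hU hq))
  refine (goodLimit_ric_iff hg hU hN'.1 (smoothOn_of_forall hsm)
    (fun q ↦ -(g.rho N R (bracket V R) q + g.nu N X q)) fun p hp ↦ ?_).trans
    (by simp only [neg_eq_zero])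
  obtain ⟨ι, _, E, F, W, c, hpW, hC, hE⟩ := hNR.exists_isAdaptedFrame hg hU hR hp
  have hP := hC.normalPair
  have hV' := hC.isLocalScreen hNR hU hV
  refine ⟨W, N, R + c • N, hpW, hC.subset, hP, ?_⟩
  have hbase := hE.hasRicPole hP hP.smooth_N hV'.smooth fun q hq hqs ↦ by
    rw [hV'.normal q hq hqs, mul_zero]
  refine (hbase.of_eq_on_sing hP hE hP.smooth_N hV'.smooth
    (fun q hq ↦ hN'.1.at hU (hC.subset hq)) (fun q hq ↦ hsm q (hC.subset hq))
    (fun q hq hqs ↦ hN'.2 q ⟨hqs, hC.subset hq⟩) fun q hq hqs ↦ ?_).congr fun q hq hqs ↦ ?_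
  · rw [addTau, pair, hNR.radical q ⟨hqs, hC.subset hq⟩, zero_smul, add_zero]
  · have hRq := hC.smooth_R hNR hU hq
    have h0 : g.pair R R q = 0 := hNR.radical q ⟨hqs, hC.subset hq⟩ _
    have h1 : g.pair (g.addTau R V X) N - g.pair V N = g.pair R R * g.pair X N := by
      change g.pair (V + g.pair R R • X) N - _ = _
      rw [pair_add_left, pair_smul_left, add_sub_cancel_left]
    have h2 := hE.ricPole_N_screen hP hV'
      (fun s hs _ ↦ hNV s (hC.subset hs)) hq hqs
    rw [h1, dirDeriv_mul_fun (g.smooth_pair hRq hRq).diff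
      (g.smooth_pair (hX.at hU (hC.subset hq)) (hP.smooth_N q hq)).diff,
      hC.dirDeriv_norm_R hNR hU hq hqs, hP.unit q hq hqs, hV'.normal q hq hqs, h0,
      hC.rho_eq hNR hU hV hq hqs]
    change _ = -(_ + g.pair X N q)
    linear_combination h2

/-- The base pair is (N, R + cN), with residue 0. The passage to R + τX changes the normal component
by ⟨R, N⟩ + τ⟨X, N⟩, whose N-derivative on Σ is 2ν(X) because N⟨R, N⟩ = 0. -/
theorem goodLimit_ric_normal_radical_iff [T2Space M] (hflat : g.IIFlat U N R)
    (hN' : g.IsExtension U N' N) (hX : SmoothOn X U) :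
    g.GoodLimit U (g.ric N' (g.addTau R R X)) ↔ ∀ p ∈ g.sing ∩ U, g.nu N X p = 0 := by
  have hRs : ∀ q ∈ U, SmoothAt R q := fun q hq ↦ hNR.smooth_R.at hU hq
  have hsm : ∀ q ∈ U, SmoothAt (g.addTau R R X) q := fun q hq ↦
    (hRs q hq).add (.smul (g.smooth_pair (hRs q hq) (hRs q hq)) (hX.at hU hq))
  refine (goodLimit_ric_iff hg hU hN'.1 (smoothOn_of_forall hsm)
    (fun q ↦ -(g.nu N X q)) fun p hp ↦ ?_).trans (by simp only [neg_eq_zero])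
  obtain ⟨ι, _, E, F, W, c, hpW, hC, hE⟩ := hNR.exists_isAdaptedFrame hg hU hR hp
  have hP := hC.normalPair
  have hflat' := hC.isLocalFlat hNR hU hflat
  refine ⟨W, N, R + c • N, hpW, hC.subset, hP, ?_⟩
  have hbase := hE.hasRicPole hP hP.smooth_N hP.smooth_R fun q hq hqs ↦ by
    rw [hP.perp q hq, mul_zero]
  refine (hbase.of_eq_on_sing hP hE hP.smooth_N hP.smooth_R
    (fun q hq ↦ hN'.1.at hU (hC.subset hq)) (fun q hq ↦ hsm q (hC.subset hq))
    (fun q hq hqs ↦ hN'.2 q ⟨hqs, hC.subset hq⟩) fun q hq hqs ↦ ?_).congr fun q hq hqs ↦ ?_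
  · rw [addTau, pair, hNR.radical q ⟨hqs, hC.subset hq⟩, zero_smul, add_zero,
      hC.apply_eq hq hqs]
  · have hq' := hC.subset hq
    have hRq := hRs q hq'
    have hNq := hP.smooth_N q hq
    have h0 : g.pair R R q = 0 := hNR.radical q ⟨hqs, hq'⟩ _
    have h1 : g.pair (g.addTau R R X) N - g.pair (R + c • N) N
        =ᶠ[nhds q] g.pair R N + g.pair R R * g.pair X N := by
      filter_upwards [hP.eventually_mem hq] with s hs
      rw [Pi.sub_apply, hP.perp s hs, sub_zero]
      change g.pair (R + g.pair R R • X) N s = _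
      rw [pair_add_left, pair_smul_left]
    have h3 := (g.smooth_pair hRq hRq).diff
    have h4 := (g.smooth_pair (hX.at hU hq') hNq).diff
    rw [dirDeriv_congr_fun h1, dirDeriv_add_fun (g.smooth_pair hRq hNq).diff
      ((g.smooth_pair hRq hRq).mul (g.smooth_pair (hX.at hU hq') hNq)).diff,
      dirDeriv_mul_fun h3 h4, hNR.dirDeriv_pair_R_N hg hU ⟨hqs, hq'⟩ (hR q hq'),
      hC.dirDeriv_norm_R hNR hU hq hqs, hP.unit q hq hqs, hP.perp q hq, h0,
      hE.ricPole_N_R hP hflat' hq hqs, hP.dirDeriv_N_dual_R_R_R hq hqs]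
    change _ = -(g.pair X N q)
    ring

theorem goodLimit_ric_radical_screen (hR' : g.IsExtension U R' R) (hV : g.IsScreen U N R V)
    (hV' : g.IsExtension U V' V) : g.GoodLimit U (g.ric R' V') := by
  refine (goodLimit_ric_iff hg hU hR'.1 hV'.1 (fun _ ↦ 0) fun p hp ↦ ?_).2 fun _ _ ↦ rfl
  obtain ⟨ι, _, E, F, W, c, hpW, hC, hE⟩ := hNR.exists_isAdaptedFrame hg hU hR hp
  have hP := hC.normalPair
  have hVl := hC.isLocalScreen hNR hU hV
  refine ⟨W, N, R + c • N, hpW, hC.subset, hP, ?_⟩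
  have hbase := hE.hasRicPole hP hP.smooth_R hVl.smooth fun q hq hqs ↦ by
    rw [hP.perp q hq, zero_mul]
  refine (hbase.of_eq_on_sing hP hE hP.smooth_R hVl.smooth
    (fun q hq ↦ hR'.1.at hU (hC.subset hq)) (fun q hq ↦ hV'.1.at hU (hC.subset hq))
    (fun q hq hqs ↦ ?_) fun q hq hqs ↦ hV'.2 q ⟨hqs, hC.subset hq⟩).congr fun q hq hqs ↦ ?_
  · rw [hC.apply_eq hq hqs, hR'.2 q ⟨hqs, hC.subset hq⟩]
  · rw [hP.perp q hq, hVl.normal q hq hqs, hE.ricPole_R_screen hP hVl hq hqs]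
    ring

theorem not_goodLimit_ric_radical (hUS : (g.sing ∩ U).Nonempty) (hR' : g.IsExtension U R' R) :
    ¬ g.GoodLimit U (g.ric R' R') := by
  obtain ⟨p, hp⟩ := hUS
  intro h
  have h1 := (goodLimit_ric_iff hg hU hR'.1 hR'.1 (fun _ ↦ -1) fun p hp ↦ ?_).1 h p hp
  · norm_num at h1
  obtain ⟨ι, _, E, F, W, c, hpW, hC, hE⟩ := hNR.exists_isAdaptedFrame hg hU hR hp
  have hP := hC.normalPair
  refine ⟨W, N, R + c • N, hpW, hC.subset, hP, ?_⟩
  have hbase := hE.hasRicPole hP hP.smooth_R hP.smooth_R fun q hq hqs ↦ by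
    rw [hP.perp q hq, zero_mul]
  have hs : ∀ q ∈ W, SmoothAt R' q := fun q hq ↦ hR'.1.at hU (hC.subset hq)
  have he : ∀ q ∈ W, q ∈ g.sing → R' q = (R + c • N) q := fun q hq hqs ↦ by
    rw [hC.apply_eq hq hqs, hR'.2 q ⟨hqs, hC.subset hq⟩]
  refine (hbase.of_eq_on_sing hP hE hP.smooth_R hP.smooth_R hs hs he he).congr fun q hq hqs ↦ ?_
  rw [hP.perp q hq, hE.ricPole_R_R hP hq hqs]
  ring

theorem goodLimit_ric_screen_iff [T2Space M] (hflat : g.IIFlat U N R) (hV : g.IsScreen U N R V)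
    (hX : g.IsScreen U N R X) (hV' : g.IsExtension U V' V) (hX' : g.IsExtension U X' X) :
    g.GoodLimit U (g.ric V' X') ↔ ∀ p ∈ g.sing ∩ U, g.III U R V X R p = 0 := by
  have hIII := fun p hp ↦ hNR.III_eq hg hU hR hflat hV hX (p := p) hp
  refine (goodLimit_ric_iff hg hU hV'.1 hX'.1 (fun q ↦ - g.dual V X N q) fun p hp ↦ ?_).trans
    (forall₂_congr fun p hp ↦ by rw [hIII p hp, neg_eq_zero])
  obtain ⟨ι, _, E, F, W, c, hpW, hC, hE⟩ := hNR.exists_isAdaptedFrame hg hU hR hp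
  have hP := hC.normalPair
  have hVl := hC.isLocalScreen hNR hU hV
  have hXl := hC.isLocalScreen hNR hU hX
  refine ⟨W, N, R + c • N, hpW, hC.subset, hP, ?_⟩
  have hbase := hE.hasRicPole hP hVl.smooth hXl.smooth fun q hq hqs ↦ by
    rw [hVl.normal q hq hqs, zero_mul]
  refine (hbase.of_eq_on_sing hP hE hVl.smooth hXl.smooth
    (fun q hq ↦ hV'.1.at hU (hC.subset hq)) (fun q hq ↦ hX'.1.at hU (hC.subset hq))
    (fun q hq hqs ↦ hV'.2 q ⟨hqs, hC.subset hq⟩)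
    fun q hq hqs ↦ hX'.2 q ⟨hqs, hC.subset hq⟩).congr fun q hq hqs ↦ ?_
  rw [hVl.normal q hq hqs, hXl.normal q hq hqs,
    hE.ricPole_screen_screen hP (hC.isLocalFlat hNR hU hflat) hVl hXl hq hqs]
  ring

end IsMainPair

end SymTensor

end RiemannLorentz

end

theorem mainTheorem10 {m : ℕ} (hm : 2 < m) {M : Type*} [TopologicalSpace M] [T2Space M]
    [ChartedSpace (EuclideanSpace ℝ (Fin m)) M] [IsManifold (𝓡 m) ∞ M]
    (g : RiemannLorentz.SymTensor m M) (hg : g.IsTransverseRiemannLorentz)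
    (U : Set M) (hU : IsOpen U) (hUS : (g.sing ∩ U).Nonempty)
    (N R : RiemannLorentz.VField m M) (hNR : g.IsMainPair U N R)
    (hN : g.IsGeodesicOff U N) (hR : ∀ p ∈ U, RiemannLorentz.bracket N R p = 0) :
    -- (a)
    (∀ N', g.IsExtension U N' N → ¬ g.GoodLimit U (g.ric N' N')) ∧
    -- (b)
    (∀ N' V Vbar, g.IsExtension U N' N → g.IsScreen U N R V →
      (∀ p ∈ U, RiemannLorentz.bracket N V p = 0) → RiemannLorentz.SmoothOn Vbar U →
      (g.GoodLimit U (g.ric N' (g.addTau R V Vbar)) ↔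
        ∀ p ∈ g.sing ∩ U,
          g.rho N R (RiemannLorentz.bracket V R) p + g.nu N Vbar p = 0)) ∧
    -- (c)
    (g.IIFlat U N R → ∀ N' Rbar, g.IsExtension U N' N → RiemannLorentz.SmoothOn Rbar U →
      (g.GoodLimit U (g.ric N' (g.addTau R R Rbar)) ↔
        ∀ p ∈ g.sing ∩ U, g.nu N Rbar p = 0)) ∧
    -- (d)
    (∀ R' V V', g.IsExtension U R' R → g.IsScreen U N R V → g.IsExtension U V' V →
      g.GoodLimit U (g.ric R' V')) ∧
    -- (e)
    (∀ R', g.IsExtension U R' R → ¬ g.GoodLimit U (g.ric R' R')) ∧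
    -- (f)
    (g.IIFlat U N R →
      ∀ e₁ e₂ : RiemannLorentz.VField m M → RiemannLorentz.VField m M,
        (∀ V, g.IsScreen U N R V → g.IsExtension U (e₁ V) V ∧ g.IsExtension U (e₂ V) V) →
        ((∀ V W, g.IsScreen U N R V → g.IsScreen U N R W →
            g.GoodLimit U (g.ric (e₁ V) (e₂ W))) ↔
          g.IIIFlat U N R)) := by
  refine ⟨fun N' hN' ↦ hNR.not_goodLimit_ric_normal hg hU hR hUS hN',
    fun N' V X hN' hV hNV hX ↦ hNR.goodLimit_ric_normal_screen_iff hg hU hR hN' hV hNV hX,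
    fun hflat N' X hN' hX ↦ hNR.goodLimit_ric_normal_radical_iff hg hU hR hflat hN' hX,
    fun R' V V' hR' hV hV' ↦ hNR.goodLimit_ric_radical_screen hg hU hR hR' hV hV',
    fun R' hR' ↦ hNR.not_goodLimit_ric_radical hg hU hR hUS hR', fun hflat e₁ e₂ he ↦ ?_⟩
  -- The equivalence holds for each pair of sections separately and for any extensions, so the
  -- choice functions `e₁`, `e₂` play no role.
  have key := fun V W hV hW ↦ hNR.goodLimit_ric_screen_iff hg hU hR hflat (V := V) (X := W) hV hW
    (he V hV).1 (he W hW).2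
  exact ⟨fun h ↦ ⟨hflat, fun V W hV hW ↦ (key V W hV hW).1 (h V W hV hW)⟩,
    fun h V W hV hW ↦ (key V W hV hW).2 (h.2 V W hV hW)⟩
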